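/- **Conventions.** Names are infinite binary strings; sequences of rationals, of rational points of $\mathbb{R}^D$ and of rational balls are encoded as such strings in a standard way, and $\langle\cdot,\ldots,\cdot\rangle$ is a standard pairing of natural numbers. A function $f:A\to B$ is $(\alpha\to\beta)$-computable if some deterministic Type-2 machine (one-way input tape, one-way output tape) transforms every $\alpha$-name of every $a\in A$ into a $\beta$-name of $f(a)$. It is nondeterministically $(\alpha\to\beta)$-computable if there is a Type-2 machine, allowed a binary choice at each step, which on every $\alpha$-name of every $a\in A$ has a computation that outputs a $\beta$-name of $f(a)$, and for which every infinite output of a computation on such a name is a $\beta$-name of $f(a)$ (computations that stop or produce only finitely many symbols are disregarded). The following representations are used. - $\rho$: $x\in\mathbb{R}^D$ is named by a sequence $(p_m)$ of rational points with $|x-p_m|\le 2^{-m}$ for all $m$; put $\rho^{(0)}=\rho$. - $\rho^{(d)}$, $d\ge1$: $y\in\mathbb{R}$ is named by a rational sequence $p$ with $y=\lim_{n_1}\lim_{n_2}\cdots\lim_{n_d}p_{\langle n_1,\ldots,n_d\rangle}$ (all limits existing in $\mathbb{R}$). - $\rho_<^{(d)}$, $d\ge0$: $y\in\mathbb{R}$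 is named by a rational sequence $p$ with $y=\sup_{n_0}\inf_{n_1}\sup_{n_2}\cdots p_{\langle n_0,\ldots,n_d\rangle}$ ($d+1$ alternating extrema, taken in $[-\infty,\infty]$). - $\rho_>$: $y\in\mathbb{R}$ is named by a rational sequence $p$ with $y=\inf_m p_m$. - $\theta_<$: an open set $U$ is named by a list of open rational balls (the empty ball being allowed) whose union is $U$. - For $X\subseteq\mathbb{R}^D$ open, $\mathbf\Sigma_1(X)$ is the class of open subsets of $X$, and $\mathbf\Sigma_{d+1}(X)$ is the class of the sets $\bigcup_m (X\setminus S_m)$ with $S_m\in\mathbf\Sigma_d(X)$. The representation $\delta_{\mathbf\Sigma_1}$ of $\mathbf\Sigma_1(X)$ is $\theta_<$, and a $\delta_{\mathbf\Sigma_{d+1}}$-name of $S$ is the join of $\delta_{\mathbf\Sigma_d}$-names of sets $S_m\in\mathbf\Sigma_d(X)$, $m\in\mathbb{N}$, with $S=\bigcup_m(X\setminus S_m)$. A function $f:X\to\mathbb{R}$ is *effectively $\mathbf\Sigma_d$-measurable* if $f^{-1}[V]\in\mathbf\Sigma_d(X)$ for every open $V\subseteq\mathbb{R}$ and the map $V\mapsto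 f^{-1}[V]$ is $(\theta_<\to\delta_{\mathbf\Sigma_d})$-computable. **Theorem.** Let $D\in\mathbb{N}$, let $X\subseteq\mathbb{R}^D$ be recursively open (i.e. $X$ has a computable $\theta_<$-name), let $f:X\to\mathbb{R}$, and let $d\ge1$. (a) $f$ is $(\rho\to\rho^{(d-1)})$-computable if and only if it is effectively $\mathbf\Sigma_d$-measurable. (b) $f$ is $(\rho\to\rho_<^{(d-1)})$-computable if and only if $f^{-1}[(y,\infty)]\in\mathbf\Sigma_d(X)$ for every $y\in\mathbb{R}$ and the map $\mathbb{R}\ni y\mapsto f^{-1}[(y,\infty)]\in\mathbf\Sigma_d(X)$ is $(\rho_>\to\delta_{\mathbf\Sigma_d})$-computable. (c) There is a total function $g:\mathbb{R}\to\mathbb{R}$ that is nondeterministically $(\rho\to\rho)$-computable but is not $(\rho\to\rho^{(d)})$-computable for any $d\in\mathbb{N}$. -/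

import Mathlib

open Filter Topology

namespace TTE

/-! Type-2 machines -/

/-- A (nondeterministic) Type-2 machine over the alphabet `{0,1}`, with a one-way read-only input
tape, a one-way write-only output tape and an unrestricted work memory whose contents (finite
control and work tapes) are coded by a natural number; the initial memory is `0`.
`step g q a` is the effect of one step with binary choice `g`, memory `q` and scanned input symbol
`a`: either the machine stops (`none`), or it gets `some (q', mv, o)` where `q'` is the new memory,
`mv` says whether the input head advances by one cell, and `o` is the symbol (if any) that is
appended to the output. The effect of a step has to be computable (partial recursive and total);
steps of Turing machines are, and conversely a Turing machine carries out a computable step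
by finitely many elementary ones. -/
structure Machine where
  step : Bool → ℕ → Bool → Option (ℕ × Bool × Option Bool)
  computable_step : Computable fun p : Bool × ℕ × Bool => step p.1 p.2.1 p.2.2

/-- A machine is deterministic if its steps do not depend on the binary choices. -/
def Machine.Deterministic (M : Machine) : Prop :=
  ∀ q a, M.step false q a = M.step true q a

/-- Configurations: memory, position of the input head, output written so far. -/
structure Config where
  mem : ℕ
  pos : ℕ
  out : List Bool

/-- The configuration after one step with choice `g` on the input string `σ`. -/
def Machine.next (M : Machine) (σ : ℕ → Bool) (g : Bool) (c : Config) : Option Config :=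
  (M.step g c.mem (σ c.pos)).map fun r =>
    { mem := r.1
      pos := if r.2.1 then c.pos + 1 else c.pos
      out := c.out ++ r.2.2.toList }

/-- `c` is an infinite computation of `M` on the input string `σ`. -/
def Machine.IsComputation (M : Machine) (σ : ℕ → Bool) (c : ℕ → Config) : Prop :=
  c 0 = { mem := 0, pos := 0, out := [] } ∧ ∀ n, ∃ g, M.next σ g (c n) = some (c (n + 1))

/-- The infinite computation `c` outputs the infinite string `τ`. -/
def Outputs (c : ℕ → Config) (τ : ℕ → Bool) : Prop :=
  ∀ n, ∃ k, (c k).out = (List.range n).map τ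

/-! Representations and computability relative to them -/

/-- A representation of `A`, as the relation "the infinite string `σ` is a name of `a`". -/
abbrev Rep (A : Type*) := (ℕ → Bool) → A → Prop

/-- `(α → β)`-computability of a function `f`. -/
def IsComputableFun {A B : Type*} (α : Rep A) (β : Rep B) (f : A → B) : Prop :=
  ∃ M : Machine, M.Deterministic ∧ ∀ σ a, α σ a →
    ∃ c τ, M.IsComputation σ c ∧ Outputs c τ ∧ β τ (f a)

/-- Nondeterministic `(α → β)`-computability of `f`: on each name of `a` some computation outputs
a name of `f a`, and every infinite output of a computation is a name of `f a`. -/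
def IsNondetComputableFun {A B : Type*} (α : Rep A) (β : Rep B) (f : A → B) : Prop :=
  ∃ M : Machine, ∀ σ a, α σ a →
    (∃ c τ, M.IsComputation σ c ∧ Outputs c τ ∧ β τ (f a)) ∧
    ∀ c τ, M.IsComputation σ c → Outputs c τ → β τ (f a)

/-- `a` is `α`-computable: it has a computable name. -/
def IsComputablePt {A : Type*} (α : Rep A) (a : A) : Prop :=
  ∃ σ : ℕ → Bool, Computable σ ∧ α σ a

/-- The infinite binary string coding a sequence of natural numbers (by its graph). -/
def seqCode (s : ℕ → ℕ) : ℕ → Bool :=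
  fun k => decide (s k.unpair.1 = k.unpair.2)

/-- A notion of names that are sequences of natural numbers, turned into a representation. -/
def ofSeq {A : Type*} (R : (ℕ → ℕ) → A → Prop) : Rep A :=
  fun σ a => ∃ s, σ = seqCode s ∧ R s a

/-- The standard numbering `⟨⟨i, j⟩, k⟩ ↦ (i - j) / (k + 1)` of the rationals. -/
def ratNum (n : ℕ) : ℚ :=
  ((n.unpair.1.unpair.1 : ℚ) - (n.unpair.1.unpair.2 : ℚ)) / ((n.unpair.2 : ℚ) + 1)

/-- The numbering of the rational points of the real line. -/
noncomputable def realPt (n : ℕ) : ℝ := (ratNum n : ℝ)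

/-- The numbering of the rational points of `ℝ^D`: a natural number codes a list of natural
numbers, whose first `D` entries (0 when missing) number the coordinates. -/
noncomputable def vecPt (D : ℕ) (n : ℕ) : EuclideanSpace ℝ (Fin D) :=
  WithLp.toLp 2 fun i => realPt ((Denumerable.ofNat (List ℕ) n).getD i 0)

/-- The numbering of the open balls with centre in a numbered set of points and rational radius;
balls of radius at most 0 are empty. -/
def ratBall {E : Type*} [PseudoMetricSpace E] (pt : ℕ → E) (n : ℕ) : Set E :=
  Metric.ball (pt n.unpair.1) (ratNum n.unpair.2 : ℝ)

/-! Representations of points -/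

/-- `ρ`: a name of `x` is a sequence of rational points `p_m` with `|x - p_m| ≤ 2^(-m)`. -/
def rho {E : Type*} [PseudoMetricSpace E] (pt : ℕ → E) : Rep E :=
  ofSeq fun s x => ∀ m, dist x (pt (s m)) ≤ (1 / 2 : ℝ) ^ m

/-- `IsIterLim d p y` says `y = lim_{n_0} lim_{n_1} ⋯ lim_{n_d} p ⟨n_0, ⟨n_1, …, n_d⟩⟩`
(`d + 1` limits, all of which exist in `ℝ`). -/
def IsIterLim : ℕ → (ℕ → ℝ) → ℝ → Prop
  | 0, p, y => Tendsto p atTop (𝓝 y)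
  | d + 1, p, y => ∃ z : ℕ → ℝ,
      (∀ n, IsIterLim d (fun k => p (Nat.pair n k)) (z n)) ∧ Tendsto z atTop (𝓝 y)

/-- `ρ^(d)`: the representation of `ℝ` by rational sequences with `d`-fold iterated limits
(for `d = 0` by fast convergent ones). -/
def rhoJump : ℕ → Rep ℝ
  | 0 => rho realPt
  | d + 1 => ofSeq fun s y => IsIterLim d (fun n => realPt (s n)) y

mutual
/-- `sup_{n_0} inf_{n_1} sup_{n_2} ⋯ p ⟨n_0, ⟨n_1, …, n_d⟩⟩` in the extended reals
(`d + 1` alternating extrema). -/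
noncomputable def iterSup : ℕ → (ℕ → EReal) → EReal
  | 0, p => ⨆ n, p n
  | d + 1, p => ⨆ n, iterInf d fun k => p (Nat.pair n k)
/-- `inf_{n_0} sup_{n_1} inf_{n_2} ⋯ p ⟨n_0, ⟨n_1, …, n_d⟩⟩` in the extended reals
(`d + 1` alternating extrema). -/
noncomputable def iterInf : ℕ → (ℕ → EReal) → EReal
  | 0, p => ⨅ n, p n
  | d + 1, p => ⨅ n, iterSup d fun k => p (Nat.pair n k)
end

/-- `ρ_<^(d)`: a name of `y` is a rational sequence with
`y = sup_{n_0} inf_{n_1} sup_{n_2} ⋯ p ⟨n_0, …, n_d⟩`. -/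
def rhoLowerJump (d : ℕ) : Rep ℝ :=
  ofSeq fun s y => (y : EReal) = iterSup d fun n => (realPt (s n) : EReal)

/-- `ρ_>`: a name of `y` is a rational sequence with infimum `y`. -/
def rhoUpper : Rep ℝ :=
  ofSeq fun s y => (y : EReal) = ⨅ n, (realPt (s n) : EReal)

/-! Representations of sets -/

/-- `θ_<`: a name of `U` is a list of rational open balls with union `U`. -/
def theta {E : Type*} [PseudoMetricSpace E] (pt : ℕ → E) : Rep (Set E) :=
  ofSeq fun s U => U = ⋃ m, ratBall pt (s m)

/-- Recursively open subsets of `ℝ^D`. -/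
def IsRecursivelyOpen {D : ℕ} (X : Set (EuclideanSpace ℝ (Fin D))) : Prop :=
  IsComputablePt (theta (vecPt D)) X

/-- The finite levels `Σ_d(Y)`, `d ≥ 1`, of the Borel hierarchy of a topological space `Y`. -/
def IsBorelSigma {Y : Type*} [TopologicalSpace Y] : ℕ → Set Y → Prop
  | 0, _ => False
  | 1, S => IsOpen S
  | d + 2, S => ∃ T : ℕ → Set Y, (∀ m, IsBorelSigma (d + 1) (T m)) ∧ S = ⋃ m, (T m)ᶜ

/-- Sequence names of the sets in `Σ_d(X)`, `d ≥ 1`: for `d = 1` a list of rational balls of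
`ℝ^D` with union `S`; for `d + 1` a join of names of sets `T_m` in `Σ_d(X)` with
`S = ⋃ m, X \ T_m`. -/
def IsSigmaSeq {D : ℕ} (X : Set (EuclideanSpace ℝ (Fin D))) : ℕ → (ℕ → ℕ) → Set X → Prop
  | 0, _, _ => False
  | 1, s, S => Subtype.val '' S = ⋃ m, ratBall (vecPt D) (s m)
  | d + 2, s, S => ∃ T : ℕ → Set X,
      (∀ m, IsSigmaSeq X (d + 1) (fun n => s (Nat.pair m n)) (T m)) ∧ S = ⋃ m, (T m)ᶜ

/-- The representation `δ_{Σ_d}` of `Σ_d(X)`. -/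
def deltaSigma {D : ℕ} (X : Set (EuclideanSpace ℝ (Fin D))) (d : ℕ) : Rep (Set X) :=
  ofSeq (IsSigmaSeq X d)

/-! Functions on `X` -/

/-- The representation `ρ` of `ℝ^D` restricted to the points of `X`. -/
def rhoOn {D : ℕ} (X : Set (EuclideanSpace ℝ (Fin D))) : Rep X :=
  fun σ x => rho (vecPt D) σ (x : EuclideanSpace ℝ (Fin D))

/-- Effective `Σ_d`-measurability: preimages of open sets are in `Σ_d(X)`, and `V ↦ f⁻¹[V]`
is `(θ_< → δ_{Σ_d})`-computable (`θ_<` names exactly the open sets `V`). -/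
def IsEffectivelySigmaMeasurable {D : ℕ} {X : Set (EuclideanSpace ℝ (Fin D))} (d : ℕ)
    (f : X → ℝ) : Prop :=
  (∀ V : Set ℝ, IsOpen V → IsBorelSigma d (f ⁻¹' V)) ∧
    IsComputableFun (theta realPt) (deltaSigma X d) fun V => f ⁻¹' V

end TTE

-- A machine reads and writes finitely many symbols in finite time. For representations by
-- sequences, computability is therefore the same as computing each output entry by a monotone
-- computable function of finite prefixes of the input sequence (`OComp`,
-- `isComputableFun_ofSeq_iff`). All later arguments use this form.
--
-- From computability to measurability. If a name of `f x` is computed from a name `s` of `x`, then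
-- "the iterated limit lies in a ball" and "a rational lies below the iterated supremum" are
-- alternating-quantifier statements about `s`, with one alternation for each limit or for each
-- further extremum (`sat_limNext_true`, `sat_cutNext`). A Borel set, however, must be described by
-- `x`, not by `s`. Forcing removes the name. Conditions are finite shrinking chains of rational
-- balls around `x`. A sufficiently generic chain yields a name of `x` for which truth is the same
-- as being forced by a prefix (`sat_iff_forces`). As truth is the same for all names of `x`, it is
-- equivalent to being forced by some condition compatible with `x` (`exists_forces_iff`).
-- Compatibility is open in `x`, and each negation in the definition of forcing costs one
-- complement, so the forced sets have computable names at the right Borel level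
-- (`isComputableFun_deltaSigma`).
--
-- From measurability to computability. A name of the preimage of a rational ball or half-line turns
-- membership of `x` into an alternation of quantifiers over bits computable from a name of `x`
-- (`mem_iff_memBit`). Alternating extrema of two values imitate these quantifiers directly, which
-- gives the lower cut of `f x`. For limits, the inner quantifiers are evaluated by iterated limits
-- (`evIter_altApprox`), and the outer two are handled by a single limit of revisable guesses at a
-- good rational approximation (`tendsto_estimate`).
--
-- Separation. The function is constant. Its value `c` avoids all iterated limits of computable
-- sequences by a ternary diagonal construction using truth values at all finite levels. A
-- nondeterministic machine guesses those truth values together with witnesses; local tests refute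
-- any wrong guess (`IsTruth.ne_zero_iff`), and the digits of `c` depend on the truth values only,
-- not on the witnesses. A computable iterated limit equal to `c` would contradict the stage of the
-- construction devoted to it.

attribute [fun_prop] Computable
attribute [fun_prop] Computable.id Computable.const Computable.comp Computable.pair

namespace TTE

-- Closure properties of computable functions.

section ComputableLemmas

variable {α β γ σ : Type*} [Primcodable α] [Primcodable β] [Primcodable γ] [Primcodable σ]

@[fun_prop] theorem computable_fst {f : α → β × γ} (hf : Computable f) :
    Computable fun a => (f a).1 := Computable.fst.comp hf

@[fun_prop] theorem computable_snd {f : α → β × γ} (hf : Computable f) :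
    Computable fun a => (f a).2 := Computable.snd.comp hf

@[fun_prop] theorem computable_natPair {f g : α → ℕ} (hf : Computable f) (hg : Computable g) :
    Computable fun a => Nat.pair (f a) (g a) := Primrec₂.natPair.to_comp.comp hf hg

@[fun_prop] theorem computable_unpair {f : α → ℕ} (hf : Computable f) :
    Computable fun a => (f a).unpair := Computable.unpair.comp hf

@[fun_prop] theorem computable_add {f g : α → ℕ} (hf : Computable f) (hg : Computable g) :
    Computable fun a => f a + g a := Primrec.nat_add.to_comp.comp hf hg

@[fun_prop] theorem computable_sub {f g : α → ℕ} (hf : Computable f) (hg : Computable g) :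
    Computable fun a => f a - g a := Primrec.nat_sub.to_comp.comp hf hg

@[fun_prop] theorem computable_mul {f g : α → ℕ} (hf : Computable f) (hg : Computable g) :
    Computable fun a => f a * g a := Primrec.nat_mul.to_comp.comp hf hg

@[fun_prop] theorem computable_pow {f g : α → ℕ} (hf : Computable f) (hg : Computable g) :
    Computable fun a => f a ^ g a :=
  (Primrec₂.unpaired'.1 Nat.Primrec.pow).to_comp.comp hf hg

@[fun_prop] theorem computable_decide_lt {f g : α → ℕ} (hf : Computable f) (hg : Computable g) :
    Computable fun a => decide (f a < g a) := Primrec.nat_lt.decide.to_comp.comp hf hg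

@[fun_prop] theorem computable_decide_le {f g : α → ℕ} (hf : Computable f) (hg : Computable g) :
    Computable fun a => decide (f a ≤ g a) := Primrec.nat_le.decide.to_comp.comp hf hg

@[fun_prop] theorem computable_decide_eq [DecidableEq β] {f g : α → β} (hf : Computable f)
    (hg : Computable g) : Computable fun a => decide (f a = g a) :=
  Primrec.eq.decide.to_comp.comp hf hg

@[fun_prop] theorem computable_and {f g : α → Bool} (hf : Computable f) (hg : Computable g) :
    Computable fun a => f a && g a := Primrec.and.to_comp.comp hf hg

@[fun_prop] theorem computable_or {f g : α → Bool} (hf : Computable f) (hg : Computable g) :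
    Computable fun a => f a || g a := Primrec.or.to_comp.comp hf hg

@[fun_prop] theorem computable_not {f : α → Bool} (hf : Computable f) :
    Computable fun a => !(f a) := Primrec.not.to_comp.comp hf

@[fun_prop] theorem computable_cond {c : α → Bool} {f g : α → σ} (hc : Computable c)
    (hf : Computable f) (hg : Computable g) : Computable fun a => bif c a then f a else g a :=
  Computable.cond hc hf hg

@[fun_prop] theorem computable_some {f : α → β} (hf : Computable f) :
    Computable fun a => some (f a) := Computable.option_some.comp hf

@[fun_prop] theorem computable_isSome {f : α → Option β} (hf : Computable f) :
    Computable fun a => (f a).isSome := Primrec.option_isSome.to_comp.comp hf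

@[fun_prop] theorem computable_optionGetD {f : α → Option β} {g : α → β} (hf : Computable f)
    (hg : Computable g) : Computable fun a => (f a).getD (g a) :=
  Computable.option_getD hf hg

@[fun_prop] theorem computable_optionBind {f : α → Option β} {g : α → β → Option σ}
    (hf : Computable f) (hg : Computable fun p : α × β => g p.1 p.2) :
    Computable fun a => (f a).bind (g a) := Computable.option_bind hf hg

@[fun_prop] theorem computable_optionMap {f : α → Option β} {g : α → β → σ}
    (hf : Computable f) (hg : Computable fun p : α × β => g p.1 p.2) :
    Computable fun a => (f a).map (g a) := Computable.option_map hf hg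

@[fun_prop] theorem computable_optionElim {f : α → Option β} {d : α → σ} {g : α → β → σ}
    (hf : Computable f) (hd : Computable d) (hg : Computable fun p : α × β => g p.1 p.2) :
    Computable fun a => (f a).elim (d a) (g a) :=
  (Computable.option_casesOn hf hd hg).of_eq fun a => by cases f a <;> rfl

@[fun_prop] theorem computable_optionToList {f : α → Option β} (hf : Computable f) :
    Computable fun a => (f a).toList :=
  (computable_optionElim hf (Computable.const []) (g := fun _ b => [b])
    (Computable.list_cons.comp Computable.snd (Computable.const []))).of_eq
    fun a => by cases f a <;> rfl

@[fun_prop] theorem computable_decode {f : α → ℕ} (hf : Computable f) :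
    Computable fun a => (Encodable.decode (f a) : Option β) := Computable.decode.comp hf

@[fun_prop] theorem computable_getElem? {l : α → List β} {f : α → ℕ} (hl : Computable l)
    (hf : Computable f) : Computable fun a => (l a)[f a]? := Computable.list_getElem?.comp hl hf

@[fun_prop] theorem computable_length {l : α → List β} (hl : Computable l) :
    Computable fun a => (l a).length := Computable.list_length.comp hl

@[fun_prop] theorem computable_append {l m : α → List β} (hl : Computable l)
    (hm : Computable m) : Computable fun a => l a ++ m a := Computable.list_append.comp hl hm

@[fun_prop] theorem computable_cons {b : α → β} {l : α → List β} (hb : Computable b)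
    (hl : Computable l) : Computable fun a => b a :: l a := Computable.list_cons.comp hb hl

@[fun_prop] theorem computable_range {f : α → ℕ} (hf : Computable f) :
    Computable fun a => List.range (f a) := Primrec.list_range.to_comp.comp hf

@[fun_prop] theorem computable_take {f : α → ℕ} {l : α → List β} (hf : Computable f)
    (hl : Computable l) : Computable fun a => (l a).take (f a) :=
  Primrec.list_take.to_comp.comp hf hl

@[fun_prop] theorem computable_drop {f : α → ℕ} {l : α → List β} (hf : Computable f)
    (hl : Computable l) : Computable fun a => (l a).drop (f a) :=
  Primrec.list_drop.to_comp.comp hf hl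

@[fun_prop] theorem computable_ofNat {δ : Type*} [Denumerable δ] {f : α → ℕ} (hf : Computable f) :
    Computable fun a => Denumerable.ofNat δ (f a) := (Computable.ofNat δ).comp hf

@[fun_prop] theorem computable_encode {f : α → β} (hf : Computable f) :
    Computable fun a => Encodable.encode (f a) := Computable.encode.comp hf

theorem computable_iter {f : α → ℕ} {g : α → σ} {h : α → ℕ → σ → σ} (hf : Computable f)
    (hg : Computable g) (hh : Computable fun p : α × ℕ × σ => h p.1 p.2.1 p.2.2) :
    Computable fun a => Nat.rec (motive := fun _ => σ) (g a) (h a) (f a) :=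
  Computable.nat_rec (h := fun a p => h a p.1 p.2) hf hg hh

@[fun_prop] theorem computable_foldl {l : α → List β} {g : α → σ} {h : α → σ → β → σ}
    (hl : Computable l) (hg : Computable g)
    (hh : Computable fun p : (α × σ) × β => h p.1.1 p.1.2 p.2) :
    Computable fun a => (l a).foldl (h a) (g a) := by
  have : Computable fun a => Nat.rec (motive := fun _ => σ) (g a)
      (fun i s => ((l a)[i]?).elim s (h a s)) (l a).length := by
    refine computable_iter (by fun_prop) hg ?_
    have h' : Computable fun q : (α × ℕ × σ) × β => h q.1.1 q.1.2.2 q.2 :=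
      hh.comp (f := fun p : (α × σ) × β => h p.1.1 p.1.2 p.2)
        (g := fun q : (α × ℕ × σ) × β => ((q.1.1, q.1.2.2), q.2)) (by fun_prop)
    exact computable_optionElim (by fun_prop) (by fun_prop) h'
  refine this.of_eq fun a => ?_
  have key : ∀ i ≤ (l a).length, Nat.rec (motive := fun _ => σ) (g a)
      (fun i s => ((l a)[i]?).elim s (h a s)) i = ((l a).take i).foldl (h a) (g a) := by
    intro i
    induction i with
    | zero => intro; simp
    | succ i ih =>
      intro hi
      have hlt : i < (l a).length := hi
      simp only [ih hlt.le, List.getElem?_eq_getElem hlt, Option.elim_some]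
      rw [List.take_succ_eq_append_getElem hlt, List.foldl_append]
      rfl
  simpa using key _ le_rfl

@[fun_prop] theorem computable_map {l : α → List β} {g : α → β → σ} (hl : Computable l)
    (hg : Computable fun p : α × β => g p.1 p.2) : Computable fun a => (l a).map (g a) := by
  have h' : Computable fun q : (α × List σ) × β => g q.1.1 q.2 :=
    hg.comp (g := fun q : (α × List σ) × β => (q.1.1, q.2)) (by fun_prop)
  have : Computable fun a => (l a).foldl (fun (s : List σ) b => s ++ [g a b]) [] := by fun_prop
  refine this.of_eq fun a => ?_
  have key : ∀ (l : List β) (s : List σ), l.foldl (fun s b => s ++ [g a b]) s = s ++ l.map (g a) := by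
    intro l
    induction l with
    | nil => simp
    | cons b l ih => intro s; simp [ih]
  simpa using key (l a) []

@[fun_prop] theorem computable_all {l : α → List β} {g : α → β → Bool} (hl : Computable l)
    (hg : Computable fun p : α × β => g p.1 p.2) : Computable fun a => (l a).all (g a) := by
  have h' : Computable fun q : (α × Bool) × β => g q.1.1 q.2 :=
    hg.comp (g := fun q : (α × Bool) × β => (q.1.1, q.2)) (by fun_prop)
  have : Computable fun a => (l a).foldl (fun (s : Bool) b => s && g a b) true := by fun_prop
  refine this.of_eq fun a => ?_
  have key : ∀ (l : List β) (s : Bool), l.foldl (fun s b => s && g a b) s = (s && l.all (g a)) := by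
    intro l
    induction l with
    | nil => simp
    | cons b l ih => intro s; simp [ih, Bool.and_assoc]
  simpa using key (l a) true

@[fun_prop] theorem computable_any {l : α → List β} {g : α → β → Bool} (hl : Computable l)
    (hg : Computable fun p : α × β => g p.1 p.2) : Computable fun a => (l a).any (g a) := by
  have : Computable fun a => !((l a).all fun b => !(g a b)) := by fun_prop
  refine this.of_eq fun a => ?_
  simp [List.any_eq_not_all_not]

@[fun_prop] theorem computable_find? {l : α → List β} {g : α → β → Bool} (hl : Computable l)
    (hg : Computable fun p : α × β => g p.1 p.2) : Computable fun a => (l a).find? (g a) := by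
  have h' : Computable fun q : (α × Option β) × β => g q.1.1 q.2 :=
    hg.comp (g := fun q : (α × Option β) × β => (q.1.1, q.2)) (by fun_prop)
  have : Computable fun a => (l a).foldl
      (fun (s : Option β) b => bif s.isSome then s else bif g a b then some b else none) none := by
    fun_prop
  refine this.of_eq fun a => ?_
  have key : ∀ (l : List β) (s : Option β), l.foldl
      (fun s b => bif s.isSome then s else bif g a b then some b else none) s
        = s.or (l.find? (g a)) := by
    intro l
    induction l with
    | nil => simp
    | cons b l ih =>
      intro s
      rw [List.foldl_cons, ih]
      cases s <;> cases h : g a b <;> simp [h]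
  simpa using key (l a) none

/-- Unbounded search for a stage that answers. Every answer is correct, so it does not matter which
stage the search hits. -/
theorem computable_of_search {F : α → β} {Φ : α → ℕ → Option β}
    (hΦ : Computable fun q : α × ℕ => Φ q.1 q.2) (h1 : ∀ a, ∃ k, Φ a k = some (F a))
    (h2 : ∀ a k b, Φ a k = some b → b = F a) : Computable F := by
  refine (Partrec.rfindOpt (f := Φ) hΦ).of_eq_tot fun a => ?_
  have hd : (Nat.rfindOpt (Φ a)).Dom := Nat.rfindOpt_dom.2 ⟨_, _, (h1 a).choose_spec⟩
  obtain ⟨n, hn⟩ := Nat.rfindOpt_spec (Part.get_mem hd)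
  exact h2 a n _ hn ▸ Part.get_mem hd

end ComputableLemmas

end TTE

namespace TTE

/-! Finite prefixes of sequences -/

/-- The prefix of length `k` of the sequence `s`. -/
def pfx {α : Type*} (s : ℕ → α) (k : ℕ) : List α := (List.range k).map s

section Pfx

variable {α : Type*}

@[simp] theorem length_pfx (s : ℕ → α) (k : ℕ) : (pfx s k).length = k := by simp [pfx]

theorem pfx_succ (s : ℕ → α) (k : ℕ) : pfx s (k + 1) = pfx s k ++ [s k] := by
  simp [pfx, List.range_succ]

theorem getElem?_pfx (s : ℕ → α) {k i : ℕ} (h : i < k) : (pfx s k)[i]? = some (s i) := by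
  simp [pfx, h]

theorem getElem?_pfx_eq_some {s : ℕ → α} {k i : ℕ} {b : α} (h : (pfx s k)[i]? = some b) :
    i < k ∧ b = s i := by
  rcases lt_or_ge i k with hi | hi
  · rw [getElem?_pfx s hi] at h
    exact ⟨hi, (Option.some.inj h).symm⟩
  · rw [List.getElem?_eq_none (by simpa using hi)] at h
    cases h

theorem pfx_prefix (s : ℕ → α) {k k' : ℕ} (h : k ≤ k') : pfx s k <+: pfx s k' := by
  obtain ⟨j, rfl⟩ := Nat.exists_eq_add_of_le h
  induction j with
  | zero => exact List.prefix_rfl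
  | succ j ih =>
    rw [← add_assoc, pfx_succ]
    exact (ih (Nat.le_add_right _ _)).trans (List.prefix_append _ _)

theorem prefix_of_getElem? {L L' : List α}
    (h : ∀ (i : ℕ) (b : α), L[i]? = some b → L'[i]? = some b) : L <+: L' := by
  rw [List.prefix_iff_eq_take]
  apply List.ext_getElem?
  intro i
  rcases lt_or_ge i L.length with hi | hi
  · rw [List.getElem?_take_of_lt hi, List.getElem?_eq_getElem hi]
    exact (h i _ (List.getElem?_eq_getElem hi)).symm
  · rw [List.getElem?_eq_none hi, List.getElem?_eq_none (by simp; omega)]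

theorem getElem?_of_prefix {L L' : List α} (h : L <+: L') {i : ℕ} {b : α} (hi : L[i]? = some b) :
    L'[i]? = some b := by
  obtain ⟨t, rfl⟩ := h
  have : i < L.length := by
    by_contra hlt
    rw [List.getElem?_eq_none (not_lt.1 hlt)] at hi
    cases hi
  rw [List.getElem?_append_left this, hi]

end Pfx

/-! Oracle computability -/

theorem eq_of_prefixes {α β : Type*} {Φ : List ℕ → α → Option β}
    (hmono : ∀ L L' a b, L <+: L' → Φ L a = some b → Φ L' a = some b) {s : ℕ → ℕ} {a : α}
    {k k' : ℕ} {b b' : β} (h : Φ (pfx s k) a = some b) (h' : Φ (pfx s k') a = some b') :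
    b = b' := by
  have h1 := hmono _ _ _ _ (pfx_prefix s (le_max_left k k')) h
  have h2 := hmono _ _ _ _ (pfx_prefix s (le_max_right k k')) h'
  exact Option.some.inj (h1.symm.trans h2)

/-- `F` is computed, for all oracles with property `P`, by a computable function of finite
prefixes of the oracle. -/
def OComp {α β : Type*} [Primcodable α] [Primcodable β] (P : (ℕ → ℕ) → Prop)
    (F : (ℕ → ℕ) → α → β) : Prop :=
  ∃ Φ : List ℕ → α → Option β, Computable (fun p : List ℕ × α => Φ p.1 p.2) ∧
    (∀ L L' a b, L <+: L' → Φ L a = some b → Φ L' a = some b) ∧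
    ∀ s, P s → ∀ a, ∃ k, Φ (pfx s k) a = some (F s a)

section OComp

variable {α β γ : Type*} [Primcodable α] [Primcodable β] [Primcodable γ]
  {P Q : (ℕ → ℕ) → Prop}

theorem OComp.of_computable {g : α → β} (hg : Computable g) : OComp P fun _ a => g a :=
  ⟨fun _ a => some (g a), by fun_prop, fun _ _ _ _ _ h => h, fun _ _ _ => ⟨0, rfl⟩⟩

theorem OComp.query {f : α → ℕ} (hf : Computable f) : OComp P fun s a => s (f a) :=
  ⟨fun L a => L[f a]?, by fun_prop, fun _ _ _ _ h h' => getElem?_of_prefix h h',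
    fun s _ a => ⟨f a + 1, getElem?_pfx s (Nat.lt_succ_self _)⟩⟩

theorem OComp.comp {F : (ℕ → ℕ) → β → γ} {G : (ℕ → ℕ) → α → β} (hF : OComp P F)
    (hG : OComp P G) : OComp P fun s a => F s (G s a) := by
  obtain ⟨Φ, h1, h2, h3⟩ := hF
  obtain ⟨Ψ, g1, g2, g3⟩ := hG
  refine ⟨fun L a => (Ψ L a).bind (Φ L), ?_, ?_, ?_⟩
  · have : Computable fun p : (List ℕ × α) × β => Φ p.1.1 p.2 :=
      h1.comp (g := fun p : (List ℕ × α) × β => (p.1.1, p.2)) (by fun_prop)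
    exact computable_optionBind g1 this
  · intro L L' a b hL h
    obtain ⟨c, hc, hb⟩ := Option.bind_eq_some_iff.1 h
    exact Option.bind_eq_some_iff.2 ⟨c, g2 _ _ _ _ hL hc, h2 _ _ _ _ hL hb⟩
  · intro s hs a
    obtain ⟨k, hk⟩ := g3 s hs a
    obtain ⟨k', hk'⟩ := h3 s hs (G s a)
    exact ⟨max k k', Option.bind_eq_some_iff.2
      ⟨_, g2 _ _ _ _ (pfx_prefix s (le_max_left _ _)) hk,
        h2 _ _ _ _ (pfx_prefix s (le_max_right _ _)) hk'⟩⟩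

theorem OComp.pair {F : (ℕ → ℕ) → α → β} {G : (ℕ → ℕ) → α → γ} (hF : OComp P F)
    (hG : OComp P G) : OComp P fun s a => (F s a, G s a) := by
  obtain ⟨Φ, h1, h2, h3⟩ := hF
  obtain ⟨Ψ, g1, g2, g3⟩ := hG
  refine ⟨fun L a => (Φ L a).bind fun b => (Ψ L a).map fun c => (b, c), ?_, ?_, ?_⟩
  · have : Computable fun p : (List ℕ × α) × β => Ψ p.1.1 p.1.2 := g1.comp (by fun_prop)
    exact computable_optionBind h1 (computable_optionMap this (by fun_prop))
  · intro L L' a b hL h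
    simp only [Option.bind_eq_some_iff, Option.map_eq_some_iff] at h ⊢
    obtain ⟨x, hx, y, hy, rfl⟩ := h
    exact ⟨x, h2 _ _ _ _ hL hx, y, g2 _ _ _ _ hL hy, rfl⟩
  · intro s hs a
    obtain ⟨k, hk⟩ := h3 s hs a
    obtain ⟨k', hk'⟩ := g3 s hs a
    refine ⟨max k k', ?_⟩
    beta_reduce
    rw [h2 _ _ _ _ (pfx_prefix s (le_max_left _ _)) hk,
      g2 _ _ _ _ (pfx_prefix s (le_max_right _ _)) hk']
    rfl

theorem OComp.comp_computable {F : (ℕ → ℕ) → β → γ} {g : α → β} (hF : OComp P F)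
    (hg : Computable g) : OComp P fun s a => F s (g a) :=
  hF.comp (OComp.of_computable hg)

theorem OComp.computable_comp {g : β → γ} {F : (ℕ → ℕ) → α → β} (hg : Computable g)
    (hF : OComp P F) : OComp P fun s a => g (F s a) :=
  (OComp.of_computable hg).comp hF

theorem OComp.map_range {F : (ℕ → ℕ) → α × ℕ → β} {f : α → ℕ} (hF : OComp P F)
    (hf : Computable f) : OComp P fun s a => (List.range (f a)).map fun i => F s (a, i) := by
  obtain ⟨Φ, h1, h2, h3⟩ := hF
  let Ψ : List ℕ → α → ℕ → Option (List β) := fun L a n =>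
    Nat.rec (motive := fun _ => Option (List β)) (some [])
      (fun i o => o.bind fun l => (Φ L (a, i)).map fun b => l ++ [b]) n
  have hs : ∀ L a n, Ψ L a (n + 1) = (Ψ L a n).bind fun l => (Φ L (a, n)).map fun b => l ++ [b] :=
    fun _ _ _ => rfl
  refine ⟨fun L a => Ψ L a (f a), ?_, ?_, ?_⟩
  · refine computable_iter (f := fun p : List ℕ × α => f p.2) (g := fun _ => some [])
      (h := fun p i o => o.bind fun l => (Φ p.1 (p.2, i)).map fun b => l ++ [b])
      (by fun_prop) (by fun_prop) ?_
    have : Computable fun q : ((List ℕ × α) × ℕ × Option (List β)) × List β =>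
        Φ q.1.1.1 (q.1.1.2, q.1.2.1) :=
      h1.comp (g := fun q : ((List ℕ × α) × ℕ × Option (List β)) × List β =>
        (q.1.1.1, (q.1.1.2, q.1.2.1))) (by fun_prop)
    exact computable_optionBind (by fun_prop) (computable_optionMap this (by fun_prop))
  · intro L L' a b hL
    beta_reduce
    generalize f a = n
    revert b
    induction n with
    | zero => intro b h; exact h
    | succ n ih =>
      intro b h
      simp only [hs, Option.bind_eq_some_iff, Option.map_eq_some_iff] at h ⊢
      obtain ⟨x, hx, y, hy, rfl⟩ := h
      exact ⟨x, ih _ hx, y, h2 _ _ _ _ hL hy, rfl⟩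
  · intro s hs' a
    beta_reduce
    generalize f a = n
    have key : ∀ n, ∃ k, ∀ k' ≥ k, Ψ (pfx s k') a n = some ((List.range n).map fun i => F s (a, i)) := by
      intro n
      induction n with
      | zero => exact ⟨0, fun _ _ => rfl⟩
      | succ n ih =>
        obtain ⟨k, hk⟩ := ih
        obtain ⟨k', hk'⟩ := h3 s hs' (a, n)
        refine ⟨max k k', fun j hj => ?_⟩
        rw [hs, hk j (le_trans (le_max_left _ _) hj),
          h2 _ _ _ _ (pfx_prefix s (le_trans (le_max_right _ _) hj)) hk']
        simp [List.range_succ]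
    obtain ⟨k, hk⟩ := key n
    exact ⟨k, hk k le_rfl⟩

/-- Unbounded search relative to an oracle. -/
theorem OComp.find {F : (ℕ → ℕ) → α × ℕ → Bool} {G : (ℕ → ℕ) → α → ℕ} (hF : OComp P F)
    (hG : ∀ s, P s → ∀ a, F s (a, G s a) = true ∧ ∀ m < G s a, F s (a, m) = false) :
    OComp P G := by
  obtain ⟨Φ, h1, h2, h3⟩ := hF
  -- A candidate is reported only once every smaller one has been refuted by the same prefix.
  -- Otherwise a longer prefix could reveal a smaller witness and change the answer.
  refine ⟨fun L a => (List.range L.length).find? fun n => decide (Φ L (a, n) = some true) &&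
    (List.range n).all fun m => decide (Φ L (a, m) = some false), ?_, ?_, ?_⟩
  · have e1 : Computable fun q : (List ℕ × α) × ℕ => Φ q.1.1 (q.1.2, q.2) :=
      h1.comp (g := fun q : (List ℕ × α) × ℕ => (q.1.1, (q.1.2, q.2))) (by fun_prop)
    have e2 : Computable fun q : ((List ℕ × α) × ℕ) × ℕ => Φ q.1.1.1 (q.1.1.2, q.2) :=
      h1.comp (g := fun q : ((List ℕ × α) × ℕ) × ℕ => (q.1.1.1, (q.1.1.2, q.2))) (by fun_prop)
    exact computable_find? (by fun_prop) (computable_and (computable_decide_eq e1 (by fun_prop))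
      (computable_all (by fun_prop) (computable_decide_eq e2 (by fun_prop))))
  · intro L L' a b hL h
    simp only [List.find?_range_eq_some, Bool.and_eq_true, decide_eq_true_eq, List.all_eq_true,
      List.mem_range, Bool.not_eq_true'] at h ⊢
    obtain ⟨⟨hb, hall⟩, hlt, -⟩ := h
    refine ⟨⟨h2 _ _ _ _ hL hb, fun m hm => h2 _ _ _ _ hL (hall m hm)⟩,
      hlt.trans_le hL.length_le, fun j hj => ?_⟩
    have := h2 _ _ _ _ hL (hall j hj)
    simp [this]
  · intro s hs a
    obtain ⟨hT, hlt⟩ := hG s hs a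
    have key : ∀ n, ∃ k, ∀ m < n, Φ (pfx s k) (a, m) = some (F s (a, m)) := by
      intro n
      induction n with
      | zero => exact ⟨0, fun m hm => absurd hm (Nat.not_lt_zero _)⟩
      | succ n ih =>
        obtain ⟨k, hk⟩ := ih
        obtain ⟨k', hk'⟩ := h3 s hs (a, n)
        refine ⟨max k k', fun m hm => ?_⟩
        rcases Nat.lt_succ_iff_lt_or_eq.1 hm with hm | rfl
        · exact h2 _ _ _ _ (pfx_prefix s (le_max_left _ _)) (hk m hm)
        · exact h2 _ _ _ _ (pfx_prefix s (le_max_right _ _)) hk'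
    obtain ⟨k, hk⟩ := key (G s a + 1)
    refine ⟨max k (G s a + 1), ?_⟩
    have hk2 : ∀ m < G s a + 1, Φ (pfx s (max k (G s a + 1))) (a, m) = some (F s (a, m)) :=
      fun m hm => h2 _ _ _ _ (pfx_prefix s (le_max_left _ _)) (hk m hm)
    simp only [List.find?_range_eq_some, Bool.and_eq_true, decide_eq_true_eq, List.all_eq_true,
      List.mem_range, Bool.not_eq_true', length_pfx]
    refine ⟨⟨by rw [hk2 _ (Nat.lt_succ_self _), hT], fun m hm => ?_⟩, by omega, fun j hj => ?_⟩
    · rw [hk2 m (by omega), hlt m hm]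
    · simp [hk2 j (by omega), hlt j hj]

/-- Feeding a computable family of oracles. -/
theorem OComp.computable_of_oracle {F : (ℕ → ℕ) → β → γ} (hF : OComp P F) {s : α → ℕ → ℕ}
    (hs : Computable fun p : α × ℕ => s p.1 p.2) (hP : ∀ a, P (s a)) :
    Computable fun p : α × β => F (s p.1) p.2 := by
  obtain ⟨Φ, h1, h2, h3⟩ := hF
  refine computable_of_search (Φ := fun p k => Φ (pfx (s p.1) k) p.2) ?_
    (fun p => h3 _ (hP p.1) p.2) ?_
  · have e : Computable fun q : (α × β) × ℕ => pfx (s q.1.1) q.2 := by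
      refine computable_map (by fun_prop) ?_
      exact hs.comp (g := fun q : ((α × β) × ℕ) × ℕ => (q.1.1.1, q.2)) (by fun_prop)
    exact h1.comp (e.pair (by fun_prop))
  · intro p k b hk
    obtain ⟨k', hk'⟩ := h3 _ (hP p.1) p.2
    exact eq_of_prefixes h2 hk hk'

end OComp

end TTE

namespace TTE

/-! Reading sequences from their graphs -/

/-- The value at `i` of the sequence whose coding string starts with `B`, if it is visible. -/
def decAt (B : List Bool) (i : ℕ) : Option ℕ :=
  (List.range B.length).find? fun v => decide (B[Nat.pair i v]? = some true)

theorem decAt_eq_some {B : List Bool} {i v : ℕ} :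
    decAt B i = some v ↔ B[Nat.pair i v]? = some true ∧ ∀ j < v, B[Nat.pair i j]? ≠ some true := by
  simp only [decAt, List.find?_range_eq_some, decide_eq_true_eq, List.mem_range,
    Bool.not_eq_true', decide_eq_false_iff_not]
  constructor
  · rintro ⟨h1, -, h2⟩
    exact ⟨h1, h2⟩
  · rintro ⟨h1, h2⟩
    refine ⟨h1, ?_, h2⟩
    by_contra hlt
    rw [List.getElem?_eq_none ((not_lt.1 hlt).trans (Nat.right_le_pair _ _))] at h1
    cases h1

/-- Since `Nat.pair i j < Nat.pair i v` for `j < v`, all smaller candidates are already visible when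
`v` is, so no later bit can displace it. -/
theorem decAt_mono {B B' : List Bool} (h : B <+: B') {i v : ℕ} (hv : decAt B i = some v) :
    decAt B' i = some v := by
  rw [decAt_eq_some] at hv ⊢
  refine ⟨getElem?_of_prefix h hv.1, fun j hj hj' => hv.2 j hj ?_⟩
  obtain ⟨t, rfl⟩ := h
  have hlt : Nat.pair i v < B.length := by
    by_contra hlt
    rw [List.getElem?_eq_none (not_lt.1 hlt)] at hv
    cases hv.1
  rwa [List.getElem?_append_left ((Nat.pair_lt_pair_right i hj).trans hlt)] at hj'

theorem decAt_seqCode {s : ℕ → ℕ} {k i v : ℕ} (h : decAt (pfx (seqCode s) k) i = some v) :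
    v = s i := by
  have := (getElem?_pfx_eq_some (decAt_eq_some.1 h).1).2
  simpa [seqCode, eq_comm] using this

theorem exists_decAt_seqCode (s : ℕ → ℕ) (i : ℕ) :
    ∃ k, decAt (pfx (seqCode s) k) i = some (s i) := by
  refine ⟨Nat.pair i (s i) + 1, decAt_eq_some.2 ⟨?_, fun j hj h => ?_⟩⟩
  · rw [getElem?_pfx _ (Nat.lt_succ_self _)]
    simp [seqCode]
  · have := (getElem?_pfx_eq_some h).2
    simp [seqCode] at this
    omega

@[fun_prop] theorem computable_decAt {α : Type*} [Primcodable α] {B : α → List Bool} {i : α → ℕ}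
    (hB : Computable B) (hi : Computable i) : Computable fun a => decAt (B a) (i a) := by
  unfold decAt
  fun_prop

/-- The first entries, at most `n` of them, of the sequence whose coding string starts with `B`. -/
def decUpTo (B : List Bool) : ℕ → List ℕ
  | 0 => []
  | n + 1 => bif decide ((decUpTo B n).length = n) then
      (decAt B n).elim (decUpTo B n) fun v => decUpTo B n ++ [v] else decUpTo B n

theorem decUpTo_spec (B : List Bool) (n : ℕ) : (decUpTo B n).length ≤ n ∧
    (∀ (i : ℕ) v, (decUpTo B n)[i]? = some v → decAt B i = some v) ∧
    ((decUpTo B n).length = n ∨ decAt B (decUpTo B n).length = none) := by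
  induction n with
  | zero => simp [decUpTo]
  | succ n ih =>
    obtain ⟨h1, h2, h3⟩ := ih
    by_cases hl : (decUpTo B n).length = n
    · cases hd : decAt B n with
      | none =>
        have : decUpTo B (n + 1) = decUpTo B n := by simp [decUpTo, hl, hd]
        rw [this]
        exact ⟨by omega, h2, Or.inr (by rw [hl, hd])⟩
      | some v =>
        have : decUpTo B (n + 1) = decUpTo B n ++ [v] := by simp [decUpTo, hl, hd]
        rw [this]
        refine ⟨by simp [hl], fun i w hw => ?_, Or.inl (by simp [hl])⟩
        rcases lt_trichotomy i n with hi | rfl | hi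
        · rw [List.getElem?_append_left (by omega)] at hw
          exact h2 i w hw
        · rw [List.getElem?_append_right (by omega), hl] at hw
          simp only [Nat.sub_self, List.getElem?_cons_zero, Option.some.injEq] at hw
          rw [hd, hw]
        · rw [List.getElem?_eq_none (by simp; omega)] at hw
          cases hw
    · have : decUpTo B (n + 1) = decUpTo B n := by simp [decUpTo, hl]
      rw [this]
      exact ⟨by omega, h2, Or.inr (h3.resolve_left hl)⟩

/-- The list of entries of a sequence that can be read off a prefix of its coding string. -/
def decList (B : List Bool) : List ℕ := decUpTo B B.length

/-- This holds for arbitrary strings, not only for codes of sequences. That matters when the string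
is guessed by a nondeterministic machine. -/
theorem decList_mono {B B' : List Bool} (h : B <+: B') : decList B <+: decList B' := by
  obtain ⟨h1, h2, -⟩ := decUpTo_spec B B.length
  obtain ⟨h1', h2', h3'⟩ := decUpTo_spec B' B'.length
  have hlen : (decList B).length ≤ (decList B').length := by
    by_contra hlt
    rw [not_le] at hlt
    rcases h3' with h3' | h3'
    · have := h.length_le
      simp only [decList] at hlt
      omega
    · have := h2 _ _ (List.getElem?_eq_getElem hlt)
      have := decAt_mono h this
      simp only [decList] at this
      rw [h3'] at this
      cases this
  refine prefix_of_getElem? fun i v hv => ?_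
  have hi : i < (decList B').length := by
    refine lt_of_lt_of_le ?_ hlen
    by_contra hi
    rw [List.getElem?_eq_none (not_lt.1 hi)] at hv
    cases hv
  have e1 := decAt_mono h (h2 i v hv)
  have e2 := h2' i _ (List.getElem?_eq_getElem hi)
  rw [List.getElem?_eq_getElem hi, ← e2, e1]

theorem decList_seqCode (s : ℕ → ℕ) (k : ℕ) :
    decList (pfx (seqCode s) k) = pfx s (decList (pfx (seqCode s) k)).length := by
  obtain ⟨-, h2, -⟩ := decUpTo_spec (pfx (seqCode s) k) (pfx (seqCode s) k).length
  refine List.ext_getElem? fun i => ?_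
  rcases lt_or_ge i (decList (pfx (seqCode s) k)).length with hi | hi
  · rw [getElem?_pfx _ hi]
    have := h2 i _ (List.getElem?_eq_getElem hi)
    rw [List.getElem?_eq_getElem hi, decAt_seqCode this]
  · rw [List.getElem?_eq_none hi, List.getElem?_eq_none (by simpa using hi)]

theorem exists_length_decList {s : ℕ → ℕ} (n : ℕ) :
    ∃ k, n ≤ (decList (pfx (seqCode s) k)).length := by
  have key : ∃ k, ∀ i < n, decAt (pfx (seqCode s) k) i ≠ none := by
    induction n with
    | zero => exact ⟨0, fun i hi => absurd hi (Nat.not_lt_zero _)⟩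
    | succ n ih =>
      obtain ⟨k, hk⟩ := ih
      obtain ⟨k', hk'⟩ := exists_decAt_seqCode s n
      refine ⟨max k k', fun i hi => ?_⟩
      rcases Nat.lt_succ_iff_lt_or_eq.1 hi with hi | rfl
      · obtain ⟨v, hv⟩ := Option.ne_none_iff_exists'.1 (hk i hi)
        rw [decAt_mono (pfx_prefix _ (le_max_left _ _)) hv]
        simp
      · rw [decAt_mono (pfx_prefix _ (le_max_right _ _)) hk']
        simp
  obtain ⟨k, hk⟩ := key
  refine ⟨max k n, ?_⟩
  obtain ⟨-, -, h3⟩ := decUpTo_spec (pfx (seqCode s) (max k n)) (pfx (seqCode s) (max k n)).length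
  by_contra hlt
  rw [not_le] at hlt
  rcases h3 with h3 | h3
  · simp only [decList] at hlt
    rw [h3] at hlt
    simp at hlt
  · obtain ⟨v, hv⟩ := Option.ne_none_iff_exists'.1 (hk _ hlt)
    have := decAt_mono (pfx_prefix (seqCode s) (le_max_left k n)) hv
    simp only [decList] at this
    rw [h3] at this
    cases this

@[fun_prop] theorem computable_decList {α : Type*} [Primcodable α] {B : α → List Bool}
    (hB : Computable B) : Computable fun a => decList (B a) := by
  have : Computable fun a => Nat.rec (motive := fun _ => List ℕ) []
      (fun n l => bif decide (l.length = n) then (decAt (B a) n).elim l fun v => l ++ [v] else l)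
      (B a).length :=
    computable_iter (h := fun a n l => bif decide (l.length = n) then
      (decAt (B a) n).elim l fun v => l ++ [v] else l) (by fun_prop) (by fun_prop) (by fun_prop)
  refine this.of_eq fun a => ?_
  unfold decList
  generalize (B a).length = n
  induction n with
  | zero => rfl
  | succ n ih => simp only [decUpTo, ih]

/-- The part of the coding string of a sequence that is determined by a prefix of the sequence. -/
def encList (L : List ℕ) : List Bool :=
  (List.range L.length).map fun p => decide (L[p.unpair.1]? = some p.unpair.2)

/-- Bit `p` concerns the entry `p.unpair.1 ≤ p`, so `k` entries determine the first `k` bits. -/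
theorem encList_pfx (s : ℕ → ℕ) (k : ℕ) : encList (pfx s k) = pfx (seqCode s) k := by
  simp only [encList, length_pfx]
  refine List.map_congr_left fun p hp => ?_
  rw [getElem?_pfx s ((Nat.unpair_left_le p).trans_lt (List.mem_range.1 hp))]
  simp [seqCode]

theorem exists_eq_pfx (L : List ℕ) : ∃ s : ℕ → ℕ, L = pfx s L.length := by
  refine ⟨fun i => L[i]?.getD 0, List.ext_getElem? fun i => ?_⟩
  rcases lt_or_ge i L.length with hi | hi
  · rw [getElem?_pfx _ hi]
    simp [hi]
  · rw [List.getElem?_eq_none hi, List.getElem?_eq_none (by simpa using hi)]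

theorem encList_mono {L L' : List ℕ} (h : L <+: L') : encList L <+: encList L' := by
  obtain ⟨s, hs⟩ := exists_eq_pfx L'
  have hL : L = pfx s L.length := by
    refine List.ext_getElem? fun i => ?_
    rcases lt_or_ge i L.length with hi | hi
    · have := getElem?_of_prefix h (List.getElem?_eq_getElem hi)
      rw [hs, getElem?_pfx s (hi.trans_le h.length_le)] at this
      rw [getElem?_pfx s hi, this, List.getElem?_eq_getElem hi]
    · rw [List.getElem?_eq_none hi, List.getElem?_eq_none (by simpa using hi)]
  rw [hs, hL, encList_pfx, encList_pfx]
  exact pfx_prefix _ h.length_le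

@[fun_prop] theorem computable_encList {α : Type*} [Primcodable α] {L : α → List ℕ}
    (hL : Computable L) : Computable fun a => encList (L a) := by
  unfold encList
  fun_prop

/-! Machines that write whatever is determined by the bits read or guessed so far -/

section StreamMachine

/-- The output after `k` steps of a machine that in each step gets one more bit of the stream `γ`
and then tries to determine the next output symbol by `Θ`. -/
def streamOut (Θ : List Bool → ℕ → Option Bool) (γ : ℕ → Bool) : ℕ → List Bool
  | 0 => []
  | k + 1 => streamOut Θ γ k ++ (Θ (pfx γ (k + 1)) (streamOut Θ γ k).length).toList

def streamCfg (Θ : List Bool → ℕ → Option Bool) (γ : ℕ → Bool) (k : ℕ) : Config where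
  mem := Encodable.encode (pfx γ k, (streamOut Θ γ k).length)
  pos := k
  out := streamOut Θ γ k

variable {Θ : List Bool → ℕ → Option Bool}

theorem streamOut_getElem? (hΘ : ∀ B B' n b, B <+: B' → Θ B n = some b → Θ B' n = some b)
    (γ : ℕ → Bool) (k : ℕ) {i : ℕ} {b : Bool} (h : (streamOut Θ γ k)[i]? = some b) :
    Θ (pfx γ k) i = some b := by
  induction k with
  | zero => simp [streamOut] at h
  | succ k ih =>
    simp only [streamOut] at h
    rcases lt_or_ge i (streamOut Θ γ k).length with hi | hi
    · rw [List.getElem?_append_left hi] at h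
      exact hΘ _ _ _ _ (pfx_prefix γ (Nat.le_succ k)) (ih h)
    · rw [List.getElem?_append_right hi] at h
      cases hc : Θ (pfx γ (k + 1)) (streamOut Θ γ k).length with
      | none => simp [hc] at h
      | some c =>
        rw [hc, Option.toList_some] at h
        have h0 : i = (streamOut Θ γ k).length := by
          by_contra hne
          rw [List.getElem?_eq_none (by simp; omega)] at h
          cases h
        subst h0
        simp at h
        rw [hc, h]

/-- A symbol that is determined once stays determined, so the machine may try only one symbol per
step without missing any. -/
theorem outputs_streamCfg_iff (hΘ : ∀ B B' n b, B <+: B' → Θ B n = some b → Θ B' n = some b)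
    (γ τ : ℕ → Bool) :
    Outputs (streamCfg Θ γ) τ ↔ ∀ n, ∃ k, Θ (pfx γ k) n = some (τ n) := by
  constructor
  · intro h n
    obtain ⟨k, hk⟩ := h (n + 1)
    refine ⟨k, streamOut_getElem? hΘ γ k ?_⟩
    change streamOut Θ γ k = pfx τ (n + 1) at hk
    rw [hk, getElem?_pfx τ (Nat.lt_succ_self n)]
  · intro h n
    change ∃ k, streamOut Θ γ k = pfx τ n
    induction n with
    | zero => exact ⟨0, rfl⟩
    | succ n ih =>
      obtain ⟨k, hk⟩ := ih
      obtain ⟨K, hK⟩ := h n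
      by_contra hno
      -- If symbol `n` were never written, the machine would keep trying it in vain, although from
      -- stage `K` on it is determined.
      have key : ∀ j, streamOut Θ γ (k + j) = pfx τ n ∧ Θ (pfx γ (k + j + 1)) n = none := by
        have step : ∀ j, streamOut Θ γ (k + j) = pfx τ n → Θ (pfx γ (k + j + 1)) n = none := by
          intro j hj
          by_contra hne
          obtain ⟨b, hb⟩ := Option.ne_none_iff_exists'.1 hne
          have e1 := hΘ _ _ _ _ (pfx_prefix γ (le_max_left (k + j + 1) K)) hb
          have e2 := hΘ _ _ _ _ (pfx_prefix γ (le_max_right (k + j + 1) K)) hK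
          obtain rfl : b = τ n := Option.some.inj (e1.symm.trans e2)
          refine hno ⟨k + j + 1, ?_⟩
          rw [streamOut, hj, length_pfx, hb, pfx_succ τ]
          rfl
        intro j
        induction j with
        | zero => exact ⟨hk, step 0 hk⟩
        | succ j ih =>
          have : streamOut Θ γ (k + (j + 1)) = pfx τ n := by
            rw [← add_assoc, streamOut, ih.1, length_pfx, ih.2]
            simp
          exact ⟨this, step _ this⟩
      have e := hΘ _ _ _ _ (pfx_prefix γ (show K ≤ k + K + 1 by omega)) hK
      rw [(key K).2] at e
      cases e

/-- The machine that appends to its memory one bit per step, selected from its binary choice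
and the scanned symbol by `sel`, stops when the bits so far fail the test `chk`, and writes
the next output symbol as soon as `Θ` determines it from these bits. -/
def streamMachine (sel : Bool → Bool → Bool) (chk : List Bool → Bool) (hchk : Computable chk)
    (Θ : List Bool → ℕ → Option Bool) (hΘ : Computable fun p : List Bool × ℕ => Θ p.1 p.2) :
    Machine where
  step g q a :=
    let p : List Bool × ℕ := (Encodable.decode q).getD ([], 0)
    let B := p.1 ++ [sel g a]
    bif chk B then
      some (Encodable.encode (B, p.2 + (Θ B p.2).toList.length), true, Θ B p.2)
    else none
  computable_step := by
    have hsel : Computable fun x : Bool × ℕ × Bool => sel x.1 x.2.2 :=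
      (Primrec.dom_bool₂ sel).to_comp.comp Computable.fst (Computable.snd.comp Computable.snd)
    have hB : Computable fun x : Bool × ℕ × Bool =>
        ((Encodable.decode x.2.1 : Option (List Bool × ℕ)).getD ([], 0)).1 ++ [sel x.1 x.2.2] :=
      computable_append (by fun_prop) (computable_cons hsel (by fun_prop))
    have ho : Computable fun x : Bool × ℕ × Bool =>
        Θ (((Encodable.decode x.2.1 : Option (List Bool × ℕ)).getD ([], 0)).1 ++ [sel x.1 x.2.2])
          ((Encodable.decode x.2.1 : Option (List Bool × ℕ)).getD ([], 0)).2 :=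
      hΘ.comp (hB.pair (by fun_prop))
    exact computable_cond (hchk.comp hB) (by fun_prop) (by fun_prop)

variable {sel : Bool → Bool → Bool} {chk : List Bool → Bool} {hchk : Computable chk}
  {hΘc : Computable fun p : List Bool × ℕ => Θ p.1 p.2}

theorem next_streamCfg {σ γ : ℕ → Bool} {g : Bool} {k : ℕ} (h : sel g (σ k) = γ k) :
    (streamMachine sel chk hchk Θ hΘc).next σ g (streamCfg Θ γ k) =
      bif chk (pfx γ (k + 1)) then some (streamCfg Θ γ (k + 1)) else none := by
  simp only [Machine.next, streamMachine, streamCfg, Encodable.encodek, Option.getD_some, h,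
    ← pfx_succ]
  cases chk (pfx γ (k + 1)) <;> simp [streamOut]

theorem isComputation_streamCfg {σ γ g : ℕ → Bool} (h : ∀ k, sel (g k) (σ k) = γ k)
    (hc : ∀ k, chk (pfx γ (k + 1)) = true) :
    (streamMachine sel chk hchk Θ hΘc).IsComputation σ (streamCfg Θ γ) :=
  ⟨rfl, fun k => ⟨g k, by rw [next_streamCfg (h k), hc k, cond_true]⟩⟩

/-- The stream is recovered from the binary choices made along the computation, and the test cannot
have failed since the computation did not stop. -/
theorem exists_of_isComputation {σ : ℕ → Bool} {c : ℕ → Config}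
    (h : (streamMachine sel chk hchk Θ hΘc).IsComputation σ c) :
    ∃ γ, c = streamCfg Θ γ ∧ ∀ k, chk (pfx γ (k + 1)) = true := by
  obtain ⟨h0, hs⟩ := h
  choose g hg using hs
  let γ : ℕ → Bool := fun k => sel (g k) (σ k)
  have key : ∀ k, c k = streamCfg Θ γ k ∧ chk (pfx γ (k + 1)) = true := by
    have step : ∀ k, c k = streamCfg Θ γ k →
        c (k + 1) = streamCfg Θ γ (k + 1) ∧ chk (pfx γ (k + 1)) = true := by
      intro k hk
      have := hg k
      rw [hk, next_streamCfg (γ := γ) rfl] at this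
      cases hch : chk (pfx γ (k + 1)) with
      | false => simp [hch] at this
      | true => simpa [hch, eq_comm] using this
    intro k
    induction k with
    | zero => exact ⟨h0, (step 0 h0).2⟩
    | succ k ih => exact ⟨(step k ih.1).1, (step _ (step k ih.1).1).2⟩
  exact ⟨γ, funext fun k => (key k).1, fun k => (key k).2⟩

end StreamMachine

/-! Finite simulations of deterministic machines -/

section Simulation

/-- One step of a machine on a finite piece `B` of the input; at its end, or if the machine
stops, nothing changes any more. -/
def simStep (M : Machine) (B : List Bool) (c : ℕ × ℕ × List Bool) : ℕ × ℕ × List Bool :=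
  (B[c.2.1]?).elim c fun a => (M.step false c.1 a).elim c fun r =>
    (r.1, bif r.2.1 then c.2.1 + 1 else c.2.1, c.2.2 ++ r.2.2.toList)

def sim (M : Machine) (B : List Bool) : ℕ → ℕ × ℕ × List Bool
  | 0 => (0, 0, [])
  | t + 1 => simStep M B (sim M B t)

def simOut (M : Machine) (B : List Bool) : List Bool := (sim M B B.length).2.2

variable {M : Machine}

theorem sim_out_prefix (B : List Bool) {t t' : ℕ} (h : t ≤ t') :
    (sim M B t).2.2 <+: (sim M B t').2.2 := by
  induction h with
  | refl => exact List.prefix_rfl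
  | @step m _ ih =>
    refine ih.trans ?_
    simp only [sim, simStep]
    cases B[(sim M B m).2.1]? with
    | none => exact List.prefix_rfl
    | some a =>
      simp only [Option.elim_some]
      cases M.step false (sim M B m).1 a with
      | none => exact List.prefix_rfl
      | some r => exact List.prefix_append _ _

/-- On the shorter piece the simulation freezes when the head reaches its end; until then it agrees
with the one on the longer piece. -/
theorem exists_sim_eq {B B' : List Bool} (h : B <+: B') (t : ℕ) :
    ∃ t' ≤ t, sim M B t = sim M B' t' := by
  induction t with
  | zero => exact ⟨0, le_rfl, rfl⟩
  | succ t ih =>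
    obtain ⟨t', ht, he⟩ := ih
    cases hB : B[(sim M B t).2.1]? with
    | none =>
      refine ⟨t', ht.trans (Nat.le_succ _), ?_⟩
      simp only [sim, simStep, hB, Option.elim_none]
      exact he
    | some a =>
      refine ⟨t' + 1, Nat.succ_le_succ ht, ?_⟩
      have hB' := getElem?_of_prefix h hB
      rw [he] at hB
      rw [he] at hB'
      simp only [sim, simStep, he, hB, hB']

theorem simOut_mono {B B' : List Bool} (h : B <+: B') : simOut M B <+: simOut M B' := by
  obtain ⟨t', ht, he⟩ := exists_sim_eq (M := M) h B.length
  unfold simOut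
  rw [he]
  exact sim_out_prefix _ (ht.trans h.length_le)

theorem sim_pfx (hM : M.Deterministic) {σ : ℕ → Bool} {c : ℕ → Config}
    (hc : M.IsComputation σ c) {k t : ℕ} (ht : t ≤ k) :
    sim M (pfx σ k) t = ((c t).mem, (c t).pos, (c t).out) ∧ (c t).pos ≤ t := by
  induction t with
  | zero => rw [hc.1]; exact ⟨rfl, le_rfl⟩
  | succ t ih =>
    obtain ⟨h1, h2⟩ := ih (by omega)
    obtain ⟨g, hg⟩ := hc.2 t
    have hstep : M.step g (c t).mem (σ (c t).pos) = M.step false (c t).mem (σ (c t).pos) := by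
      cases g
      · rfl
      · exact (hM _ _).symm
    simp only [Machine.next, hstep, Option.map_eq_some_iff] at hg
    obtain ⟨r, hr, hn⟩ := hg
    have hpos : (pfx σ k)[(c t).pos]? = some (σ (c t).pos) := getElem?_pfx σ (by omega)
    rw [← hn]
    refine ⟨?_, ?_⟩
    · simp only [sim, simStep, h1, hpos, Option.elim_some, hr]
      cases r.2.1 <;> rfl
    · change (if r.2.1 then (c t).pos + 1 else (c t).pos) ≤ t + 1
      split <;> omega

theorem exists_simOut_eq (hM : M.Deterministic) {σ τ : ℕ → Bool} {c : ℕ → Config}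
    (hc : M.IsComputation σ c) (hτ : Outputs c τ) (n : ℕ) :
    ∃ k, simOut M (pfx σ k) = pfx τ n := by
  obtain ⟨k, hk⟩ := hτ n
  refine ⟨k, ?_⟩
  unfold simOut
  rw [length_pfx, (sim_pfx hM hc le_rfl).1]
  exact hk

@[fun_prop] theorem computable_simOut {α : Type*} [Primcodable α] {B : α → List Bool}
    (hB : Computable B) : Computable fun a => simOut M (B a) := by
  have : Computable fun a => Nat.rec (motive := fun _ => ℕ × ℕ × List Bool) (0, 0, [])
      (fun _ c => simStep M (B a) c) (B a).length := by
    refine computable_iter (h := fun a _ c => simStep M (B a) c) (by fun_prop) (by fun_prop) ?_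
    unfold simStep
    refine computable_optionElim (by fun_prop) (by fun_prop) ?_
    refine computable_optionElim
      (M.computable_step.comp (g := fun p : (α × ℕ × ℕ × ℕ × List Bool) × Bool =>
        (false, p.1.2.2.1, p.2)) (by fun_prop)) (by fun_prop) ?_
    fun_prop
  refine Computable.of_eq (f := fun a => (Nat.rec (motive := fun _ => ℕ × ℕ × List Bool) (0, 0, [])
      (fun _ c => simStep M (B a) c) (B a).length).2.2) (by fun_prop) fun a => ?_
  have key : ∀ n, Nat.rec (motive := fun _ => ℕ × ℕ × List Bool) (0, 0, [])
      (fun _ c => simStep M (B a) c) n = sim M (B a) n := by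
    intro n
    induction n with
    | zero => rfl
    | succ n ih => simp only [sim, ih]
  rw [key]
  rfl

end Simulation

/-- Computability relative to representations by sequences, in terms of oracle computability. -/
theorem isComputableFun_ofSeq_iff {A B : Type*} {R : (ℕ → ℕ) → A → Prop}
    {R' : (ℕ → ℕ) → B → Prop} {f : A → B} :
    IsComputableFun (ofSeq R) (ofSeq R') f ↔
      ∃ F : (ℕ → ℕ) → ℕ → ℕ, OComp (fun s => ∃ a, R s a) F ∧ ∀ s a, R s a → R' (F s) (f a) := by
  classical
  constructor
  · rintro ⟨M, hM, h⟩
    -- The output sequence has to depend on `s` alone, although `s` may name several points.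
    have h' : ∀ s, (∃ a, R s a) → ∃ t c, M.IsComputation (seqCode s) c ∧ Outputs c (seqCode t) ∧
        ∀ a, R s a → R' t (f a) := by
      rintro s ⟨a, ha⟩
      obtain ⟨c, τ, hc, hτ, t, rfl, ht⟩ := h (seqCode s) a ⟨s, rfl, ha⟩
      refine ⟨t, c, hc, hτ, fun a' ha' => ?_⟩
      obtain ⟨c', τ', hc', hτ', t', rfl, ht'⟩ := h (seqCode s) a' ⟨s, rfl, ha'⟩
      -- By determinism both outputs are read off the same finite simulations on `s`.
      have : t = t' := by
        funext i
        obtain ⟨k, hk⟩ := exists_decAt_seqCode t i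
        obtain ⟨k', hk'⟩ := exists_decAt_seqCode t' i
        obtain ⟨j, hj⟩ := exists_simOut_eq hM hc hτ k
        obtain ⟨j', hj'⟩ := exists_simOut_eq hM hc' hτ' k'
        rw [← hj] at hk
        rw [← hj'] at hk'
        have e1 := decAt_mono (simOut_mono (pfx_prefix (seqCode s) (le_max_left j j'))) hk
        have e2 := decAt_mono (simOut_mono (pfx_prefix (seqCode s) (le_max_right j j'))) hk'
        exact Option.some.inj (e1.symm.trans e2)
      rw [this]
      exact ht'
    choose! F hF using h'
    refine ⟨F, ⟨fun L i => decAt (simOut M (encList L)) i, by fun_prop, ?_, ?_⟩, ?_⟩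
    · exact fun L L' a b hL h => decAt_mono (simOut_mono (encList_mono hL)) h
    · intro s hs i
      obtain ⟨c, hc, hτ, -⟩ := hF s hs
      obtain ⟨k, hk⟩ := exists_decAt_seqCode (F s) i
      obtain ⟨j, hj⟩ := exists_simOut_eq hM hc hτ k
      exact ⟨j, by beta_reduce; rw [encList_pfx, hj, hk]⟩
    · intro s a ha
      obtain ⟨c, hc, hτ, h⟩ := hF s ⟨a, ha⟩
      exact h a ha
  · rintro ⟨F, ⟨Φ, h1, h2, h3⟩, hF⟩
    -- Bit `n` of the code of the output asks whether its entry `n.unpair.1` is `n.unpair.2`.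
    let Θ : List Bool → ℕ → Option Bool := fun B n =>
      (Φ (decList B) n.unpair.1).map fun w => decide (w = n.unpair.2)
    have hΘc : Computable fun p : List Bool × ℕ => Θ p.1 p.2 :=
      computable_optionMap (h1.comp (g := fun p : List Bool × ℕ => (decList p.1, p.2.unpair.1))
        (by fun_prop)) (by fun_prop)
    have hΘ : ∀ B B' n b, B <+: B' → Θ B n = some b → Θ B' n = some b := by
      intro B B' n b hB h
      obtain ⟨w, hw, rfl⟩ := Option.map_eq_some_iff.1 h
      exact Option.map_eq_some_iff.2 ⟨w, h2 _ _ _ _ (decList_mono hB) hw, rfl⟩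
    refine ⟨streamMachine (fun _ a => a) (fun _ => true) (by fun_prop) Θ hΘc, ?_, ?_⟩
    · intro q a
      rfl
    · rintro σ a ⟨s, rfl, hs⟩
      refine ⟨streamCfg Θ (seqCode s), seqCode (F s),
        isComputation_streamCfg (g := seqCode s) (fun _ => rfl) (fun _ => rfl),
        (outputs_streamCfg_iff hΘ _ _).2 fun n => ?_, F s, rfl, hF s a hs⟩
      obtain ⟨k, hk⟩ := h3 s ⟨a, hs⟩ n.unpair.1
      obtain ⟨j, hj⟩ := exists_length_decList (s := s) k
      refine ⟨j, Option.map_eq_some_iff.2 ⟨F s n.unpair.1, ?_, rfl⟩⟩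
      rw [decList_seqCode]
      exact h2 _ _ _ _ (pfx_prefix s hj) hk

end TTE

namespace TTE

/-! Arithmetic on codes of rationals -/

section Codes

def rsub (m n : ℕ) : ℕ :=
  Nat.pair (Nat.pair
    (m.unpair.1.unpair.1 * (n.unpair.2 + 1) + n.unpair.1.unpair.2 * (m.unpair.2 + 1))
    (m.unpair.1.unpair.2 * (n.unpair.2 + 1) + n.unpair.1.unpair.1 * (m.unpair.2 + 1)))
    ((m.unpair.2 + 1) * (n.unpair.2 + 1) - 1)

def radd (m n : ℕ) : ℕ :=
  Nat.pair (Nat.pair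
    (m.unpair.1.unpair.1 * (n.unpair.2 + 1) + n.unpair.1.unpair.1 * (m.unpair.2 + 1))
    (m.unpair.1.unpair.2 * (n.unpair.2 + 1) + n.unpair.1.unpair.2 * (m.unpair.2 + 1)))
    ((m.unpair.2 + 1) * (n.unpair.2 + 1) - 1)

def rmul (m n : ℕ) : ℕ :=
  Nat.pair (Nat.pair
    (m.unpair.1.unpair.1 * n.unpair.1.unpair.1 + m.unpair.1.unpair.2 * n.unpair.1.unpair.2)
    (m.unpair.1.unpair.1 * n.unpair.1.unpair.2 + m.unpair.1.unpair.2 * n.unpair.1.unpair.1))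
    ((m.unpair.2 + 1) * (n.unpair.2 + 1) - 1)

/-- Comparison of codes of rationals. -/
def rlt (m n : ℕ) : Bool :=
  decide (m.unpair.1.unpair.1 * (n.unpair.2 + 1) + n.unpair.1.unpair.2 * (m.unpair.2 + 1) <
    m.unpair.1.unpair.2 * (n.unpair.2 + 1) + n.unpair.1.unpair.1 * (m.unpair.2 + 1))

/-- A code of `b ^ (-i)`, for `b ≥ 1`. -/
def rpowInv (b i : ℕ) : ℕ := Nat.pair (Nat.pair 1 0) (b ^ i - 1)

theorem cast_den (m n : ℕ) : (((m + 1) * (n + 1) - 1 : ℕ) : ℚ) + 1 = (m + 1) * (n + 1) := by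
  have : 1 ≤ (m + 1) * (n + 1) := Nat.mul_pos (Nat.succ_pos _) (Nat.succ_pos _)
  push_cast [Nat.cast_sub this]
  ring

theorem ratNum_rsub (m n : ℕ) : ratNum (rsub m n) = ratNum m - ratNum n := by
  simp only [ratNum, rsub, Nat.unpair_pair, cast_den]
  have h1 : (m.unpair.2 : ℚ) + 1 ≠ 0 := by positivity
  have h2 : (n.unpair.2 : ℚ) + 1 ≠ 0 := by positivity
  field_simp
  push_cast
  ring

theorem ratNum_radd (m n : ℕ) : ratNum (radd m n) = ratNum m + ratNum n := by
  simp only [ratNum, radd, Nat.unpair_pair, cast_den]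
  have h1 : (m.unpair.2 : ℚ) + 1 ≠ 0 := by positivity
  have h2 : (n.unpair.2 : ℚ) + 1 ≠ 0 := by positivity
  field_simp
  push_cast
  ring

theorem ratNum_rmul (m n : ℕ) : ratNum (rmul m n) = ratNum m * ratNum n := by
  simp only [ratNum, rmul, Nat.unpair_pair, cast_den]
  have h1 : (m.unpair.2 : ℚ) + 1 ≠ 0 := by positivity
  have h2 : (n.unpair.2 : ℚ) + 1 ≠ 0 := by positivity
  field_simp
  push_cast
  ring

theorem rlt_iff (m n : ℕ) : rlt m n = true ↔ ratNum m < ratNum n := by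
  simp only [rlt, ratNum, decide_eq_true_eq]
  rw [div_lt_div_iff₀ (by positivity) (by positivity), ← Nat.cast_lt (α := ℚ)]
  push_cast
  constructor <;> intro h <;> linarith

theorem ratNum_rpowInv {b : ℕ} (hb : 1 ≤ b) (i : ℕ) :
    ratNum (rpowInv b i) = (1 / (b : ℚ)) ^ i := by
  have : 1 ≤ b ^ i := Nat.one_le_pow _ _ hb
  simp only [ratNum, rpowInv, Nat.unpair_pair]
  push_cast [Nat.cast_sub this]
  simp

theorem ratNum_natCast (k : ℕ) : ratNum (Nat.pair (Nat.pair k 0) 0) = k := by simp [ratNum]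

theorem ratNum_surjective : Function.Surjective ratNum := by
  intro q
  refine ⟨Nat.pair (Nat.pair q.num.toNat (-q.num).toNat) (q.den - 1), ?_⟩
  have hd : 1 ≤ q.den := q.den_pos
  simp only [ratNum, Nat.unpair_pair]
  push_cast [Nat.cast_sub hd]
  have : ((q.num.toNat : ℚ) - ((-q.num).toNat : ℚ)) = q.num := by
    have := Int.toNat_sub_toNat_neg q.num
    exact_mod_cast this
  rw [this]
  simp [Rat.num_div_den]

theorem realPt_surjOn (q : ℚ) : ∃ n, realPt n = q := by
  obtain ⟨n, hn⟩ := ratNum_surjective q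
  exact ⟨n, by rw [realPt, hn]⟩

theorem exists_realPt_between {x y : ℝ} (h : x < y) : ∃ n, x < realPt n ∧ realPt n < y := by
  obtain ⟨q, h1, h2⟩ := exists_rat_btwn h
  obtain ⟨n, hn⟩ := realPt_surjOn q
  exact ⟨n, by rw [hn]; exact h1, by rw [hn]; exact h2⟩

theorem rlt_iff_realPt (m n : ℕ) : rlt m n = true ↔ realPt m < realPt n := by
  rw [rlt_iff, realPt, realPt, Rat.cast_lt]

theorem realPt_rpowInv {b : ℕ} (hb : 1 ≤ b) (i : ℕ) : realPt (rpowInv b i) = (1 / (b : ℝ)) ^ i := by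
  rw [realPt, ratNum_rpowInv hb]
  push_cast
  rfl

variable {α : Type*} [Primcodable α] {f g : α → ℕ}

@[fun_prop] theorem computable_rsub (hf : Computable f) (hg : Computable g) :
    Computable fun a => rsub (f a) (g a) := by
  unfold rsub; fun_prop

@[fun_prop] theorem computable_radd (hf : Computable f) (hg : Computable g) :
    Computable fun a => radd (f a) (g a) := by
  unfold radd; fun_prop

@[fun_prop] theorem computable_rmul (hf : Computable f) (hg : Computable g) :
    Computable fun a => rmul (f a) (g a) := by
  unfold rmul; fun_prop

@[fun_prop] theorem computable_rlt (hf : Computable f) (hg : Computable g) :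
    Computable fun a => rlt (f a) (g a) := by
  exact computable_decide_lt (by fun_prop) (by fun_prop)

@[fun_prop] theorem computable_rpowInv (hf : Computable f) (hg : Computable g) :
    Computable fun a => rpowInv (f a) (g a) := by
  unfold rpowInv; fun_prop

end Codes

attribute [irreducible] rsub radd rmul rlt rpowInv

/-! Formal inclusion and disjointness of rational balls -/

/-- A dense numbered set of points together with a computation of their squared distances. -/
structure PointCode {E : Type*} [PseudoMetricSpace E] (pt : ℕ → E) where
  sqd : ℕ → ℕ → ℕ
  computable_sqd : Computable fun p : ℕ × ℕ => sqd p.1 p.2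
  realPt_sqd : ∀ m n, realPt (sqd m n) = dist (pt m) (pt n) ^ 2
  dense : DenseRange pt

/-- The closed ball with the same centre and radius as `ratBall pt n`. -/
def ratClosedBall {E : Type*} [PseudoMetricSpace E] (pt : ℕ → E) (n : ℕ) : Set E :=
  Metric.closedBall (pt n.unpair.1) (ratNum n.unpair.2 : ℝ)

/-- A code of a ball with negative radius. -/
def negBall : ℕ := Nat.pair 0 (Nat.pair (Nat.pair 0 1) 0)

namespace PointCode

variable {E : Type*} [PseudoMetricSpace E] {pt : ℕ → E} (S : PointCode pt)

/-- Formal inclusion of balls: distance of the centres plus first radius less than second. -/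
def inc (b b' : ℕ) : Bool :=
  rlt b.unpair.2 b'.unpair.2 && rlt (S.sqd b.unpair.1 b'.unpair.1)
    (rmul (rsub b'.unpair.2 b.unpair.2) (rsub b'.unpair.2 b.unpair.2))

/-- Formal disjointness of balls: sum of the radii less than the distance of the centres. -/
def disj (b b' : ℕ) : Bool :=
  rlt (radd b.unpair.2 b'.unpair.2) 0 || rlt (rmul (radd b.unpair.2 b'.unpair.2)
    (radd b.unpair.2 b'.unpair.2)) (S.sqd b.unpair.1 b'.unpair.1)

/-- Distances of rational points need not be rational, but their squares are. Comparing the radii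
first makes squaring an equivalence. -/
theorem inc_iff (b b' : ℕ) : S.inc b b' = true ↔
    dist (pt b.unpair.1) (pt b'.unpair.1) + realPt b.unpair.2 < realPt b'.unpair.2 := by
  have hd : 0 ≤ dist (pt b.unpair.1) (pt b'.unpair.1) := dist_nonneg
  simp only [inc, Bool.and_eq_true, rlt_iff_realPt, S.realPt_sqd]
  have e : realPt (rmul (rsub b'.unpair.2 b.unpair.2) (rsub b'.unpair.2 b.unpair.2)) =
      (realPt b'.unpair.2 - realPt b.unpair.2) ^ 2 := by
    simp only [realPt, ratNum_rmul, ratNum_rsub]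
    push_cast
    ring
  rw [e]
  constructor
  · rintro ⟨h1, h2⟩
    have := lt_of_pow_lt_pow_left₀ 2 (by linarith) h2
    linarith
  · intro h
    refine ⟨by linarith, ?_⟩
    exact pow_lt_pow_left₀ (by linarith) hd (by norm_num)

theorem disj_iff (b b' : ℕ) : S.disj b b' = true ↔
    realPt b.unpair.2 + realPt b'.unpair.2 < dist (pt b.unpair.1) (pt b'.unpair.1) := by
  have hd : 0 ≤ dist (pt b.unpair.1) (pt b'.unpair.1) := dist_nonneg
  simp only [disj, Bool.or_eq_true, rlt_iff_realPt, S.realPt_sqd]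
  have e : realPt (radd b.unpair.2 b'.unpair.2) = realPt b.unpair.2 + realPt b'.unpair.2 := by
    simp only [realPt, ratNum_radd]
    push_cast
    ring
  have e2 : realPt (rmul (radd b.unpair.2 b'.unpair.2) (radd b.unpair.2 b'.unpair.2)) =
      (realPt b.unpair.2 + realPt b'.unpair.2) ^ 2 := by
    simp only [realPt, ratNum_radd, ratNum_rmul]
    push_cast
    ring
  have e0 : realPt 0 = 0 := by simp [realPt, ratNum]
  rw [e, e2, e0]
  constructor
  · rintro (h | h)
    · linarith
    · exact lt_of_pow_lt_pow_left₀ 2 hd h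
  · intro h
    rcases lt_or_ge (realPt b.unpair.2 + realPt b'.unpair.2) 0 with h0 | h0
    · exact Or.inl h0
    · exact Or.inr (pow_lt_pow_left₀ h h0 (by norm_num))

@[fun_prop] theorem computable_inc {α : Type*} [Primcodable α] {f g : α → ℕ} (hf : Computable f)
    (hg : Computable g) : Computable fun a => S.inc (f a) (g a) := by
  have := S.computable_sqd.comp
    (g := fun a => ((f a).unpair.1, (g a).unpair.1)) (by fun_prop)
  unfold inc
  exact computable_and (by fun_prop) (computable_rlt this (by fun_prop))

@[fun_prop] theorem computable_disj {α : Type*} [Primcodable α] {f g : α → ℕ} (hf : Computable f)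
    (hg : Computable g) : Computable fun a => S.disj (f a) (g a) := by
  have := S.computable_sqd.comp
    (g := fun a => ((f a).unpair.1, (g a).unpair.1)) (by fun_prop)
  unfold disj
  exact computable_or (by fun_prop) (computable_rlt (by fun_prop) this)

attribute [irreducible] inc disj

theorem mem_ratBall {x : E} {b : ℕ} :
    x ∈ ratBall pt b ↔ dist x (pt b.unpair.1) < realPt b.unpair.2 := Iff.rfl

theorem mem_ratClosedBall {x : E} {b : ℕ} :
    x ∈ ratClosedBall pt b ↔ dist x (pt b.unpair.1) ≤ realPt b.unpair.2 := Iff.rfl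

theorem realPt_negBall : realPt negBall.unpair.2 = -1 := by simp [negBall, realPt, ratNum]

theorem notMem_ratClosedBall_negBall (x : E) : x ∉ ratClosedBall pt negBall := by
  rw [mem_ratClosedBall, realPt_negBall, not_le]
  linarith [dist_nonneg (x := x) (y := pt negBall.unpair.1)]

theorem notMem_ratBall_negBall (x : E) : x ∉ ratBall pt negBall :=
  fun h => notMem_ratClosedBall_negBall x (Metric.ball_subset_closedBall h)

variable {S}

theorem mem_ratBall_of_inc {b b' : ℕ} (h : S.inc b b' = true) {x : E}
    (hx : x ∈ ratClosedBall pt b) : x ∈ ratBall pt b' := by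
  rw [S.inc_iff] at h
  rw [mem_ratClosedBall] at hx
  rw [mem_ratBall]
  have := dist_triangle x (pt b.unpair.1) (pt b'.unpair.1)
  linarith

theorem notMem_of_disj {b b' : ℕ} (h : S.disj b b' = true) {x : E}
    (hx : x ∈ ratClosedBall pt b) : x ∉ ratClosedBall pt b' := by
  rw [S.disj_iff] at h
  rw [mem_ratClosedBall] at hx ⊢
  have := dist_triangle_left (pt b.unpair.1) (pt b'.unpair.1) x
  intro h'
  linarith

theorem mem_ratClosedBall_of_mem {b : ℕ} {x : E} (hx : x ∈ ratBall pt b) :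
    x ∈ ratClosedBall pt b := Metric.ball_subset_closedBall hx

theorem inc_of_lt {x : E} {b b' : ℕ} {ε : ℝ} (hx : x ∈ ratClosedBall pt b)
    (hr : realPt b.unpair.2 ≤ ε) (h : dist x (pt b'.unpair.1) + 2 * ε < realPt b'.unpair.2) :
    S.inc b b' = true := by
  rw [S.inc_iff]
  rw [mem_ratClosedBall] at hx
  have := dist_triangle_left (pt b.unpair.1) (pt b'.unpair.1) x
  linarith

theorem disj_of_lt {x : E} {b b' : ℕ} {ε : ℝ} (hx : x ∈ ratClosedBall pt b)
    (hr : realPt b.unpair.2 ≤ ε) (h : realPt b'.unpair.2 + 2 * ε < dist x (pt b'.unpair.1)) :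
    S.disj b b' = true := by
  rw [S.disj_iff]
  rw [mem_ratClosedBall] at hx
  have := dist_triangle x (pt b.unpair.1) (pt b'.unpair.1)
  linarith

theorem exists_small (S : PointCode pt) (x : E) {ε : ℝ} (hε : 0 < ε) :
    ∃ b, x ∈ ratBall pt b ∧ realPt b.unpair.2 < ε := by
  obtain ⟨r, hr0, hr⟩ := exists_realPt_between hε
  obtain ⟨c, hc⟩ := Metric.denseRange_iff.1 S.dense x _ hr0
  exact ⟨Nat.pair c r, by simpa [mem_ratBall] using hc, by simpa using hr⟩

theorem exists_inc (S : PointCode pt) {x : E} {b : ℕ} (hx : x ∈ ratBall pt b) {ε : ℝ} (hε : 0 < ε) :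
    ∃ b', S.inc b' b = true ∧ x ∈ ratBall pt b' ∧ realPt b'.unpair.2 < ε := by
  rw [mem_ratBall] at hx
  obtain ⟨b', hb, hr⟩ := S.exists_small x (ε := min ε
    ((realPt b.unpair.2 - dist x (pt b.unpair.1)) / 3)) (lt_min hε (by linarith))
  refine ⟨b', inc_of_lt (mem_ratClosedBall_of_mem hb) (hr.le.trans (min_le_right _ _)) ?_, hb,
    hr.trans_le (min_le_left _ _)⟩
  linarith

theorem exists_inc_disj (S : PointCode pt) {x : E} {b b₀ : ℕ} (hx : x ∈ ratBall pt b)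
    (hx' : x ∉ ratClosedBall pt b₀) :
    ∃ b', S.inc b' b = true ∧ x ∈ ratBall pt b' ∧ S.disj b' b₀ = true := by
  rw [mem_ratClosedBall, not_le] at hx'
  obtain ⟨b', h1, h2, h3⟩ := S.exists_inc hx (ε := (dist x (pt b₀.unpair.1) - realPt b₀.unpair.2) / 3)
    (by linarith)
  exact ⟨b', h1, h2, disj_of_lt (mem_ratClosedBall_of_mem h2) h3.le (by linarith)⟩

theorem exists_disj (S : PointCode pt) {x : E} {b₀ : ℕ} (hx' : x ∉ ratClosedBall pt b₀) :
    ∃ b', x ∈ ratBall pt b' ∧ S.disj b' b₀ = true := by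
  rw [mem_ratClosedBall, not_le] at hx'
  obtain ⟨b', h2, h3⟩ := S.exists_small x (ε := (dist x (pt b₀.unpair.1) - realPt b₀.unpair.2) / 3)
    (by linarith)
  exact ⟨b', h2, disj_of_lt (mem_ratClosedBall_of_mem h2) h3.le (by linarith)⟩

variable (S)

/-- The test whether `m`-th entry `c` of a name shows that the named point is in a ball. -/
def near (c m b : ℕ) : Bool := S.inc (Nat.pair c (rpowInv 2 m)) b

@[fun_prop] theorem computable_near {α : Type*} [Primcodable α] {f g h : α → ℕ}
    (hf : Computable f) (hg : Computable g) (hh : Computable h) :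
    Computable fun a => S.near (f a) (g a) (h a) := by
  unfold near
  fun_prop

/-- The closed balls of radius `2^(-m)` around the entries contain `x` and shrink to it, so one of
them is eventually included in any open ball around `x` with positive slack. -/
theorem mem_ratBall_iff_near {x : E} {s : ℕ → ℕ}
    (hs : ∀ m, dist x (pt (s m)) ≤ (1 / 2 : ℝ) ^ m) {b : ℕ} :
    x ∈ ratBall pt b ↔ ∃ m, S.near (s m) m b = true := by
  have hcl : ∀ m, x ∈ ratClosedBall pt (Nat.pair (s m) (rpowInv 2 m)) := by
    intro m
    rw [mem_ratClosedBall]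
    simpa [realPt_rpowInv] using hs m
  constructor
  · intro hx
    rw [mem_ratBall] at hx
    obtain ⟨m, hm⟩ := exists_pow_lt_of_lt_one
      (show 0 < (realPt b.unpair.2 - dist x (pt b.unpair.1)) / 2 by linarith)
      (show (1 / 2 : ℝ) < 1 by norm_num)
    refine ⟨m, inc_of_lt (hcl m) (ε := (1 / 2 : ℝ) ^ m) ?_ (by linarith)⟩
    simp [realPt_rpowInv]
  · rintro ⟨m, hm⟩
    exact mem_ratBall_of_inc hm (hcl m)

end PointCode

theorem denseRange_realPt : DenseRange realPt := by
  have h : Set.range realPt = Set.range ((↑) : ℚ → ℝ) := by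
    ext x
    constructor
    · rintro ⟨n, rfl⟩
      exact ⟨ratNum n, rfl⟩
    · rintro ⟨q, rfl⟩
      exact realPt_surjOn q
  rw [DenseRange, h]
  exact Rat.denseRange_cast

/-- The rational points of the line. -/
def realCode : PointCode realPt where
  sqd m n := rmul (rsub m n) (rsub m n)
  computable_sqd := by fun_prop
  realPt_sqd m n := by
    rw [Real.dist_eq, sq_abs]
    simp only [realPt, ratNum_rmul, ratNum_rsub]
    push_cast
    ring
  dense := denseRange_realPt

/-- A code of the sum of the squared differences of the first `D` coordinates. -/
def sqdVec (m n : ℕ) : ℕ → ℕ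
  | 0 => 0
  | i + 1 => radd (sqdVec m n i)
      (rmul (rsub ((Denumerable.ofNat (List ℕ) m)[i]?.getD 0) ((Denumerable.ofNat (List ℕ) n)[i]?.getD 0))
        (rsub ((Denumerable.ofNat (List ℕ) m)[i]?.getD 0) ((Denumerable.ofNat (List ℕ) n)[i]?.getD 0)))

theorem realPt_sqdVec (m n D : ℕ) : realPt (sqdVec m n D) = ∑ i : Fin D,
    (realPt ((Denumerable.ofNat (List ℕ) m).getD i 0) -
      realPt ((Denumerable.ofNat (List ℕ) n).getD i 0)) ^ 2 := by
  induction D with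
  | zero => simp [sqdVec, realPt, ratNum]
  | succ D ih =>
    rw [Fin.sum_univ_castSucc]
    simp only [Fin.val_castSucc, Fin.val_last]
    rw [← ih]
    simp only [sqdVec, realPt, ratNum_radd, ratNum_rmul, ratNum_rsub, List.getD_eq_getElem?_getD]
    push_cast
    ring

theorem denseRange_vecPt (D : ℕ) : DenseRange (vecPt D) := by
  have h1 : Dense {v : Fin D → ℝ | ∀ i, v i ∈ Set.range realPt} := by
    have := dense_pi (Set.univ : Set (Fin D)) (s := fun _ => Set.range realPt)
      (fun _ _ => denseRange_realPt)
    simpa [Set.pi] using this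
  have h2 : {v : Fin D → ℝ | ∀ i, v i ∈ Set.range realPt} ⊆
      Set.range fun n : ℕ => fun i : Fin D => realPt ((Denumerable.ofNat (List ℕ) n).getD i 0) := by
    intro v hv
    choose c hc using hv
    refine ⟨Encodable.encode (List.ofFn c), ?_⟩
    funext i
    simp [Denumerable.ofNat_encode, List.getD_eq_getElem?_getD, hc]
  have h3 : DenseRange fun n : ℕ => fun i : Fin D =>
      realPt ((Denumerable.ofNat (List ℕ) n).getD i 0) := h1.mono h2
  have h4 : DenseRange (WithLp.toLp 2 : (Fin D → ℝ) → EuclideanSpace ℝ (Fin D)) :=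
    (WithLp.toLp_surjective 2).denseRange
  exact h4.comp h3 (PiLp.continuous_toLp 2 _)

/-- The rational points of Euclidean space. -/
noncomputable def vecCode (D : ℕ) : PointCode (vecPt D) where
  sqd m n := sqdVec m n D
  computable_sqd := by
    induction D with
    | zero => exact Computable.const 0
    | succ D ih => simp only [sqdVec]; fun_prop
  realPt_sqd m n := by
    rw [realPt_sqdVec, EuclideanSpace.dist_eq, Real.sq_sqrt (by positivity)]
    refine Finset.sum_congr rfl fun i _ => ?_
    rw [Real.dist_eq, sq_abs]
    rfl
  dense := denseRange_vecPt D

end TTE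

namespace TTE

/-! Alternating quantifiers and forcing -/

section Forcing

variable {A : Type*}

/-- Truth of the state `a` of a system of alternating quantifiers: an existential step `n` is
allowed if `upd a n` is defined, and leads to the negation of the next state. -/
def Sat (upd : A → ℕ → Option A) (base : A → ℕ → Prop) : ℕ → A → Prop
  | 0, a => ∃ n, base a n
  | d + 1, a => ∃ n a', upd a n = some a' ∧ ¬ Sat upd base d a'

/-- Forcing of `Sat` by conditions `v` with property `P`, ordered by extension. -/
def Forces (upd : A → ℕ → Option A) (P : List ℕ → Prop) (base : A → ℕ → List ℕ → Prop) :
    ℕ → A → List ℕ → Prop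
  | 0, a, v => ∃ n, base a n v
  | d + 1, a, v => ∃ n a', upd a n = some a' ∧
      ∀ v', v <+: v' → P v' → ¬ Forces upd P base d a' v'

theorem Forces.mono {upd : A → ℕ → Option A} {P : List ℕ → Prop} {base : A → ℕ → List ℕ → Prop}
    (hb : ∀ a n v v', v <+: v' → base a n v → base a n v') {d : ℕ} {a : A} {v v' : List ℕ}
    (hv : v <+: v') (h : Forces upd P base d a v) : Forces upd P base d a v' := by
  cases d with
  | zero =>
    obtain ⟨n, hn⟩ := h
    exact ⟨n, hb _ _ _ _ hv hn⟩
  | succ d =>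
    obtain ⟨n, a', ha, h⟩ := h
    exact ⟨n, a', ha, fun w hw => h w (hv.trans hw)⟩

theorem exists_limit_of_chain {α : Type*} [Inhabited α] {V : ℕ → List α}
    (h1 : ∀ n, V n <+: V (n + 1)) (h2 : ∀ n, (V n).length < (V (n + 1)).length) :
    ∃ σ : ℕ → α, ∀ n, V n = pfx σ (V n).length := by
  have hmono : ∀ m n, m ≤ n → V m <+: V n := by
    intro m n h
    induction h with
    | refl => exact List.prefix_rfl
    | step _ ih => exact ih.trans (h1 _)
  have hlen : ∀ n, n ≤ (V n).length := by
    intro n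
    induction n with
    | zero => exact Nat.zero_le _
    | succ n ih => exact Nat.succ_le_of_lt (ih.trans_lt (h2 n))
  refine ⟨fun i => ((V (i + 1))[i]?).getD default, fun n => List.ext_getElem? fun i => ?_⟩
  rcases lt_or_ge i (V n).length with hi | hi
  · rw [getElem?_pfx _ hi]
    have hi' : i < (V (i + 1)).length := hlen (i + 1)
    have e1 := getElem?_of_prefix (hmono _ _ (le_max_left n (i + 1))) (List.getElem?_eq_getElem hi)
    have e2 := getElem?_of_prefix (hmono _ _ (le_max_right n (i + 1)))
      (List.getElem?_eq_getElem hi')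
    rw [List.getElem?_eq_getElem hi, List.getElem?_eq_getElem hi', Option.getD_some, ← e2, e1]
  · rw [List.getElem?_eq_none hi, List.getElem?_eq_none (by simpa using hi)]

/-- Existence of sequences that are generic for countably many properties of conditions. -/
theorem exists_generic {P : List ℕ → Prop} (hext : ∀ v, P v → ∃ b, P (v ++ [b]))
    (hpre : ∀ v v', v <+: v' → v ≠ [] → P v' → P v) (Q : ℕ → List ℕ → Prop) {v₀ : List ℕ}
    (hv₀ : P v₀) :
    ∃ σ : ℕ → ℕ, pfx σ v₀.length = v₀ ∧ (∀ k, P (pfx σ (k + 1))) ∧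
      ∀ n, ∃ k, Q n (pfx σ k) ∨ ∀ v', pfx σ k <+: v' → P v' → ¬ Q n v' := by
  have step : ∀ (n : ℕ) (v : {v // P v}), ∃ v' : {v // P v}, v.1 <+: v'.1 ∧
      v.1.length < v'.1.length ∧ (Q n v'.1 ∨ ∀ w, v'.1 <+: w → P w → ¬ Q n w) := by
    rintro n ⟨v, hv⟩
    obtain ⟨b, hb⟩ := hext v hv
    -- Decide `Q n`: satisfy it by an extension if there is one; otherwise every extension fails it.
    -- The entry `b` is added in both cases so that the lengths grow without bound.
    by_cases h : ∃ w, v ++ [b] <+: w ∧ P w ∧ Q n w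
    · obtain ⟨w, hw, hPw, hQ⟩ := h
      refine ⟨⟨w, hPw⟩, (List.prefix_append _ _).trans hw, ?_, Or.inl hQ⟩
      have := hw.length_le
      simp only [List.length_append, List.length_cons, List.length_nil] at this
      exact this
    · push Not at h
      exact ⟨⟨v ++ [b], hb⟩, List.prefix_append _ _, by simp, Or.inr h⟩
  choose f hf1 hf2 hf3 using step
  let V : ℕ → {v // P v} := fun n => Nat.rec (motive := fun _ => {v // P v}) ⟨v₀, hv₀⟩ f n
  have hV : ∀ n, V (n + 1) = f n (V n) := fun _ => rfl
  obtain ⟨σ, hσ⟩ := exists_limit_of_chain (V := fun n => (V n).1)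
    (fun n => by rw [hV]; exact hf1 _ _) (fun n => by rw [hV]; exact hf2 _ _)
  have hlen : ∀ n, n ≤ (V n).1.length := by
    intro n
    induction n with
    | zero => exact Nat.zero_le _
    | succ n ih => exact Nat.succ_le_of_lt (ih.trans_lt (by rw [hV]; exact hf2 _ _))
  refine ⟨σ, (hσ 0).symm, fun k => ?_, fun n => ⟨(V (n + 1)).1.length, ?_⟩⟩
  · refine hpre _ (V (k + 1)).1 ?_ ?_ (V (k + 1)).2
    · rw [hσ (k + 1)]
      exact pfx_prefix σ (hlen (k + 1))
    · rw [pfx_succ]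
      simp
  · rw [← hσ (n + 1), hV]
    exact hf3 _ _

/-- The truth lemma of forcing. At a negation, genericity yields a prefix that either forces the
next state or has no extension forcing it. By induction the first alternative is truth of that
state, and the second is exactly what forcing its negation means. -/
theorem sat_iff_forces {upd : A → ℕ → Option A} {P : List ℕ → Prop}
    {base : A → ℕ → List ℕ → Prop} (hb : ∀ a n v v', v <+: v' → base a n v → base a n v')
    {σ : ℕ → ℕ} (hP : ∀ k, P (pfx σ (k + 1)))
    (hgen : ∀ d a, ∃ k, Forces upd P base d a (pfx σ k) ∨
      ∀ v', pfx σ k <+: v' → P v' → ¬ Forces upd P base d a v') (d : ℕ) (a : A) :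
    Sat upd (fun a n => ∃ k, base a n (pfx σ k)) d a ↔ ∃ k, Forces upd P base d a (pfx σ k) := by
  induction d generalizing a with
  | zero =>
    constructor
    · rintro ⟨n, k, h⟩
      exact ⟨k, n, h⟩
    · rintro ⟨k, n, h⟩
      exact ⟨n, k, h⟩
  | succ d ih =>
    constructor
    · rintro ⟨n, a', ha, h⟩
      rw [ih, not_exists] at h
      obtain ⟨k, hk⟩ := hgen d a'
      exact ⟨k, n, a', ha, hk.resolve_left (h k)⟩
    · rintro ⟨k, n, a', ha, h⟩
      refine ⟨n, a', ha, fun h' => ?_⟩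
      obtain ⟨k', hk'⟩ := (ih a').1 h'
      exact h _ (pfx_prefix σ ((le_max_left k k').trans (Nat.le_succ _))) (hP _)
        (Forces.mono hb (pfx_prefix σ ((le_max_right k k').trans (Nat.le_succ _))) hk')

end Forcing

/-! Conditions: shrinking sequences of balls that start inside a given open set -/

section Conditions

variable {E : Type*} [PseudoMetricSpace E] {pt : ℕ → E} (S : PointCode pt)

/-- Appending the ball `b` to a condition whose last ball, and their number, is given. -/
def condStep (o : Option (ℕ × ℕ)) (b : ℕ) : Option (ℕ × ℕ) :=
  o.bind fun p => bif S.inc b p.1 && rlt b.unpair.2 (rpowInv 2 p.2) then some (b, p.2 + 1) else none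

/-- The last ball and the number of steps of a condition `t :: l`, where `t` selects the first
ball `xs t`, and `l` lists balls each of which is formally included in the preceding one. -/
def lastBall (xs : ℕ → ℕ) (v : List ℕ) : Option (ℕ × ℕ) :=
  v.head?.bind fun t => (v.drop 1).foldl (condStep S) (some (xs t, 0))

/-- The condition `v` is valid and compatible with the point `x`. -/
def IsCond (xs : ℕ → ℕ) (x : E) (v : List ℕ) : Prop :=
  ∃ p, lastBall S xs v = some p ∧ x ∈ ratBall pt p.1

/-- The centres of the balls of a condition. -/
def centres (v : List ℕ) : List ℕ := (v.drop 1).map fun b => b.unpair.1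

variable {S} {xs : ℕ → ℕ}

theorem lastBall_concat {v : List ℕ} (hv : v ≠ []) (b : ℕ) :
    lastBall S xs (v ++ [b]) = condStep S (lastBall S xs v) b := by
  cases v with
  | nil => exact absurd rfl hv
  | cons t l => simp [lastBall]

theorem condStep_eq_some {o : Option (ℕ × ℕ)} {b : ℕ} {p : ℕ × ℕ} :
    condStep S o b = some p ↔ ∃ q, o = some q ∧ S.inc b q.1 = true ∧
      rlt b.unpair.2 (rpowInv 2 q.2) = true ∧ p = (b, q.2 + 1) := by
  simp only [condStep, Option.bind_eq_some_iff]
  refine exists_congr fun q => and_congr_right fun _ => ?_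
  cases h1 : S.inc b q.1 <;> cases h2 : rlt b.unpair.2 (rpowInv 2 q.2) <;> simp [eq_comm]

theorem length_of_lastBall {v : List ℕ} {p : ℕ × ℕ} (h : lastBall S xs v = some p) :
    v.length = p.2 + 1 := by
  induction v using List.reverseRecOn generalizing p with
  | nil => simp [lastBall] at h
  | append_singleton v b ih =>
    by_cases hv : v = []
    · subst hv
      simp [lastBall] at h
      rw [← h]
      rfl
    · rw [lastBall_concat hv, condStep_eq_some] at h
      obtain ⟨q, hq, -, -, rfl⟩ := h
      simp [ih hq]

theorem IsCond.of_prefix {x : E} {v v' : List ℕ} (h : v <+: v') (hv : v ≠ [])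
    (h' : IsCond S xs x v') : IsCond S xs x v := by
  obtain ⟨t, rfl⟩ := h
  induction t using List.reverseRecOn with
  | nil => simpa using h'
  | append_singleton t b ih =>
    apply ih
    rw [← List.append_assoc] at h'
    obtain ⟨p, hp, hx⟩ := h'
    rw [lastBall_concat (by simp [hv]), condStep_eq_some] at hp
    obtain ⟨q, hq, hi, -, rfl⟩ := hp
    exact ⟨q, hq, PointCode.mem_ratBall_of_inc hi (PointCode.mem_ratClosedBall_of_mem hx)⟩

theorem IsCond.exists_concat {x : E} {v : List ℕ} (h : IsCond S xs x v) :
    ∃ b, IsCond S xs x (v ++ [b]) := by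
  obtain ⟨p, hp, hx⟩ := h
  obtain ⟨b, h1, h2, h3⟩ := S.exists_inc hx (ε := (1 / 2 : ℝ) ^ p.2) (by positivity)
  have hv : v ≠ [] := by
    rintro rfl
    simp [lastBall] at hp
  refine ⟨b, (b, p.2 + 1), ?_, h2⟩
  rw [lastBall_concat hv, condStep_eq_some]
  refine ⟨p, hp, h1, ?_, rfl⟩
  rw [rlt_iff_realPt, realPt_rpowInv one_le_two]
  exact_mod_cast h3

theorem isCond_singleton {x : E} {t : ℕ} (h : x ∈ ratBall pt (xs t)) : IsCond S xs x [t] :=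
  ⟨(xs t, 0), rfl, h⟩

theorem centres_pfx (σ : ℕ → ℕ) (k : ℕ) :
    centres (pfx σ (k + 1)) = pfx (fun i => (σ (i + 1)).unpair.1) k := by
  simp [centres, pfx, List.range_succ_eq_map, Function.comp_def]

theorem centres_mono {v v' : List ℕ} (h : v <+: v') : centres v <+: centres v' := by
  obtain ⟨t, rfl⟩ := h
  cases v with
  | nil => exact List.nil_prefix
  | cons a l =>
    simp only [centres, List.cons_append, List.drop_succ_cons, List.drop_zero, List.map_append]
    exact List.prefix_append _ _

/-- An infinite compatible chain thus yields a name of `x`: the ball appended at step `i` contains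
`x` and has radius below `2^(-i)`. The offset by one skips the selector of the first ball. -/
theorem dist_le_of_isCond {x : E} {σ : ℕ → ℕ} (h : ∀ k, IsCond S xs x (pfx σ (k + 1))) (i : ℕ) :
    dist x (pt (σ (i + 1)).unpair.1) ≤ (1 / 2 : ℝ) ^ i := by
  obtain ⟨p, hp, hx⟩ := h (i + 1)
  rw [pfx_succ, lastBall_concat (by simp [pfx_succ]), condStep_eq_some] at hp
  obtain ⟨q, hq, -, hr, rfl⟩ := hp
  have hl := length_of_lastBall hq
  rw [length_pfx] at hl
  obtain rfl : i = q.2 := by omega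
  rw [rlt_iff_realPt, realPt_rpowInv one_le_two] at hr
  rw [PointCode.mem_ratBall] at hx
  exact_mod_cast (hx.trans hr).le

/-- If the truth of a statement about the names of `x` depends on `x` only, it is equivalent to
being forced by some condition. -/
theorem exists_forces_iff {A : Type*} [Countable A] {upd : A → ℕ → Option A}
    {base : A → ℕ → List ℕ → Prop} (hb : ∀ a n v v', v <+: v' → base a n v → base a n v')
    {x : E} (hx : ∃ t, x ∈ ratBall pt (xs t)) {Q : Prop} {ι : Type*} {d : ℕ} {a₀ : ι → A}
    (h : ∀ s : ℕ → ℕ, (∀ m, dist x (pt (s m)) ≤ (1 / 2 : ℝ) ^ m) →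
      ((∃ j, Sat upd (fun a n => ∃ k, base a n (pfx s k)) d (a₀ j)) ↔ Q)) :
    (∃ j v, IsCond S xs x v ∧
      Forces upd (IsCond S xs x) (fun a n v => base a n (centres v)) d (a₀ j) v) ↔ Q := by
  -- Without indices nothing is forced; that `Q` fails too follows from the hypothesis, once some
  -- name of `x` is known to exist.
  by_cases hA : IsEmpty ι
  · obtain ⟨t, ht⟩ := hx
    obtain ⟨σ, -, hσ, -⟩ := exists_generic (fun _ h => IsCond.exists_concat h)
      (fun _ _ h h' h'' => IsCond.of_prefix h h' h'') (fun _ _ => True)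
      (isCond_singleton (S := S) ht)
    rw [← h _ (dist_le_of_isCond hσ)]
    simp
  rw [not_isEmpty_iff] at hA
  obtain ⟨j₀⟩ := hA
  have : Nonempty (ℕ × A) := ⟨(0, a₀ j₀)⟩
  -- Genericity is required only for the countably many pairs of a level and a state.
  obtain ⟨e, he⟩ := exists_surjective_nat (ℕ × A)
  have hb' : ∀ (a : A) n v v', v <+: v' → base a n (centres v) → base a n (centres v') :=
    fun a n v v' hv => hb a n _ _ (centres_mono hv)
  set Fc := Forces upd (IsCond S xs x) (fun a n v => base a n (centres v)) with hFc
  -- Every condition extends to a generic name, and every name gives the same answer `Q`. Hence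
  -- whatever a condition forces is decisive for `Q`.
  have main : ∀ v₀, IsCond S xs x v₀ → ∃ σ : ℕ → ℕ, pfx σ v₀.length = v₀ ∧
      (∀ k, IsCond S xs x (pfx σ (k + 1))) ∧ ((∃ j k, Fc d (a₀ j) (pfx σ k)) ↔ Q) := by
    intro v₀ hv₀
    obtain ⟨σ, h1, h2, h3⟩ := exists_generic (fun _ h => IsCond.exists_concat h)
      (fun _ _ h h' h'' => IsCond.of_prefix h h' h'') (fun n v => Fc (e n).1 (e n).2 v) hv₀
    refine ⟨σ, h1, h2, ?_⟩
    rw [← h _ (dist_le_of_isCond h2)]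
    refine exists_congr fun j => ?_
    rw [hFc, ← sat_iff_forces hb' h2]
    · have : (fun (a : A) n => ∃ k, base a n (centres (pfx σ k))) =
          fun a n => ∃ k, base a n (pfx (fun m => (σ (m + 1)).unpair.1) k) := by
        funext a n
        apply propext
        constructor
        · rintro ⟨k, hk⟩
          exact ⟨k, by rw [← centres_pfx]; exact hb' a n _ _ (pfx_prefix σ (Nat.le_succ k)) hk⟩
        · rintro ⟨k, hk⟩
          exact ⟨k + 1, by rw [centres_pfx]; exact hk⟩
      rw [this]
    · intro d a
      obtain ⟨n, hn⟩ := he (d, a)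
      simpa [hn] using h3 n
  constructor
  · rintro ⟨j, v, hv, hf⟩
    obtain ⟨σ, h1, -, h3⟩ := main v hv
    exact h3.1 ⟨j, v.length, by rwa [h1]⟩
  · intro hQ
    obtain ⟨t, ht⟩ := hx
    obtain ⟨σ, -, h2, h3⟩ := main [t] (isCond_singleton ht)
    obtain ⟨j, k, hk⟩ := h3.2 hQ
    exact ⟨j, pfx σ (k + 1), h2 k, Forces.mono hb' (pfx_prefix σ (Nat.le_succ k)) hk⟩

end Conditions

end TTE

namespace TTE

theorem OComp.optionBind {α β γ : Type*} [Primcodable α] [Primcodable β] [Primcodable γ]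
    {P : (ℕ → ℕ) → Prop} {F : (ℕ → ℕ) → α → Option β} {G : (ℕ → ℕ) → α × β → Option γ}
    (hF : OComp P F) (hG : OComp P G) : OComp P fun s a => (F s a).bind fun b => G s (a, b) := by
  obtain ⟨Φ, h1, h2, h3⟩ := hF
  obtain ⟨Ψ, g1, g2, g3⟩ := hG
  refine ⟨fun L a => (Φ L a).bind fun o => o.elim (some none) fun b => Ψ L (a, b), ?_, ?_, ?_⟩
  · refine computable_optionBind h1 (computable_optionElim (by fun_prop) (by fun_prop) ?_)
    exact g1.comp (g := fun q : ((List ℕ × α) × Option β) × β => (q.1.1.1, (q.1.1.2, q.2)))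
      (by fun_prop)
  · intro L L' a b hL h
    obtain ⟨o, ho, hb⟩ := Option.bind_eq_some_iff.1 h
    refine Option.bind_eq_some_iff.2 ⟨o, h2 _ _ _ _ hL ho, ?_⟩
    cases o with
    | none => exact hb
    | some c => exact g2 _ _ _ _ hL hb
  · intro s hs a
    obtain ⟨k, hk⟩ := h3 s hs a
    cases ho : F s a with
    | none => exact ⟨k, by simp [hk, ho]⟩
    | some c =>
      obtain ⟨k', hk'⟩ := g3 s hs (a, c)
      refine ⟨max k k', ?_⟩
      beta_reduce
      rw [h2 _ _ _ _ (pfx_prefix s (le_max_left k k')) hk, ho]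
      simpa using g2 _ _ _ _ (pfx_prefix s (le_max_right k k')) hk'

/-! Unions of sets given by names -/

section SigmaNames

variable {D : ℕ} {X : Set (EuclideanSpace ℝ (Fin D))}

theorem IsSigmaSeq.isBorelSigma {d : ℕ} {s : ℕ → ℕ} {T : Set X} (h : IsSigmaSeq X d s T) :
    IsBorelSigma d T := by
  induction d using Nat.strong_induction_on generalizing s T with
  | _ d ih =>
    match d, h with
    | 1, h =>
      have : T = Subtype.val ⁻¹' (⋃ m, ratBall (vecPt D) (s m)) := by
        rw [← h, Set.preimage_image_eq _ Subtype.val_injective]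
      change IsOpen T
      rw [this]
      exact (isOpen_iUnion fun m => Metric.isOpen_ball).preimage continuous_subtype_val
    | d + 2, ⟨U, hU, hT⟩ => exact ⟨U, fun m => ih (d + 1) (by omega) (hU m), hT⟩

/-- Where to find the `i`-th entry of a name of a union in the names of the members. -/
def unionIdx : ℕ → ℕ → ℕ × ℕ
  | 0, i => i.unpair
  | _ + 1, i => (i.unpair.1.unpair.1, Nat.pair i.unpair.1.unpair.2 i.unpair.2)

theorem computable_unionIdx (d : ℕ) : Computable (unionIdx d) := by
  cases d with
  | zero => exact Computable.unpair
  | succ d =>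
    change Computable fun i : ℕ => (i.unpair.1.unpair.1, Nat.pair i.unpair.1.unpair.2 i.unpair.2)
    fun_prop

/-- The outermost operation of a name is already a countable union, which absorbs another one by
pairing the indices. -/
theorem IsSigmaSeq.iUnion {d : ℕ} {s : ℕ → ℕ → ℕ} {T : ℕ → Set X}
    (h : ∀ j, IsSigmaSeq X (d + 1) (s j) (T j)) :
    IsSigmaSeq X (d + 1) (fun i => s (unionIdx d i).1 (unionIdx d i).2) (⋃ j, T j) := by
  cases d with
  | zero =>
    change _ '' _ = _
    rw [Set.image_iUnion]
    ext x
    simp only [Set.mem_iUnion, unionIdx]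
    constructor
    · rintro ⟨j, hj⟩
      have h' := h j
      change _ '' _ = _ at h'
      rw [h', Set.mem_iUnion] at hj
      obtain ⟨m, hm⟩ := hj
      exact ⟨Nat.pair j m, by simpa using hm⟩
    · rintro ⟨i, hi⟩
      refine ⟨i.unpair.1, ?_⟩
      have h' := h i.unpair.1
      change _ '' _ = _ at h'
      rw [h', Set.mem_iUnion]
      exact ⟨_, hi⟩
  | succ d =>
    choose U hU hT using h
    refine ⟨fun i => U i.unpair.1 i.unpair.2, fun i => ?_, ?_⟩
    · simpa [unionIdx] using hU i.unpair.1 i.unpair.2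
    · ext x
      simp only [Set.mem_iUnion]
      constructor
      · rintro ⟨j, hj⟩
        rw [hT, Set.mem_iUnion] at hj
        obtain ⟨m, hm⟩ := hj
        exact ⟨Nat.pair j m, by simpa using hm⟩
      · rintro ⟨i, hi⟩
        refine ⟨i.unpair.1, ?_⟩
        rw [hT, Set.mem_iUnion]
        exact ⟨_, hi⟩

end SigmaNames

/-! Names of forced sets -/

section ForcedSets

variable {E : Type*} [PseudoMetricSpace E] {pt : ℕ → E} (S : PointCode pt) (xs : ℕ → ℕ)
  {A : Type*}

/-- A ball formally included in a ball `xs t` and formally disjoint from `b`. -/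
def outsideBall (b : Option ℕ) (b' t : ℕ) : ℕ :=
  bif S.inc b' (xs t) && (b.elim false fun b₀ => S.disj b' b₀) then b' else negBall

/-- An index has one of two shapes. With first component 0 it is `⟨0, ⟨ball, root⟩⟩` and serves the
complement of a closed ball; otherwise it is `⟨_, ⟨ball, ⟨condition, step⟩⟩⟩` and serves the forcing
part. -/
def idxBall (i : ℕ) : ℕ := i.unpair.2.unpair.1
def idxRoot (i : ℕ) : ℕ := i.unpair.2.unpair.2
def idxCond (i : ℕ) : List ℕ := Denumerable.ofNat (List ℕ) i.unpair.2.unpair.2.unpair.1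
def idxStep (i : ℕ) : ℕ := i.unpair.2.unpair.2.unpair.2

/-- States describing sets: `(o, b)` stands for the union of the complement of the closed ball `b`
and of the set of points with a condition extending `w` that forces `a`, where `o = (a, w)`. -/
abbrev SetState (A : Type*) := Option (A × List ℕ) × Option ℕ

/-- The complement of the set of the new state is a piece of the set of `st`. A forcing piece is a
closed ball, inside the last ball of a condition `v`, minus the points at which some extension of
`v` forces the next state. Carrying that ball in the state lets the intersection with it survive
complementation. The default state `(none, some negBall)` describes the whole space, so its
complement contributes nothing. -/
def setNext (st : SetState A) (i : ℕ) (u : Option A) : SetState A :=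
  bif decide (i.unpair.1 = 0) then (none, some (outsideBall S xs st.2 (idxBall i) (idxRoot i)))
  else (st.1.bind fun aw => u.bind fun a' => (lastBall S xs (idxCond i)).bind fun p =>
    bif decide (aw.2 = (idxCond i).take aw.2.length) && S.inc (idxBall i) p.1 then
      some ((some (a', idxCond i), some (idxBall i)) : SetState A) else none).getD
        (none, some negBall)

/-- At the lowest level forcing means finding a base witness, so the last ball of each successful
condition is listed. The default `negBall` is empty. -/
def setOut (st : SetState A) (i : ℕ) (u : Option Bool) : ℕ :=
  bif decide (i.unpair.1 = 0) then outsideBall S xs st.2 (idxBall i) (idxRoot i)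
  else (st.1.bind fun aw => (lastBall S xs (idxCond i)).bind fun p =>
    bif decide (aw.2 = (idxCond i).take aw.2.length) && u.getD false then
      some p.1 else none).getD negBall

def setName (upd : A → ℕ → Option A) (base : A → ℕ → List ℕ → Bool) : ℕ → SetState A → ℕ → ℕ
  | 0, st, i => setOut S xs st i
      (st.1.bind fun aw => some (base aw.1 (idxStep i) (centres (idxCond i))))
  | d + 1, st, i => setName upd base d
      (setNext S xs st i.unpair.1 (st.1.bind fun aw => upd aw.1 (idxStep i.unpair.1))) i.unpair.2

def forcedSet (upd : A → ℕ → Option A) (base : A → ℕ → List ℕ → Bool) (d : ℕ)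
    (st : SetState A) : Set E :=
  {x | (∃ b₀, st.2 = some b₀ ∧ x ∉ ratClosedBall pt b₀) ∨ ∃ a w, st.1 = some (a, w) ∧
    ∃ v, IsCond S xs x v ∧ w <+: v ∧
      Forces upd (IsCond S xs x) (fun a n v => base a n (centres v) = true) d a v}

variable {S xs} {upd : A → ℕ → Option A} {base : A → ℕ → List ℕ → Bool}

theorem mem_outsideBall {b : Option ℕ} {b' t : ℕ} {x : E}
    (h : x ∈ ratClosedBall pt (outsideBall S xs b b' t)) :
    (∃ t, x ∈ ratBall pt (xs t)) ∧ ∃ b₀, b = some b₀ ∧ x ∉ ratClosedBall pt b₀ := by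
  unfold outsideBall at h
  cases hc : (S.inc b' (xs t) && (b.elim false fun b₀ => S.disj b' b₀)) with
  | false =>
    rw [hc, cond_false] at h
    exact absurd h (PointCode.notMem_ratClosedBall_negBall x)
  | true =>
    rw [hc, cond_true] at h
    rw [Bool.and_eq_true] at hc
    refine ⟨⟨t, PointCode.mem_ratBall_of_inc hc.1 h⟩, ?_⟩
    cases b with
    | none => simp at hc
    | some b₀ =>
      have hd : S.disj b' b₀ = true := by simpa using hc.2
      have := PointCode.notMem_of_disj (S := S) (b := b') (b' := b₀) hd (x := x) h
      exact ⟨b₀, rfl, this⟩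

theorem exists_mem_outsideBall {b₀ : ℕ} {x : E} (hx : ∃ t, x ∈ ratBall pt (xs t))
    (h : x ∉ ratClosedBall pt b₀) :
    ∃ b' t, x ∈ ratBall pt (outsideBall S xs (some b₀) b' t) := by
  obtain ⟨t, ht⟩ := hx
  obtain ⟨b', h1, h2, h3⟩ := S.exists_inc_disj ht h
  exact ⟨b', t, by simpa [outsideBall, h1, h3] using h2⟩

theorem IsCond.root {x : E} {v : List ℕ} (h : IsCond S xs x v) : ∃ t, x ∈ ratBall pt (xs t) := by
  cases v with
  | nil => obtain ⟨p, hp, -⟩ := h; simp [lastBall] at hp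
  | cons t l =>
    have : IsCond S xs x [t] := h.of_prefix ⟨l, rfl⟩ (by simp)
    obtain ⟨p, hp, hx⟩ := this
    simp only [lastBall, List.head?_cons, List.drop_succ_cons, List.drop_zero, List.foldl_nil,
      Option.bind_some, Option.some.injEq] at hp
    exact ⟨t, by rw [← hp] at hx; exact hx⟩

theorem mem_setOut_iff {st : SetState A} {x : E} :
    (∃ i, x ∈ ratBall pt (setName S xs upd base 0 st i)) ↔
      (∃ t, x ∈ ratBall pt (xs t)) ∧ x ∈ forcedSet S xs upd base 0 st := by
  constructor
  · rintro ⟨i, hi⟩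
    simp only [setName, setOut] at hi
    by_cases hm : i.unpair.1 = 0
    · simp only [hm, decide_true, cond_true] at hi
      obtain ⟨h1, h2⟩ := mem_outsideBall (PointCode.mem_ratClosedBall_of_mem hi)
      exact ⟨h1, Or.inl h2⟩
    · simp only [hm, decide_false, cond_false] at hi
      obtain ⟨o, b⟩ := st
      cases o with
      | none => exact absurd hi (by simpa using PointCode.notMem_ratBall_negBall x)
      | some aw =>
        cases hl : lastBall S xs (idxCond i) with
        | none => exact absurd hi (by simpa [hl] using PointCode.notMem_ratBall_negBall x)
        | some p =>
          simp only [hl, Option.bind_some, Option.getD_some] at hi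
          cases hc : (decide (aw.2 = (idxCond i).take aw.2.length) &&
              base aw.1 (idxStep i) (centres (idxCond i))) with
          | false =>
            exact absurd hi (by simpa [hc] using PointCode.notMem_ratBall_negBall x)
          | true =>
            rw [hc] at hi
            simp only [cond_true, Option.getD_some] at hi
            rw [Bool.and_eq_true, decide_eq_true_eq] at hc
            have hcond : IsCond S xs x (idxCond i) := ⟨p, hl, hi⟩
            exact ⟨hcond.root, Or.inr ⟨aw.1, aw.2, rfl, idxCond i, hcond,
              List.prefix_iff_eq_take.2 hc.1, idxStep i, hc.2⟩⟩
  · rintro ⟨hx, ⟨b₀, hb, hx'⟩ | ⟨a, w, ho, v, hv, hw, n, hn⟩⟩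
    · obtain ⟨b', t, h⟩ := exists_mem_outsideBall (S := S) hx hx'
      exact ⟨Nat.pair 0 (Nat.pair b' t), by simpa [setName, setOut, idxBall, idxRoot, hb] using h⟩
    · obtain ⟨p, hp, hxp⟩ := hv
      refine ⟨Nat.pair 1 (Nat.pair 0 (Nat.pair (Encodable.encode v) n)), ?_⟩
      rw [List.prefix_iff_eq_take] at hw
      simpa [setName, setOut, idxCond, idxStep, ho, hp, hn, Denumerable.ofNat_encode, ← hw]
        using hxp

/-- One level of forcing is one union of complements. Only points covered by the balls `xs t` are
considered, because all complements are later taken inside `X`. -/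
theorem mem_forcedSet_succ_iff {d : ℕ} {st : SetState A} {x : E}
    (hx : ∃ t, x ∈ ratBall pt (xs t)) :
    x ∈ forcedSet S xs upd base (d + 1) st ↔ ∃ i, x ∉ forcedSet S xs upd base d
      (setNext S xs st i (st.1.bind fun aw => upd aw.1 (idxStep i))) := by
  have hneg : x ∈ forcedSet S xs upd base d (none, some negBall) :=
    Or.inl ⟨_, rfl, PointCode.notMem_ratClosedBall_negBall x⟩
  constructor
  · rintro (⟨b₀, hb, hx'⟩ | ⟨a, w, ho, v, hv, hw, n, a', ha, hn⟩)
    · obtain ⟨b', t, h⟩ := exists_mem_outsideBall (S := S) hx hx'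
      refine ⟨Nat.pair 0 (Nat.pair b' t), ?_⟩
      rintro (⟨b₁, hb₁, hx₁⟩ | ⟨a, w, ho, -⟩)
      · simp only [setNext, Nat.unpair_pair, decide_true, cond_true, idxBall, idxRoot, hb,
          Option.some.injEq] at hb₁
        rw [← hb₁] at hx₁
        exact hx₁ (PointCode.mem_ratClosedBall_of_mem h)
      · simp [setNext] at ho
    · obtain ⟨p, hp, hxp⟩ := id hv
      -- The ball `b'` confines the piece to points for which `v` is a condition; the bound 1 on its
      -- radius plays no role.
      obtain ⟨b', h1, h2, -⟩ := S.exists_inc hxp one_pos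
      refine ⟨Nat.pair 1 (Nat.pair b' (Nat.pair (Encodable.encode v) n)), ?_⟩
      have hw' := List.prefix_iff_eq_take.1 hw
      have : setNext S xs st (Nat.pair 1 (Nat.pair b' (Nat.pair (Encodable.encode v) n)))
          (st.1.bind fun aw => upd aw.1
            (idxStep (Nat.pair 1 (Nat.pair b' (Nat.pair (Encodable.encode v) n))))) =
          (some (a', v), some b') := by
        simp [setNext, idxCond, idxStep, idxBall, ho, hp, h1, ha, Denumerable.ofNat_encode, ← hw']
      rw [this]
      rintro (⟨b₁, hb₁, hx₁⟩ | ⟨a₁, w₁, ho₁, v₁, hv₁, hw₁, hf₁⟩)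
      · simp only [Option.some.injEq] at hb₁
        rw [← hb₁] at hx₁
        exact hx₁ (PointCode.mem_ratClosedBall_of_mem h2)
      · simp only [Option.some.injEq, Prod.mk.injEq] at ho₁
        obtain ⟨rfl, rfl⟩ := ho₁
        exact hn v₁ hw₁ hv₁ hf₁
  · rintro ⟨i, hi⟩
    by_cases hm : i.unpair.1 = 0
    · simp only [setNext, hm, decide_true, cond_true] at hi
      have : x ∈ ratClosedBall pt (outsideBall S xs st.2 (idxBall i) (idxRoot i)) := by
        by_contra hcon
        exact hi (Or.inl ⟨_, rfl, hcon⟩)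
      exact Or.inl (mem_outsideBall this).2
    · simp only [setNext, hm, decide_false, cond_false] at hi
      obtain ⟨o, b⟩ := st
      cases o with
      | none => exact absurd hneg (by simpa using hi)
      | some aw =>
        simp only [Option.bind_some] at hi
        cases hu : upd aw.1 (idxStep i) with
        | none => exact absurd hneg (by simpa [hu] using hi)
        | some a' =>
          cases hl : lastBall S xs (idxCond i) with
          | none => exact absurd hneg (by simpa [hl, hu] using hi)
          | some p =>
            simp only [hu, hl, Option.bind_some] at hi
            cases hc : (decide (aw.2 = (idxCond i).take aw.2.length) &&
                S.inc (idxBall i) p.1) with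
            | false => exact absurd hneg (by simpa [hc] using hi)
            | true =>
              rw [hc] at hi
              simp only [cond_true, Option.getD_some] at hi
              rw [Bool.and_eq_true, decide_eq_true_eq] at hc
              have hxb : x ∈ ratClosedBall pt (idxBall i) := by
                by_contra hcon
                exact hi (Or.inl ⟨_, rfl, hcon⟩)
              refine Or.inr ⟨aw.1, aw.2, rfl, idxCond i,
                ⟨p, hl, PointCode.mem_ratBall_of_inc hc.2 hxb⟩,
                List.prefix_iff_eq_take.2 hc.1, idxStep i, a', hu, fun v' hv' hc' hf' => ?_⟩
              exact hi (Or.inr ⟨a', idxCond i, rfl, v', hc', hv', hf'⟩)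

section Computability

variable [Primcodable A] {β : Type*} [Primcodable β]

@[fun_prop] theorem computable_idxBall {f : β → ℕ} (hf : Computable f) :
    Computable fun a => idxBall (f a) := by unfold idxBall; fun_prop
@[fun_prop] theorem computable_idxRoot {f : β → ℕ} (hf : Computable f) :
    Computable fun a => idxRoot (f a) := by unfold idxRoot; fun_prop
@[fun_prop] theorem computable_idxCond {f : β → ℕ} (hf : Computable f) :
    Computable fun a => idxCond (f a) := by unfold idxCond; fun_prop
@[fun_prop] theorem computable_idxStep {f : β → ℕ} (hf : Computable f) :
    Computable fun a => idxStep (f a) := by unfold idxStep; fun_prop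
@[fun_prop] theorem computable_centres {f : β → List ℕ} (hf : Computable f) :
    Computable fun a => centres (f a) := by unfold centres; fun_prop

@[fun_prop] theorem computable_lastBall (hxs : Computable xs) {f : β → List ℕ}
    (hf : Computable f) : Computable fun a => lastBall S xs (f a) := by
  have e : Computable fun q : (β × ℕ) × Option (ℕ × ℕ) × ℕ => condStep S q.2.1 q.2.2 := by
    unfold condStep
    fun_prop
  have e' : Computable fun q : ((β × ℕ) × Option (ℕ × ℕ)) × ℕ => condStep S q.1.2 q.2 :=
    e.comp (g := fun q : ((β × ℕ) × Option (ℕ × ℕ)) × ℕ => (q.1.1, q.1.2, q.2)) (by fun_prop)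
  have h0 : Computable fun a => (f a).head? :=
    Computable.of_eq (f := fun a => (f a)[0]?) (by fun_prop) fun a => by cases f a <;> rfl
  unfold lastBall
  exact computable_optionBind h0 (computable_foldl (by fun_prop) (by fun_prop) e')

theorem computable_outsideBall (hxs : Computable xs) {f : β → Option ℕ} {g h : β → ℕ}
    (hf : Computable f) (hg : Computable g) (hh : Computable h) :
    Computable fun a => outsideBall S xs (f a) (g a) (h a) := by
  unfold outsideBall
  fun_prop

theorem computable_setNext (hxs : Computable xs) :
    Computable fun p : (SetState A × ℕ) × Option A => setNext S xs p.1.1 p.1.2 p.2 := by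
  unfold setNext
  refine computable_cond (by fun_prop) ?_ ?_
  · have := computable_outsideBall (S := S) hxs (f := fun p : (SetState A × ℕ) × Option A => p.1.1.2)
      (g := fun p => idxBall p.1.2) (h := fun p => idxRoot p.1.2) (by fun_prop) (by fun_prop)
      (by fun_prop)
    fun_prop
  · refine computable_optionGetD (computable_optionBind (by fun_prop)
      (computable_optionBind (by fun_prop)
        (computable_optionBind (computable_lastBall hxs (by fun_prop)) ?_))) (by fun_prop)
    fun_prop

theorem computable_setOut (hxs : Computable xs) :
    Computable fun p : (SetState A × ℕ) × Option Bool => setOut S xs p.1.1 p.1.2 p.2 := by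
  unfold setOut
  refine computable_cond (by fun_prop) ?_ ?_
  · exact computable_outsideBall hxs (by fun_prop) (by fun_prop) (by fun_prop)
  · refine computable_optionGetD (computable_optionBind (by fun_prop)
        (computable_optionBind (computable_lastBall hxs (by fun_prop)) ?_)) (by fun_prop)
    fun_prop

theorem ocomp_setName (hxs : Computable xs) {P : (ℕ → ℕ) → Prop}
    {upd : (ℕ → ℕ) → A → ℕ → Option A} {base : (ℕ → ℕ) → A → ℕ → List ℕ → Bool}
    (hupd : OComp P fun V (p : A × ℕ) => upd V p.1 p.2)
    (hbase : OComp P fun V (p : A × ℕ × List ℕ) => base V p.1 p.2.1 p.2.2) (d : ℕ) :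
    OComp P fun V (p : SetState A × ℕ) => setName S xs (upd V) (base V) d p.1 p.2 := by
  induction d with
  | zero =>
    have e1 : OComp P fun V (p : SetState A × ℕ) => p.1.1.bind fun aw =>
        some (base V aw.1 (idxStep p.2) (centres (idxCond p.2))) :=
      OComp.optionBind (F := fun _ (p : SetState A × ℕ) => p.1.1)
        (G := fun V (q : (SetState A × ℕ) × A × List ℕ) =>
          some (base V q.2.1 (idxStep q.1.2) (centres (idxCond q.1.2))))
        (OComp.of_computable (by fun_prop))
        (OComp.computable_comp Computable.option_some (hbase.comp_computable
          (g := fun q : (SetState A × ℕ) × A × List ℕ =>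
            (q.2.1, idxStep q.1.2, centres (idxCond q.1.2))) (by fun_prop)))
    exact OComp.computable_comp (computable_setOut hxs)
      ((OComp.of_computable (g := fun p : SetState A × ℕ => p) (by fun_prop)).pair e1)
  | succ d ih =>
    have hg : Computable fun q : (SetState A × ℕ) × A × List ℕ =>
        (q.2.1, idxStep q.1.2.unpair.1) := by fun_prop
    have e4 := hupd.comp_computable hg
    have e1 := OComp.optionBind (OComp.of_computable (g := fun p : SetState A × ℕ => p.1.1)
      (by fun_prop)) e4
    dsimp only at e1
    have e0 : OComp P fun _ (p : SetState A × ℕ) => (p.1, p.2.unpair.1) :=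
      OComp.of_computable (by fun_prop)
    have e2 : OComp P fun V (p : SetState A × ℕ) => setNext S xs p.1 p.2.unpair.1
        (p.1.1.bind fun aw => upd V aw.1 (idxStep p.2.unpair.1)) :=
      OComp.computable_comp (g := fun q : (SetState A × ℕ) × Option A => setNext S xs q.1.1 q.1.2 q.2)
        (computable_setNext hxs) (e0.pair e1)
    have e3 : OComp P fun _ (p : SetState A × ℕ) => p.2.unpair.2 :=
      OComp.of_computable (by fun_prop)
    exact ih.comp (e2.pair e3)

end Computability

end ForcedSets

theorem isSigmaSeq_setName {D : ℕ} {X : Set (EuclideanSpace ℝ (Fin D))} {xs : ℕ → ℕ}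
    (hX : X = ⋃ t, ratBall (vecPt D) (xs t)) {A : Type*} {upd : A → ℕ → Option A}
    {base : A → ℕ → List ℕ → Bool} (d : ℕ) (st : SetState A) :
    IsSigmaSeq X (d + 1) (setName (vecCode D) xs upd base d st)
      {x : X | (x : EuclideanSpace ℝ (Fin D)) ∈ forcedSet (vecCode D) xs upd base d st} := by
  have hX' : ∀ x, x ∈ X ↔ ∃ t, x ∈ ratBall (vecPt D) (xs t) := fun x => by
    rw [hX, Set.mem_iUnion]
  induction d generalizing st with
  | zero =>
    change _ '' _ = _
    ext x
    rw [Set.mem_iUnion, mem_setOut_iff, ← hX']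
    simp [and_comm]
  | succ d ih =>
    refine ⟨fun i => {x : X | (x : EuclideanSpace ℝ (Fin D)) ∈ forcedSet (vecCode D) xs upd base d
      (setNext (vecCode D) xs st i (st.1.bind fun aw => upd aw.1 (idxStep i)))}, fun i => ?_, ?_⟩
    · have := ih (setNext (vecCode D) xs st i (st.1.bind fun aw => upd aw.1 (idxStep i)))
      simpa [setName] using this
    · ext x
      have := mem_forcedSet_succ_iff (S := vecCode D) (upd := upd) (base := base) (d := d)
        (st := st) ((hX' x).1 x.2)
      simpa using this

/-- Sets of points that are described by alternating quantifiers over the names of the points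
have computable names. -/
theorem isComputableFun_deltaSigma {D : ℕ} {X : Set (EuclideanSpace ℝ (Fin D))}
    (hX : IsRecursivelyOpen X) {A : Type*} [Primcodable A] {B : Type*} {R : (ℕ → ℕ) → B → Prop}
    {f : B → Set X} {upd : (ℕ → ℕ) → A → ℕ → Option A}
    {base : (ℕ → ℕ) → A → ℕ → List ℕ → Bool} {a₀ : (ℕ → ℕ) → ℕ → A}
    (hupd : OComp (fun V => ∃ b, R V b) fun V (p : A × ℕ) => upd V p.1 p.2)
    (hbase : OComp (fun V => ∃ b, R V b) fun V (p : A × ℕ × List ℕ) => base V p.1 p.2.1 p.2.2)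
    (ha₀ : OComp (fun V => ∃ b, R V b) a₀)
    (hb : ∀ V a n v v', v <+: v' → base V a n v = true → base V a n v' = true) (d : ℕ)
    (h : ∀ V b, R V b → ∀ (x : X) (s : ℕ → ℕ),
      (∀ m, dist (x : EuclideanSpace ℝ (Fin D)) (vecPt D (s m)) ≤ (1 / 2 : ℝ) ^ m) →
      ((∃ j, Sat (upd V) (fun a n => ∃ k, base V a n (pfx s k) = true) d (a₀ V j)) ↔ x ∈ f b)) :
    IsComputableFun (ofSeq R) (deltaSigma X (d + 1)) f := by
  obtain ⟨σ, hσ, xs, rfl, hXxs⟩ := hX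
  -- Each entry is found by searching the graph for its unique value.
  have hxs : Computable xs := by
    refine computable_of_search (Φ := fun i v => bif seqCode xs (Nat.pair i v) then some v else none)
      ?_ (fun i => ⟨xs i, by simp [seqCode]⟩) ?_
    · have := hσ.comp (g := fun q : ℕ × ℕ => Nat.pair q.1 q.2) (by fun_prop)
      exact computable_cond this (by fun_prop) (by fun_prop)
    · intro i k b hk
      by_cases he : xs i = k <;> simp [seqCode, he] at hk
      rw [← hk, he]
  -- The initial states ask for a condition extending the empty list, that is, for any condition,
  -- and have no ball to avoid. The union over `j` is absorbed by `unionIdx`.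
  refine isComputableFun_ofSeq_iff.2 ⟨fun V i => setName (vecCode D) xs (upd V) (base V) d
    (some (a₀ V (unionIdx d i).1, []), none) (unionIdx d i).2, ?_, ?_⟩
  · have e1 := ha₀.comp_computable (g := fun i => (unionIdx d i).1)
      (Computable.fst.comp (computable_unionIdx d))
    have e2 := OComp.computable_comp (g := fun a : A => ((some (a, []), none) : SetState A))
      (by fun_prop) e1
    exact (ocomp_setName hxs hupd hbase d).comp
      (e2.pair (OComp.of_computable (Computable.snd.comp (computable_unionIdx d))))
  · intro V b hV
    have := IsSigmaSeq.iUnion fun j => isSigmaSeq_setName hXxs (upd := upd V) (base := base V) d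
      (some (a₀ V j, []), none)
    have hS : f b = ⋃ j, {x : X | (x : EuclideanSpace ℝ (Fin D)) ∈
        forcedSet (vecCode D) xs (upd V) (base V) d (some (a₀ V j, []), none)} := by
      ext x
      have hx : ∃ t, (x : EuclideanSpace ℝ (Fin D)) ∈ ratBall (vecPt D) (xs t) := by
        exact Set.mem_iUnion.1 (hXxs.subset x.2)
      rw [← exists_forces_iff (S := vecCode D) (xs := xs)
        (base := fun a n v => base V a n v = true) (hb V) hx (h V b hV x)]
      simp [forcedSet]
    rw [hS]
    exact this

end TTE

namespace TTE

attribute [local irreducible] Nat.unpair Nat.pair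

/-! Iterated limits and iterated extrema as alternating quantifiers -/

/-- The index `⟨n₀, ⟨n₁, … ⟨n_k, n⟩⟩⟩`, for a list `[n_k, …, n₀]`. -/
def pathIdx (path : List ℕ) (n : ℕ) : ℕ := path.foldl (fun acc m => Nat.pair m acc) n

@[fun_prop] theorem computable_pathIdx {α : Type*} [Primcodable α] {f : α → List ℕ} {g : α → ℕ}
    (hf : Computable f) (hg : Computable g) : Computable fun a => pathIdx (f a) (g a) := by
  unfold pathIdx
  fun_prop

-- Membership of iterated limits in rational balls.

section Limits

/-- `(false, path, b, N)` stands for: some entry, from the `N`-th on, of the sequence at `path`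
lies outside the closed ball `b`; `(true, path, b, N)` for: the limit lies in the ball `b`. -/
abbrev LimState := Bool × List ℕ × ℕ × ℕ

/-- The step `i` codes `⟨n, ⟨b', M⟩⟩`: a row `n` (for negative states), a ball `b'` and a bound `M`
such that no entry from `M` on leaves the closed ball `b'`. A limit lies in an open set iff the
entries eventually stay in some closed ball formally inside it; the same holds for the complement of
a closed ball, with formal disjointness. So each limit costs a single alternation. -/
noncomputable def limNext (a : LimState) (i : ℕ) : Option LimState :=
  bif (bif a.1 then realCode.inc i.unpair.2.unpair.1 a.2.2.1
    else decide (a.2.2.2 ≤ i.unpair.1) && realCode.disj i.unpair.2.unpair.1 a.2.2.1) then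
    some (false, bif a.1 then a.2.1 else i.unpair.1 :: a.2.1,
      i.unpair.2.unpair.1, i.unpair.2.unpair.2)
  else none

theorem computable_limNext : Computable fun p : LimState × ℕ => limNext p.1 p.2 := by
  unfold limNext
  fun_prop

theorem limNext_false_eq_some {path : List ℕ} {β N i : ℕ} {a' : LimState} :
    limNext (false, path, β, N) i = some a' ↔ N ≤ i.unpair.1 ∧
      realCode.disj i.unpair.2.unpair.1 β = true ∧
      a' = (false, i.unpair.1 :: path, i.unpair.2.unpair.1, i.unpair.2.unpair.2) := by
  simp only [limNext, cond_false]
  cases realCode.disj i.unpair.2.unpair.1 β <;> by_cases h : N ≤ i.unpair.1 <;> simp [h, eq_comm]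

theorem limNext_true_eq_some {path : List ℕ} {β N i : ℕ} {a' : LimState} :
    limNext (true, path, β, N) i = some a' ↔
      realCode.inc i.unpair.2.unpair.1 β = true ∧
      a' = (false, path, i.unpair.2.unpair.1, i.unpair.2.unpair.2) := by
  simp only [limNext, cond_true]
  cases realCode.inc i.unpair.2.unpair.1 β <;> simp [eq_comm]

/-- `z` is the sequence whose limit is the iterated limit of `q`. -/
def IsOuterSeq : ℕ → (ℕ → ℝ) → (ℕ → ℝ) → Prop
  | 0, q, z => z = q
  | d + 1, q, z => ∀ n, IsIterLim d (fun k => q (Nat.pair n k)) (z n)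

theorem isIterLim_iff {d : ℕ} {q : ℕ → ℝ} {y : ℝ} :
    IsIterLim d q y ↔ ∃ z, IsOuterSeq d q z ∧ Tendsto z atTop (𝓝 y) := by
  cases d with
  | zero => simp [IsIterLim, IsOuterSeq]
  | succ d => rfl

theorem isClosed_ratClosedBall (b : ℕ) : IsClosed (ratClosedBall realPt b) :=
  Metric.isClosed_closedBall

theorem isOpen_ratBall {E : Type*} [PseudoMetricSpace E] (pt : ℕ → E) (b : ℕ) :
    IsOpen (ratBall pt b) := Metric.isOpen_ball

variable {p : ℕ → ℕ} {base : LimState → ℕ → Prop}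

/-- If the entries of a row stay in a closed ball, so does their limit. Conversely a limit outside
the closed ball `β` has an open ball around it, formally disjoint from `β`, which eventually
contains the entries. -/
theorem sat_limNext_false (hbase : ∀ path β N, (∃ n, base (false, path, β, N) n) ↔
      ∃ n, N ≤ n ∧ realPt (p (pathIdx path n)) ∉ ratClosedBall realPt β)
    {d : ℕ} {path : List ℕ} {z : ℕ → ℝ}
    (hz : IsOuterSeq d (fun k => realPt (p (pathIdx path k))) z) (β N : ℕ) :
    Sat limNext base d (false, path, β, N) ↔ ∃ n, N ≤ n ∧ z n ∉ ratClosedBall realPt β := by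
  induction d generalizing path z β N with
  | zero =>
    obtain rfl : z = _ := hz
    exact hbase path β N
  | succ d ih =>
    have hz' : ∀ n, IsIterLim d (fun k => realPt (p (pathIdx (n :: path) k))) (z n) := hz
    constructor
    · rintro ⟨i, a', ha, hs⟩
      obtain ⟨hN, hd, rfl⟩ := limNext_false_eq_some.1 ha
      obtain ⟨w, hw, hlim⟩ := isIterLim_iff.1 (hz' i.unpair.1)
      rw [ih hw] at hs
      push Not at hs
      refine ⟨i.unpair.1, hN, PointCode.notMem_of_disj hd ?_⟩
      exact (isClosed_ratClosedBall _).mem_of_tendsto hlim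
        (eventually_atTop.2 ⟨i.unpair.2.unpair.2, hs⟩)
    · rintro ⟨n, hN, hn⟩
      obtain ⟨b', h1, h2⟩ := realCode.exists_disj hn
      obtain ⟨w, hw, hlim⟩ := isIterLim_iff.1 (hz' n)
      obtain ⟨M, hM⟩ := eventually_atTop.1 (hlim.eventually_mem ((isOpen_ratBall _ _).mem_nhds h1))
      refine ⟨Nat.pair n (Nat.pair b' M), _,
        limNext_false_eq_some.2 ⟨by simpa using hN, by simpa using h2, rfl⟩, ?_⟩
      simp only [Nat.unpair_pair]
      rw [ih hw]
      push Not
      exact fun m hm => PointCode.mem_ratClosedBall_of_mem (hM m hm)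

theorem sat_limNext_true (hbase : ∀ path β N, (∃ n, base (false, path, β, N) n) ↔
      ∃ n, N ≤ n ∧ realPt (p (pathIdx path n)) ∉ ratClosedBall realPt β)
    {d : ℕ} {path : List ℕ} {y : ℝ}
    (hy : IsIterLim d (fun k => realPt (p (pathIdx path k))) y) (b N : ℕ) :
    Sat limNext base (d + 1) (true, path, b, N) ↔ y ∈ ratBall realPt b := by
  obtain ⟨w, hw, hlim⟩ := isIterLim_iff.1 hy
  constructor
  · rintro ⟨i, a', ha, hs⟩
    obtain ⟨hd, rfl⟩ := limNext_true_eq_some.1 ha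
    rw [sat_limNext_false hbase hw] at hs
    push Not at hs
    exact PointCode.mem_ratBall_of_inc hd ((isClosed_ratClosedBall _).mem_of_tendsto hlim
        (eventually_atTop.2 ⟨i.unpair.2.unpair.2, hs⟩))
  · intro hb
    obtain ⟨b', h1, h2, -⟩ := realCode.exists_inc hb one_pos
    obtain ⟨M, hM⟩ := eventually_atTop.1 (hlim.eventually_mem ((isOpen_ratBall _ _).mem_nhds h2))
    refine ⟨Nat.pair 0 (Nat.pair b' M), _,
      limNext_true_eq_some.2 ⟨by simpa using h1, rfl⟩, ?_⟩
    simp only [Nat.unpair_pair]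
    rw [sat_limNext_false hbase hw]
    push Not
    exact fun m hm => PointCode.mem_ratClosedBall_of_mem (hM m hm)

/-- The test that the rational `q` lies outside the closed ball `b`. -/
noncomputable def outTest (q b : ℕ) : Bool := realCode.disj (Nat.pair q 0) b

@[fun_prop] theorem computable_outTest {α : Type*} [Primcodable α] {f g : α → ℕ}
    (hf : Computable f) (hg : Computable g) : Computable fun a => outTest (f a) (g a) := by
  unfold outTest
  fun_prop

theorem outTest_iff {q b : ℕ} : outTest q b = true ↔ realPt q ∉ ratClosedBall realPt b := by
  rw [outTest, PointCode.disj_iff, PointCode.mem_ratClosedBall, not_le]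
  simp [realPt, ratNum]

end Limits

-- Cuts of alternating extrema.

section Cuts

/-- `(path, true, a)` stands for: `a` is less than the alternating supremum at `path`;
`(path, false, a)` for: the alternating infimum at `path` is less than `a`. -/
abbrev CutState := List ℕ × Bool × ℕ

/-- The step `i` codes `⟨n, a'⟩` with a rational `a'` strictly beyond `a`. The negated next state
only gives the weak inequality with `a'`, and the gap between `a` and `a'` restores the strict one.
-/
def cutNext (a : CutState) (i : ℕ) : Option CutState :=
  bif (bif a.2.1 then rlt a.2.2 i.unpair.2 else rlt i.unpair.2 a.2.2) then
    some (i.unpair.1 :: a.1, !a.2.1, i.unpair.2) else none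

theorem computable_cutNext : Computable fun p : CutState × ℕ => cutNext p.1 p.2 := by
  unfold cutNext
  fun_prop

theorem cutNext_true_eq_some {path : List ℕ} {a i : ℕ} {a' : CutState} :
    cutNext (path, true, a) i = some a' ↔ rlt a i.unpair.2 = true ∧
      a' = (i.unpair.1 :: path, false, i.unpair.2) := by
  simp only [cutNext, cond_true]
  cases rlt a i.unpair.2 <;> simp [eq_comm]

theorem cutNext_false_eq_some {path : List ℕ} {a i : ℕ} {a' : CutState} :
    cutNext (path, false, a) i = some a' ↔ rlt i.unpair.2 a = true ∧
      a' = (i.unpair.1 :: path, true, i.unpair.2) := by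
  simp only [cutNext, cond_false]
  cases rlt i.unpair.2 a <;> simp [eq_comm]

theorem exists_realPt_between_ereal {x y : EReal} (h : x < y) :
    ∃ n, x < (realPt n : EReal) ∧ (realPt n : EReal) < y := by
  obtain ⟨q, h1, h2⟩ := EReal.lt_iff_exists_rat_btwn.1 h
  obtain ⟨n, hn⟩ := realPt_surjOn q
  exact ⟨n, by rw [hn]; exact h1, by rw [hn]; exact h2⟩

theorem sat_cutNext {p : ℕ → ℕ} {base : CutState → ℕ → Prop}
    (hbase : ∀ path sg a, (∃ n, base (path, sg, a) n) ↔
      ∃ n, if sg = true then realPt a < realPt (p (pathIdx path n))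
        else realPt (p (pathIdx path n)) < realPt a) (d : ℕ) (path : List ℕ) (a : ℕ) :
    (Sat cutNext base d (path, true, a) ↔
      (realPt a : EReal) < iterSup d fun k => (realPt (p (pathIdx path k)) : EReal)) ∧
    (Sat cutNext base d (path, false, a) ↔
      (iterInf d fun k => (realPt (p (pathIdx path k)) : EReal)) < (realPt a : EReal)) := by
  induction d generalizing path a with
  | zero =>
    constructor
    · simp only [Sat, hbase, iterSup, lt_iSup_iff, EReal.coe_lt_coe_iff, if_true]
    · simp only [Sat, hbase, iterInf, iInf_lt_iff, EReal.coe_lt_coe_iff, Bool.false_eq_true,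
        if_false]
  | succ d ih =>
    constructor
    · simp only [iterSup, lt_iSup_iff]
      constructor
      · rintro ⟨i, a', ha, hs⟩
        obtain ⟨hlt, rfl⟩ := cutNext_true_eq_some.1 ha
        rw [(ih _ _).2, not_lt] at hs
        rw [rlt_iff_realPt] at hlt
        exact ⟨i.unpair.1, (EReal.coe_lt_coe_iff.2 hlt).trans_le hs⟩
      · rintro ⟨n, hn⟩
        obtain ⟨a', h1, h2⟩ := exists_realPt_between_ereal hn
        refine ⟨Nat.pair n a', _, cutNext_true_eq_some.2 ⟨?_, rfl⟩, ?_⟩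
        · rw [rlt_iff_realPt, Nat.unpair_pair]
          exact EReal.coe_lt_coe_iff.1 h1
        · rw [(ih _ _).2, not_lt, Nat.unpair_pair]
          exact h2.le
    · simp only [iterInf, iInf_lt_iff]
      constructor
      · rintro ⟨i, a', ha, hs⟩
        obtain ⟨hlt, rfl⟩ := cutNext_false_eq_some.1 ha
        rw [(ih _ _).1, not_lt] at hs
        rw [rlt_iff_realPt] at hlt
        exact ⟨i.unpair.1, hs.trans_lt (EReal.coe_lt_coe_iff.2 hlt)⟩
      · rintro ⟨n, hn⟩
        obtain ⟨a', h1, h2⟩ := exists_realPt_between_ereal hn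
        refine ⟨Nat.pair n a', _, cutNext_false_eq_some.2 ⟨?_, rfl⟩, ?_⟩
        · rw [rlt_iff_realPt, Nat.unpair_pair]
          exact EReal.coe_lt_coe_iff.1 h2
        · rw [(ih _ _).1, not_lt, Nat.unpair_pair]
          exact h1.le

end Cuts

/-! From computability to measurability -/

section Forward

variable {D : ℕ} {X : Set (EuclideanSpace ℝ (Fin D))}

/-- A name of a value certifies its Borel class, so the plain measurability statement follows from
the effective one as soon as each argument has a name. -/
theorem isBorelSigma_of_isComputableFun {B : Type*} {R : (ℕ → ℕ) → B → Prop} {d : ℕ}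
    {g : B → Set X} (h : IsComputableFun (ofSeq R) (deltaSigma X d) g) {b : B}
    (hb : ∃ s, R s b) : IsBorelSigma d (g b) := by
  obtain ⟨F, -, hF⟩ := isComputableFun_ofSeq_iff.1 h
  obtain ⟨s, hs⟩ := hb
  exact (hF s b hs).isBorelSigma

theorem exists_theta_name {E : Type*} [PseudoMetricSpace E] {pt : ℕ → E} (S : PointCode pt)
    {U : Set E} (hU : IsOpen U) : ∃ s : ℕ → ℕ, U = ⋃ m, ratBall pt (s m) := by
  classical
  refine ⟨fun n => if ratBall pt n ⊆ U then n else negBall, ?_⟩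
  ext x
  rw [Set.mem_iUnion]
  constructor
  · intro hx
    obtain ⟨ε, hε, hball⟩ := Metric.isOpen_iff.1 hU x hx
    obtain ⟨b, h1, h2⟩ := S.exists_small x (half_pos hε)
    have : ratBall pt b ⊆ U := by
      intro y hy
      apply hball
      rw [PointCode.mem_ratBall] at h1 hy
      have := dist_triangle_right y x (pt b.unpair.1)
      rw [Metric.mem_ball]
      linarith
    exact ⟨b, by beta_reduce; rw [if_pos this]; exact h1⟩
  · rintro ⟨n, hn⟩
    beta_reduce at hn
    split_ifs at hn with h
    · exact h hn
    · exact absurd hn (PointCode.notMem_ratBall_negBall x)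

theorem exists_rhoUpper_name (y : ℝ) :
    ∃ s : ℕ → ℕ, (y : EReal) = ⨅ n, (realPt (s n) : EReal) := by
  have : ∀ n : ℕ, ∃ k, y < realPt k ∧ realPt k < y + 1 / ((n : ℝ) + 1) := fun n =>
    exists_realPt_between (lt_add_of_pos_right y (by positivity))
  choose s h1 h2 using this
  refine ⟨s, le_antisymm (le_iInf fun n => EReal.coe_le_coe_iff.2 (h1 n).le) ?_⟩
  refine le_of_forall_gt fun c hc => ?_
  obtain ⟨r, hr1, hr2⟩ := EReal.lt_iff_exists_real_btwn.1 hc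
  obtain ⟨n, hn⟩ := exists_nat_one_div_lt (sub_pos.2 (EReal.coe_lt_coe_iff.1 hr1))
  refine (iInf_le _ n).trans_lt (lt_trans (EReal.coe_lt_coe_iff.2 ?_) hr2)
  have := h2 n
  linarith

variable {f : X → ℝ}

/-- The names of the points of `X`. -/
def IsNameOn (X : Set (EuclideanSpace ℝ (Fin D))) (s : ℕ → ℕ) (x : X) : Prop :=
  ∀ m, dist (x : EuclideanSpace ℝ (Fin D)) (vecPt D (s m)) ≤ (1 / 2 : ℝ) ^ m

theorem elim_decide_mono {Φ : List ℕ → ℕ → Option ℕ}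
    (h2 : ∀ L L' a b, L <+: L' → Φ L a = some b → Φ L' a = some b) {g : ℕ → Bool} {i : ℕ}
    {v v' : List ℕ} (hv : v <+: v') (h : (Φ v i).elim false g = true) :
    (Φ v' i).elim false g = true := by
  cases hi : Φ v i with
  | none => simp [hi] at h
  | some q =>
    rw [hi] at h
    rw [h2 _ _ _ _ hv hi]
    exact h

theorem exists_elim_iff {Φ : List ℕ → ℕ → Option ℕ}
    (h2 : ∀ L L' a b, L <+: L' → Φ L a = some b → Φ L' a = some b) {g : ℕ → Bool} {i w : ℕ}
    {s : ℕ → ℕ} (hw : ∃ k, Φ (pfx s k) i = some w) :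
    (∃ k, (Φ (pfx s k) i).elim false g = true) ↔ g w = true := by
  obtain ⟨k, hk⟩ := hw
  constructor
  · rintro ⟨k', hk'⟩
    cases hi : Φ (pfx s k') i with
    | none => simp [hi] at hk'
    | some q =>
      rw [hi] at hk'
      rw [← eq_of_prefixes h2 hi hk]
      exact hk'
  · intro h
    exact ⟨k, by rw [hk]; exact h⟩

/-- For `d = 0` the entries approximate with a known error, so membership in a ball needs just one
existential quantifier. For `d + 1` there are `d + 1` limits, hence as many alternations below the
outermost quantifier. -/
theorem isComputableFun_preimage_of_rhoJump (hX : IsRecursivelyOpen X) (d : ℕ)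
    (hf : IsComputableFun (rhoOn X) (rhoJump d) f) :
    IsComputableFun (theta realPt) (deltaSigma X (d + 1)) fun V => f ⁻¹' V := by
  cases d with
  | zero =>
    have hf' : IsComputableFun (ofSeq (IsNameOn X))
        (ofSeq fun s (y : ℝ) => ∀ m, dist y (realPt (s m)) ≤ (1 / 2 : ℝ) ^ m) f := hf
    obtain ⟨F, ⟨Φ, h1, h2, h3⟩, hF⟩ := isComputableFun_ofSeq_iff.1 hf'
    refine isComputableFun_deltaSigma hX (A := ℕ) (upd := fun _ _ _ => none)
      (base := fun _ a n L => (Φ L n).elim false fun q => realCode.near q n a)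
      (a₀ := fun V j => V j) (OComp.of_computable (g := fun _ => none) (by fun_prop))
      (OComp.of_computable (g := fun p : ℕ × ℕ × List ℕ => (Φ p.2.2 p.2.1).elim false
        fun q => realCode.near q p.2.1 p.1) ?_) (OComp.query (f := fun j => j) (by fun_prop))
      (fun _ _ _ _ _ hv h => elim_decide_mono h2 hv h) 0 ?_
    · exact computable_optionElim (h1.comp (g := fun p : ℕ × ℕ × List ℕ => (p.2.2, p.2.1))
        (by fun_prop)) (by fun_prop) (by fun_prop)
    · rintro V U rfl x s hs
      rw [Set.mem_preimage, Set.mem_iUnion]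
      refine exists_congr fun j => ?_
      rw [realCode.mem_ratBall_iff_near (hF s x hs)]
      refine exists_congr fun n => ?_
      exact exists_elim_iff h2 (g := fun q => realCode.near q n (V j)) (h3 s ⟨x, hs⟩ n)
  | succ d =>
    have hf' : IsComputableFun (ofSeq (IsNameOn X))
        (ofSeq fun s y => IsIterLim d (fun n => realPt (s n)) y) f := hf
    obtain ⟨F, ⟨Φ, h1, h2, h3⟩, hF⟩ := isComputableFun_ofSeq_iff.1 hf'
    refine isComputableFun_deltaSigma hX (A := LimState) (upd := fun _ => limNext)
      (base := fun _ a n L => decide (a.2.2.2 ≤ n) && (Φ L (pathIdx a.2.1 n)).elim false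
        fun q => outTest q a.2.2.1)
      (a₀ := fun V j => (true, [], V j, 0)) (OComp.of_computable computable_limNext)
      (OComp.of_computable (g := fun p : LimState × ℕ × List ℕ => decide (p.1.2.2.2 ≤ p.2.1) &&
        (Φ p.2.2 (pathIdx p.1.2.1 p.2.1)).elim false fun q => outTest q p.1.2.2.1) ?_)
      (OComp.computable_comp (g := fun b => ((true, [], b, 0) : LimState)) (by fun_prop)
        (OComp.query (f := fun j => j) (by fun_prop))) ?_ (d + 1) ?_
    · refine computable_and (by fun_prop) (computable_optionElim
        (h1.comp (g := fun p : LimState × ℕ × List ℕ => (p.2.2, pathIdx p.1.2.1 p.2.1))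
        (by fun_prop)) (by fun_prop) (by fun_prop))
    · intro _ a n v v' hv h
      rw [Bool.and_eq_true] at h ⊢
      exact ⟨h.1, elim_decide_mono h2 hv h.2⟩
    · rintro V U rfl x s hs
      rw [Set.mem_preimage, Set.mem_iUnion]
      refine exists_congr fun j => ?_
      refine sat_limNext_true (p := F s) (fun path β N => ?_) (hF s x hs) _ _
      refine exists_congr fun n => ?_
      simp only [Bool.and_eq_true, decide_eq_true_eq, exists_and_left]
      refine and_congr_right fun _ => ?_
      rw [exists_elim_iff h2 (g := fun q => outTest q β) (h3 s ⟨x, hs⟩ _), outTest_iff]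

theorem isComputableFun_preimage_of_rhoLowerJump (hX : IsRecursivelyOpen X) (d : ℕ)
    (hf : IsComputableFun (rhoOn X) (rhoLowerJump d) f) :
    IsComputableFun rhoUpper (deltaSigma X (d + 1)) fun y : ℝ => f ⁻¹' Set.Ioi y := by
  have hf' : IsComputableFun (ofSeq (IsNameOn X))
      (ofSeq fun s (y : ℝ) => (y : EReal) = iterSup d fun n => (realPt (s n) : EReal)) f := hf
  obtain ⟨F, ⟨Φ, h1, h2, h3⟩, hF⟩ := isComputableFun_ofSeq_iff.1 hf'
  refine isComputableFun_deltaSigma hX (A := CutState) (upd := fun _ => cutNext)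
    (base := fun _ a n L => (Φ L (pathIdx a.1 n)).elim false
      fun q => bif a.2.1 then rlt a.2.2 q else rlt q a.2.2)
    (a₀ := fun V j => ([], true, V j)) (OComp.of_computable computable_cutNext)
    (OComp.of_computable (g := fun p : CutState × ℕ × List ℕ =>
      (Φ p.2.2 (pathIdx p.1.1 p.2.1)).elim false
        fun q => bif p.1.2.1 then rlt p.1.2.2 q else rlt q p.1.2.2) ?_)
    (OComp.computable_comp (g := fun b => (([], true, b) : CutState)) (by fun_prop)
      (OComp.query (f := fun j => j) (by fun_prop)))
    (fun _ _ _ _ _ hv h => elim_decide_mono h2 hv h) d ?_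
  · exact computable_optionElim
      (h1.comp (g := fun p : CutState × ℕ × List ℕ => (p.2.2, pathIdx p.1.1 p.2.1))
      (by fun_prop)) (by fun_prop) (by fun_prop)
  · intro V y hV x s hs
    rw [Set.mem_preimage, Set.mem_Ioi, ← EReal.coe_lt_coe_iff, hV, hF s x hs, iInf_lt_iff]
    refine exists_congr fun j => ?_
    refine (sat_cutNext (p := F s) (fun path sg a => ?_) d [] (V j)).1
    refine exists_congr fun n => ?_
    rw [exists_elim_iff h2 (g := fun q => bif sg then rlt a q else rlt q a) (h3 s ⟨x, hs⟩ _)]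
    cases sg <;> simp [rlt_iff_realPt]

end Forward

end TTE

namespace TTE

attribute [local irreducible] Nat.unpair Nat.pair

/-! Membership in sets with given names -/

section AltEx

/-- `∃ n₀, ¬ ∃ n₁, ¬ ⋯ ∃ n_d, B ⟨n₀, ⟨n₁, …, n_d⟩⟩`. -/
def AltEx : ℕ → (ℕ → Prop) → Prop
  | 0, B => ∃ n, B n
  | d + 1, B => ∃ n, ¬ AltEx d fun k => B (Nat.pair n k)

theorem IsSigmaSeq.mem_iff {D : ℕ} {X : Set (EuclideanSpace ℝ (Fin D))} {d : ℕ} {s : ℕ → ℕ}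
    {T : Set X} (h : IsSigmaSeq X (d + 1) s T) (x : X) :
    x ∈ T ↔ AltEx d fun n => (x : EuclideanSpace ℝ (Fin D)) ∈ ratBall (vecPt D) (s n) := by
  induction d generalizing s T with
  | zero =>
    have h' : Subtype.val '' T = ⋃ m, ratBall (vecPt D) (s m) := h
    have := Set.ext_iff.1 h' x
    rw [Set.mem_iUnion] at this
    rw [AltEx, ← this]
    simp
  | succ d ih =>
    obtain ⟨U, hU, rfl⟩ := h
    simp only [Set.mem_iUnion, Set.mem_compl_iff, AltEx]
    exact exists_congr fun m => not_congr (ih (hU m))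

/-- Splitting the innermost index into two. -/
def splitLast : ℕ → ℕ → ℕ × ℕ
  | 0, n => n.unpair
  | d + 1, n => (Nat.pair n.unpair.1 (splitLast d n.unpair.2).1, (splitLast d n.unpair.2).2)

theorem computable_splitLast (d : ℕ) : Computable (splitLast d) := by
  induction d with
  | zero => exact Computable.unpair
  | succ d ih =>
    have : Computable fun n : ℕ => splitLast d n.unpair.2 := ih.comp (by fun_prop)
    change Computable fun n : ℕ =>
      (Nat.pair n.unpair.1 (splitLast d n.unpair.2).1, (splitLast d n.unpair.2).2)
    fun_prop

theorem altEx_splitLast (d : ℕ) (t : ℕ → ℕ → Prop) :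
    AltEx d (fun n => ∃ m, t n m) ↔ AltEx d fun n => t (splitLast d n).1 (splitLast d n).2 := by
  induction d generalizing t with
  | zero =>
    simp only [AltEx, splitLast]
    constructor
    · rintro ⟨n, m, h⟩
      exact ⟨Nat.pair n m, by simpa using h⟩
    · rintro ⟨n, h⟩
      exact ⟨_, _, h⟩
  | succ d ih =>
    simp only [AltEx, splitLast, Nat.unpair_pair]
    exact exists_congr fun n => not_congr (ih fun k => t (Nat.pair n k))

/-- Bits that can be computed from a name of a point and decide, through alternating quantifiers,
its membership in the sets with names `h q`. -/
noncomputable def memBit (D d : ℕ) (h : ℕ → ℕ → ℕ) (s : ℕ → ℕ) (p : ℕ × ℕ) : Bool :=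
  (vecCode D).near (s (splitLast d p.2).2) (splitLast d p.2).2 (h p.1 (splitLast d p.2).1)

theorem ocomp_memBit (D d : ℕ) {h : ℕ → ℕ → ℕ} (hh : Computable fun p : ℕ × ℕ => h p.1 p.2)
    {P : (ℕ → ℕ) → Prop} : OComp P (memBit D d h) := by
  have e1 : Computable fun p : ℕ × ℕ => splitLast d p.2 :=
    (computable_splitLast d).comp (by fun_prop)
  have e2 : Computable fun p : ℕ × ℕ => h p.1 (splitLast d p.2).1 :=
    hh.comp (g := fun p : ℕ × ℕ => (p.1, (splitLast d p.2).1)) (by fun_prop)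
  have e3 : OComp P fun s (p : ℕ × ℕ) => s (splitLast d p.2).2 :=
    OComp.query (f := fun p : ℕ × ℕ => (splitLast d p.2).2) (by fun_prop)
  have e4 : OComp P fun _ (p : ℕ × ℕ) => ((splitLast d p.2).2, h p.1 (splitLast d p.2).1) :=
    OComp.of_computable (by fun_prop)
  exact OComp.computable_comp (g := fun q : ℕ × ℕ × ℕ => (vecCode D).near q.1 q.2.1 q.2.2)
    (by fun_prop) (e3.pair e4)

/-- Membership of `x` in a ball is existential in a name of `x`, and this quantifier merges with the
innermost one of the name of `T`. -/
theorem mem_iff_memBit {D : ℕ} {X : Set (EuclideanSpace ℝ (Fin D))} {d : ℕ} {h : ℕ → ℕ → ℕ}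
    {q : ℕ} {T : Set X} (hT : IsSigmaSeq X (d + 1) (h q) T) {x : X} {s : ℕ → ℕ}
    (hs : IsNameOn X s x) : x ∈ T ↔ AltEx d fun n => memBit D d h s (q, n) = true := by
  rw [hT.mem_iff]
  simp only [(vecCode D).mem_ratBall_iff_near hs]
  exact altEx_splitLast d _

end AltEx

/-! Lower cuts from measurability -/

section LowerCuts

/-- Suprema and infima of two values act as existential and universal quantifiers. Each negation
exchanges the roles of `lo` and `hi`, whence the parity of `d`. -/
theorem iter_eq_ite (d : ℕ) (B : ℕ → Bool) {lo hi : EReal} (h : lo ≤ hi) :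
    (iterSup d (fun n => bif xor (B n) d.bodd then hi else lo) =
      open Classical in if AltEx d (fun n => B n = true) then hi else lo) ∧
    (iterInf d (fun n => bif xor (B n) d.bodd then lo else hi) =
      open Classical in if AltEx d (fun n => B n = true) then lo else hi) := by
  classical
  induction d generalizing B with
  | zero =>
    simp only [iterSup, iterInf, Nat.bodd_zero, Bool.xor_false]
    by_cases hB : AltEx 0 fun n => B n = true
    · simp only [if_pos hB]
      obtain ⟨n, hn⟩ := hB
      constructor
      · refine le_antisymm (iSup_le fun k => ?_) (le_iSup_of_le n (by simp [hn]))
        cases B k <;> simp [h]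
      · refine le_antisymm (iInf_le_of_le n (by simp [hn])) (le_iInf fun k => ?_)
        cases B k <;> simp [h]
    · simp only [if_neg hB]
      simp only [AltEx, not_exists] at hB
      simp only [Bool.not_eq_true] at hB
      simp [hB]
  | succ d ih =>
    have e : ∀ (n k : ℕ) (u v : EReal), (bif xor (B (Nat.pair n k)) (d + 1).bodd then u else v) =
        bif xor (B (Nat.pair n k)) d.bodd then v else u := by
      intro n k u v
      rw [Nat.bodd_succ]
      cases B (Nat.pair n k) <;> cases d.bodd <;> rfl
    simp only [iterSup, iterInf, e]
    simp only [(ih _).1, (ih _).2]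
    by_cases hB : AltEx (d + 1) fun n => B n = true
    · simp only [if_pos hB]
      obtain ⟨n, hn⟩ := hB
      constructor
      · refine le_antisymm (iSup_le fun k => ?_) (le_iSup_of_le n (by rw [if_neg hn]))
        split_ifs <;> simp [h]
      · refine le_antisymm (iInf_le_of_le n (by rw [if_neg hn])) (le_iInf fun k => ?_)
        split_ifs <;> simp [h]
    · simp only [if_neg hB]
      simp only [AltEx, not_exists, not_not] at hB
      simp [hB]

/-- Splitting the outermost index into two. -/
def splitFirst : ℕ → ℕ → ℕ × ℕ
  | 0, r => r.unpair
  | _ + 1, r => (Nat.pair r.unpair.1.unpair.1 r.unpair.2, r.unpair.1.unpair.2)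

theorem computable_splitFirst (d : ℕ) : Computable (splitFirst d) := by
  cases d with
  | zero => exact Computable.unpair
  | succ d =>
    change Computable fun r : ℕ => (Nat.pair r.unpair.1.unpair.1 r.unpair.2, r.unpair.1.unpair.2)
    fun_prop

/-- The outermost infimum can carry an additional infimum over `k`. This allows the lower value to
be `⊥` although all entries are finite. -/
theorem iterInf_splitFirst (d : ℕ) (B : ℕ → Bool) {lo : ℕ → EReal} {hi : EReal}
    (h : ∀ k, lo k ≤ hi) :
    iterInf d (fun r => bif xor (B (splitFirst d r).1) d.bodd then lo (splitFirst d r).2 else hi) =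
      open Classical in if AltEx d (fun n => B n = true) then ⨅ k, lo k else hi := by
  classical
  cases d with
  | zero =>
    simp only [iterInf, Nat.bodd_zero, Bool.xor_false, splitFirst]
    by_cases hB : AltEx 0 fun n => B n = true
    · simp only [if_pos hB]
      obtain ⟨n, hn⟩ := hB
      refine le_antisymm (le_iInf fun k => iInf_le_of_le (Nat.pair n k) (by simp [hn]))
        (le_iInf fun r => ?_)
      cases B r.unpair.1
      · exact (iInf_le _ 0).trans (h 0)
      · exact iInf_le _ _
    · simp only [if_neg hB]
      simp only [AltEx, not_exists] at hB
      simp only [Bool.not_eq_true] at hB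
      simp [hB]
  | succ d =>
    have e : ∀ (r k : ℕ), (bif xor (B (splitFirst (d + 1) (Nat.pair r k)).1) (d + 1).bodd
          then lo (splitFirst (d + 1) (Nat.pair r k)).2 else hi) =
        bif xor (B (Nat.pair r.unpair.1 k)) d.bodd then hi else lo r.unpair.2 := by
      intro r k
      simp only [splitFirst, Nat.unpair_pair, Nat.bodd_succ]
      cases B (Nat.pair r.unpair.1 k) <;> cases d.bodd <;> rfl
    simp only [iterInf, e]
    have e2 : ∀ r : ℕ, iterSup d (fun k => bif xor (B (Nat.pair r.unpair.1 k)) d.bodd then hi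
        else lo r.unpair.2) = if AltEx d (fun k => B (Nat.pair r.unpair.1 k) = true) then hi
        else lo r.unpair.2 := fun r =>
      (iter_eq_ite d (fun k => B (Nat.pair r.unpair.1 k)) (h r.unpair.2)).1
    simp only [e2]
    by_cases hB : AltEx (d + 1) fun n => B n = true
    · simp only [if_pos hB]
      obtain ⟨n, hn⟩ := hB
      refine le_antisymm (le_iInf fun k => iInf_le_of_le (Nat.pair n k) ?_) (le_iInf fun r => ?_)
      · simp [hn]
      · split_ifs
        · exact (iInf_le _ 0).trans (h 0)
        · exact iInf_le _ _
    · simp only [if_neg hB]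
      simp only [AltEx, not_exists, not_not] at hB
      simp [hB]

theorem iInf_sub_natCast (q : ℝ) : ⨅ k : ℕ, ((q - k : ℝ) : EReal) = ⊥ := by
  rw [eq_bot_iff]
  refine le_of_forall_gt fun c hc => ?_
  obtain ⟨r, -, hr⟩ := EReal.lt_iff_exists_real_btwn.1 hc
  obtain ⟨k, hk⟩ := exists_nat_gt (q - r)
  exact (iInf_le _ k).trans_lt (lt_trans (EReal.coe_lt_coe_iff.2 (by linarith)) hr)

theorem eq_iSup_of_cut {ι : Type*} {y : ℝ} {v : ι → EReal} (h1 : ∀ i, v i ≤ y)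
    (h2 : ∀ q, realPt q < y → ∃ i, (realPt q : EReal) ≤ v i) : (y : EReal) = ⨆ i, v i := by
  refine le_antisymm (le_of_forall_lt fun c hc => ?_) (iSup_le h1)
  obtain ⟨q, hq1, hq2⟩ := exists_realPt_between_ereal hc
  obtain ⟨i, hi⟩ := h2 q (EReal.coe_lt_coe_iff.1 hq2)
  exact hq1.trans_le (hi.trans (le_iSup v i))

variable {D : ℕ} {X : Set (EuclideanSpace ℝ (Fin D))} {f : X → ℝ}

/-- `f x` is the supremum of the rationals `q < f x`; the other `q` must contribute nothing although
names have finite entries. For `d = 0` they are replaced by a rational below `f x` found by search.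
For larger `d`, the value `⊥` is produced as the infimum of `q - k` over `k`. -/
theorem isComputableFun_rhoLowerJump_of_names {d : ℕ} {h : ℕ → ℕ → ℕ}
    (hh : Computable fun p : ℕ × ℕ => h p.1 p.2)
    (hf : ∀ q, IsSigmaSeq X (d + 1) (h q) (f ⁻¹' Set.Ioi (realPt q))) :
    IsComputableFun (rhoOn X) (rhoLowerJump d) f := by
  have hcut : ∀ {s : ℕ → ℕ} {x : X}, IsNameOn X s x → ∀ q, realPt q < f x ↔
      AltEx d fun n => memBit D d h s (q, n) = true := fun hs q => mem_iff_memBit (hf q) hs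
  refine isComputableFun_ofSeq_iff.2 ?_
  cases d with
  | zero =>
    classical
    let P : (ℕ → ℕ) → Prop := fun s => ∃ x, IsNameOn X s x
    have hb : OComp P fun s (p : Unit × ℕ) => memBit D 0 h s p.2.unpair :=
      (ocomp_memBit D 0 hh).comp_computable (g := fun p : Unit × ℕ => p.2.unpair) (by fun_prop)
    have hex : ∀ s, P s → ∃ n : ℕ, memBit D 0 h s n.unpair = true := by
      rintro s ⟨x, hs⟩
      obtain ⟨q, -, hq⟩ := exists_realPt_between (sub_one_lt (f x))
      obtain ⟨n, hn⟩ := (hcut hs q).1 hq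
      exact ⟨Nat.pair q n, by simpa using hn⟩
    let G : (ℕ → ℕ) → Unit → ℕ := fun s _ =>
      if hs : ∃ n : ℕ, memBit D 0 h s n.unpair = true then Nat.find hs else 0
    have hG : ∀ s, P s → memBit D 0 h s (G s ()).unpair = true ∧
        ∀ m < G s (), memBit D 0 h s m.unpair = false := by
      intro s hs
      simp only [G, dif_pos (hex s hs)]
      exact ⟨Nat.find_spec (hex s hs), fun m hm => by simpa using Nat.find_min (hex s hs) hm⟩
    have hGc : OComp P G := OComp.find hb fun s hs _ => hG s hs
    refine ⟨fun s n => bif memBit D 0 h s n.unpair then n.unpair.1 else (G s ()).unpair.1, ?_, ?_⟩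
    · have e1 : OComp P fun s (n : ℕ) => memBit D 0 h s n.unpair :=
        (ocomp_memBit D 0 hh).comp_computable (g := fun n : ℕ => n.unpair) (by fun_prop)
      have e2 : OComp P fun s (_ : ℕ) => G s () :=
        hGc.comp_computable (g := fun _ : ℕ => ()) (by fun_prop)
      have e3 : OComp P fun _ (n : ℕ) => n := OComp.of_computable (by fun_prop)
      exact OComp.computable_comp (g := fun q : Bool × ℕ × ℕ =>
        bif q.1 then q.2.2.unpair.1 else q.2.1.unpair.1) (by fun_prop) (e1.pair (e2.pair e3))
    · intro s x hs
      have hlt : ∀ n : ℕ, memBit D 0 h s n.unpair = true → realPt n.unpair.1 < f x := fun n hn =>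
        (hcut hs _).2 ⟨n.unpair.2, hn⟩
      change (f x : EReal) = iterSup 0 _
      rw [iterSup]
      refine eq_iSup_of_cut (fun n => ?_) fun q hq => ?_
      · refine EReal.coe_le_coe_iff.2 (le_of_lt ?_)
        cases hn : memBit D 0 h s n.unpair with
        | false => simpa only [hn, cond_false] using hlt _ (hG s ⟨x, hs⟩).1
        | true => simpa only [hn, cond_true] using hlt _ hn
      · obtain ⟨n, hn⟩ := (hcut hs q).1 hq
        refine ⟨Nat.pair q n, ?_⟩
        simp only [Nat.unpair_pair, hn, cond_true, le_refl]
  | succ d =>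
    refine ⟨fun s n => bif xor (memBit D (d + 1) h s (n.unpair.1.unpair.1,
      Nat.pair n.unpair.1.unpair.2 (splitFirst d n.unpair.2).1)) d.bodd then
        rsub n.unpair.1.unpair.1 (Nat.pair (Nat.pair (splitFirst d n.unpair.2).2 0) 0)
      else n.unpair.1.unpair.1, ?_, ?_⟩
    · have e0 : Computable fun n : ℕ => splitFirst d n.unpair.2 :=
        (computable_splitFirst d).comp (by fun_prop)
      have e1 := (ocomp_memBit D (d + 1) hh (P := fun s => ∃ x, IsNameOn X s x)).comp_computable
        (g := fun n : ℕ => (n.unpair.1.unpair.1,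
          Nat.pair n.unpair.1.unpair.2 (splitFirst d n.unpair.2).1)) (by fun_prop)
      have e3 : OComp (fun s => ∃ x, IsNameOn X s x) fun _ (n : ℕ) => n :=
        OComp.of_computable (by fun_prop)
      have e4 : Computable fun b : Bool => xor b d.bodd := (Primrec.dom_bool _).to_comp
      have e5 : Computable fun q : Bool × ℕ => bif xor q.1 d.bodd then
          rsub q.2.unpair.1.unpair.1 (Nat.pair (Nat.pair (splitFirst d q.2.unpair.2).2 0) 0)
          else q.2.unpair.1.unpair.1 := by
        have e6 : Computable fun q : Bool × ℕ => splitFirst d q.2.unpair.2 :=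
          (computable_splitFirst d).comp (by fun_prop)
        exact computable_cond (e4.comp Computable.fst) (by fun_prop) (by fun_prop)
      exact OComp.computable_comp e5 (e1.pair e3)
    · intro s x hs
      classical
      have key : ∀ i : ℕ, (iterInf d fun k => (realPt (bif xor (memBit D (d + 1) h s (i.unpair.1,
          Nat.pair i.unpair.2 (splitFirst d k).1)) d.bodd then
            rsub i.unpair.1 (Nat.pair (Nat.pair (splitFirst d k).2 0) 0)
          else i.unpair.1) : EReal)) =
          -- The pair `i` is a rational with a candidate outermost witness; `AltEx` of the remainder
          -- refutes this witness.
          if AltEx d (fun k => memBit D (d + 1) h s (i.unpair.1, Nat.pair i.unpair.2 k) = true)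
          then ⊥ else (realPt i.unpair.1 : EReal) := by
        intro i
        have e : ∀ (c : Bool) (k : ℕ), ((realPt (bif c then
            rsub i.unpair.1 (Nat.pair (Nat.pair k 0) 0) else i.unpair.1) : ℝ) : EReal) =
            bif c then ((realPt i.unpair.1 - k : ℝ) : EReal) else (realPt i.unpair.1 : EReal) := by
          intro c k
          cases c
          · rfl
          · simp only [cond_true, realPt, ratNum_rsub, ratNum_natCast]
            push_cast
            rfl
        simp only [e]
        rw [iterInf_splitFirst d (fun k => memBit D (d + 1) h s (i.unpair.1,
          Nat.pair i.unpair.2 k)) (lo := fun k => ((realPt i.unpair.1 - k : ℝ) : EReal))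
          (fun k => EReal.coe_le_coe_iff.2 (by simp)), iInf_sub_natCast]
      rw [iterSup]
      simp only [Nat.unpair_pair]
      simp only [key]
      refine eq_iSup_of_cut (fun i => ?_) fun q hq => ?_
      · split_ifs with hi
        · exact bot_le
        · exact EReal.coe_le_coe_iff.2 ((hcut hs _).2 ⟨_, hi⟩).le
      · obtain ⟨n, hn⟩ := (hcut hs q).1 hq
        refine ⟨Nat.pair q n, ?_⟩
        simp only [Nat.unpair_pair]
        rw [if_neg hn]

/-- Only rational cuts are needed, and the constant sequences are names of rationals uniformly in
their codes. -/
theorem isComputableFun_rhoLowerJump {d : ℕ}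
    (hf : IsComputableFun rhoUpper (deltaSigma X (d + 1)) fun y : ℝ => f ⁻¹' Set.Ioi y) :
    IsComputableFun (rhoOn X) (rhoLowerJump d) f := by
  obtain ⟨F, hFc, hF⟩ := isComputableFun_ofSeq_iff.1 hf
  have hname : ∀ q : ℕ, ((realPt q : ℝ) : EReal) = ⨅ _ : ℕ, (realPt q : EReal) := fun q =>
    iInf_const.symm
  refine isComputableFun_rhoLowerJump_of_names (h := fun q => F fun _ => q)
    (hFc.computable_of_oracle (s := fun q _ => q) (by fun_prop) fun q => ⟨_, hname q⟩)
    fun q => hF _ _ (hname q)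

end LowerCuts

end TTE

namespace TTE

attribute [local irreducible] Nat.unpair Nat.pair

/-! Eventually constant iterated limits -/

section EvIter

variable {β γ : Type*}

/-- Iterated limits of discrete sequences. -/
def EvIter : ℕ → (ℕ → β) → β → Prop
  | 0, b, v => ∀ᶠ n in atTop, b n = v
  | d + 1, b, v => ∃ z : ℕ → β, (∀ n, EvIter d (fun k => b (Nat.pair n k)) (z n)) ∧
      ∀ᶠ n in atTop, z n = v

theorem EvIter.map {d : ℕ} {b : ℕ → β} {v : β} (g : β → γ) (h : EvIter d b v) :
    EvIter d (fun n => g (b n)) (g v) := by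
  induction d generalizing b v with
  | zero => exact Eventually.mono h fun n hn => congrArg g hn
  | succ d ih =>
    obtain ⟨z, h1, h2⟩ := h
    exact ⟨fun n => g (z n), fun n => ih (h1 n), h2.mono fun n hn => congrArg g hn⟩

theorem EvIter.map_range {d : ℕ} {b : ℕ → ℕ → β} {v : ℕ → β} (h : ∀ i, EvIter d (b i) (v i))
    (t : ℕ) : EvIter d (fun n => (List.range t).map fun i => b i n) ((List.range t).map v) := by
  induction d generalizing b v with
  | zero =>
    have : ∀ᶠ n in atTop, ∀ i ∈ Finset.range t, b i n = v i :=
      (Filter.eventually_all_finset _).2 fun i _ => h i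
    exact this.mono fun n hn => List.map_congr_left fun i hi =>
      hn i (Finset.mem_range.2 (List.mem_range.1 hi))
  | succ d ih =>
    choose z h1 h2 using h
    refine ⟨fun n => (List.range t).map fun i => z i n, fun n => ih fun i => h1 i n, ?_⟩
    have : ∀ᶠ n in atTop, ∀ i ∈ Finset.range t, z i n = v i :=
      (Filter.eventually_all_finset _).2 fun i _ => h2 i
    exact this.mono fun n hn => List.map_congr_left fun i hi =>
      hn i (Finset.mem_range.2 (List.mem_range.1 hi))

theorem EvIter.isIterLim {d : ℕ} {b : ℕ → ℝ} {v : ℝ} (h : EvIter d b v) : IsIterLim d b v := by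
  induction d generalizing b v with
  | zero => exact tendsto_const_nhds.congr' (Eventually.mono h fun n hn => hn.symm)
  | succ d ih =>
    obtain ⟨z, h1, h2⟩ := h
    exact ⟨z, fun n => ih (h1 n), tendsto_const_nhds.congr' (h2.mono fun n hn => hn.symm)⟩

/-- Approximations to the truth value of `AltEx e b`. -/
def altApprox : ℕ → (ℕ → Bool) → ℕ → Bool
  | 0, b, k => (List.range k).any b
  | e + 1, b, k => ((List.range k.unpair.1).map fun n =>
      altApprox e (fun r => b (Nat.pair n r)) k.unpair.2).any (!·)

open Classical in
theorem eventually_any_range {b : ℕ → Bool} {p : ℕ → Prop} (h : ∀ n, b n = true ↔ p n) :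
    ∀ᶠ k in atTop, (List.range k).any b = decide (∃ n, p n) := by
  by_cases hb : ∃ n, p n
  · obtain ⟨n, hn⟩ := hb
    filter_upwards [eventually_gt_atTop n] with k hk
    rw [decide_eq_true ⟨n, hn⟩, List.any_eq_true]
    exact ⟨n, List.mem_range.2 hk, (h n).2 hn⟩
  · refine Eventually.of_forall fun k => ?_
    rw [decide_eq_false hb, List.any_eq_false]
    exact fun n _ hn => hb ⟨n, (h n).1 hn⟩

open Classical in
-- The outermost index bounds the search for a witness. For a fixed bound only finitely many rows
-- matter, so their iterated limits can be taken simultaneously; the bounded answer then stabilises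
-- as the bound grows.
theorem evIter_altApprox (e : ℕ) (b : ℕ → Bool) :
    EvIter e (altApprox e b) (decide (AltEx e fun n => b n = true)) := by
  induction e generalizing b with
  | zero => exact eventually_any_range fun n => Iff.rfl
  | succ e ih =>
    refine ⟨fun n => ((List.range n).map fun i =>
      decide (AltEx e fun r => b (Nat.pair i r) = true)).any (!·), fun n => ?_, ?_⟩
    · simp only [altApprox, Nat.unpair_pair]
      exact (EvIter.map_range (fun i => ih fun r => b (Nat.pair i r)) n).map fun l => l.any (!·)
    · simp only [List.any_map]
      exact eventually_any_range fun n => by simp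

theorem ocomp_altApprox {α : Type*} [Primcodable α] {P : (ℕ → ℕ) → Prop} (e : ℕ)
    {F : (ℕ → ℕ) → α × ℕ → Bool} (hF : OComp P F) :
    OComp P fun s (p : α × ℕ) => altApprox e (fun r => F s (p.1, r)) p.2 := by
  induction e generalizing α with
  | zero =>
    have h1 : OComp P fun s (p : (α × ℕ) × ℕ) => F s (p.1.1, p.2) :=
      hF.comp_computable (g := fun p : (α × ℕ) × ℕ => (p.1.1, p.2)) (by fun_prop)
    have h2 := OComp.computable_comp (g := fun l : List Bool => l.any id) (by fun_prop)
      (h1.map_range (f := fun p : α × ℕ => p.2) (by fun_prop))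
    simpa only [altApprox, List.any_map, Function.id_comp] using h2
  | succ e ih =>
    have h1 := ih (F := fun s (p : (α × ℕ) × ℕ) => F s (p.1.1, Nat.pair p.1.2 p.2))
      (hF.comp_computable (g := fun p : (α × ℕ) × ℕ => (p.1.1, Nat.pair p.1.2 p.2)) (by fun_prop))
    have h2 := h1.comp_computable
      (g := fun p : (α × ℕ) × ℕ => ((p.1.1, p.2), p.1.2.unpair.2)) (by fun_prop)
    exact OComp.computable_comp (g := fun l : List Bool => l.any (!·)) (by fun_prop)
      (h2.map_range (f := fun p : α × ℕ => p.2.unpair.1) (by fun_prop))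

end EvIter

/-! Limits of guesses -/

section Guess

/-- Consistency of the approximations numbered `a` and `b`, of quality `2^(-m)`. -/
def closeAt (m a b : ℕ) : Bool :=
  rlt (rsub a b) (rmul (Nat.pair (Nat.pair 2 0) 0) (rpowInv 2 m)) &&
    rlt (rsub b a) (rmul (Nat.pair (Nat.pair 2 0) 0) (rpowInv 2 m))

theorem closeAt_iff (m a b : ℕ) :
    closeAt m a b = true ↔ |realPt a - realPt b| < 2 * (1 / 2 : ℝ) ^ m := by
  have h : realPt (rmul (Nat.pair (Nat.pair 2 0) 0) (rpowInv 2 m)) = 2 * (1 / 2 : ℝ) ^ m := by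
    have := realPt_rpowInv (b := 2) (by norm_num) m
    rw [realPt] at this
    rw [realPt, ratNum_rmul, Rat.cast_mul, this, ratNum_natCast]
    norm_num
  have h' : ∀ a b, realPt (rsub a b) = realPt a - realPt b := fun a b => by
    rw [realPt, ratNum_rsub, Rat.cast_sub]; rfl
  rw [closeAt, Bool.and_eq_true, rlt_iff_realPt, rlt_iff_realPt, h, h', h', abs_lt]
  constructor
  · rintro ⟨h1, h2⟩; constructor <;> linarith
  · rintro ⟨h1, h2⟩; constructor <;> linarith

/-- The number of approximations before the first inconsistency. -/
def consistentUpTo (l : List Bool) (g : ℕ → ℕ) : ℕ :=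
  ((List.range l.length).find? fun M =>
    (List.range (M + 1)).any fun m => !closeAt m (g m) (g (M + 1))).getD l.length

/-- The least index without a violation recorded in `l`. -/
def guess (l : List Bool) (m : ℕ) : ℕ :=
  ((List.range l.length).find? fun j => (List.range l.length).all fun n =>
    !decide (l[Nat.pair m (Nat.pair j n)]? = some true)).getD 0

/-- The best approximation suggested by a list of violations. -/
def estimate (l : List Bool) : ℕ :=
  (guess l (consistentUpTo l fun m => (guess l m).unpair.1)).unpair.1

theorem computable_guess {α : Type*} [Primcodable α] {l : α → List Bool} {m : α → ℕ}
    (hl : Computable l) (hm : Computable m) : Computable fun a => guess (l a) (m a) := by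
  unfold guess
  fun_prop

theorem computable_estimate : Computable estimate := by
  have h1 : Computable fun l : List Bool =>
      consistentUpTo l fun m => (guess l m).unpair.1 := by
    unfold consistentUpTo closeAt
    have e1 : Computable fun q : (List Bool × ℕ) × ℕ => guess q.1.1 q.2 :=
      computable_guess (by fun_prop) (by fun_prop)
    have e2 : Computable fun q : (List Bool × ℕ) × ℕ => guess q.1.1 (q.1.2 + 1) :=
      computable_guess (by fun_prop) (by fun_prop)
    fun_prop
  exact computable_fst (computable_unpair (computable_guess Computable.id h1))

/-- Each index below the least unviolated one has a violation, which is eventually seen, while that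
index itself is never rejected. -/
theorem eventually_guess {V : ℕ → Bool} {m : ℕ}
    (h : ∃ j, ∀ n, V (Nat.pair m (Nat.pair j n)) = false) :
    ∃ j, (∀ n, V (Nat.pair m (Nat.pair j n)) = false) ∧
      ∀ᶠ t in atTop, guess ((List.range t).map V) m = j := by
  classical
  refine ⟨Nat.find h, Nat.find_spec h, ?_⟩
  have h1 : ∀ j ∈ Finset.range (Nat.find h), ∀ᶠ t in atTop, ∃ n < t,
      ((List.range t).map V)[Nat.pair m (Nat.pair j n)]? = some true := by
    intro j hj
    have := Nat.find_min h (Finset.mem_range.1 hj)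
    push Not at this
    obtain ⟨n, hn⟩ := this
    filter_upwards [eventually_gt_atTop n, eventually_gt_atTop (Nat.pair m (Nat.pair j n))]
      with t ht1 ht2
    refine ⟨n, ht1, ?_⟩
    simpa [List.getElem?_range ht2] using hn
  filter_upwards [(Filter.eventually_all_finset _).2 h1, eventually_gt_atTop (Nat.find h)]
    with t ht1 ht2
  have : (List.range t).find? (fun j => (List.range t).all fun n =>
      !decide (((List.range t).map V)[Nat.pair m (Nat.pair j n)]? = some true)) =
      some (Nat.find h) := by
    simp only [List.find?_range_eq_some, List.all_eq_true, List.mem_range]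
    refine ⟨fun n hn => ?_, ht2, fun j hj => ?_⟩
    · have hV := Nat.find_spec h n
      rcases lt_or_ge (Nat.pair m (Nat.pair (Nat.find h) n)) t with hlt | hge
      · simp [List.getElem?_range hlt, hV]
      · simp [hge]
    · obtain ⟨n, hn, e⟩ := ht1 j (Finset.mem_range.2 hj)
      rw [Bool.not_eq_true', List.all_eq_false]
      exact ⟨n, List.mem_range.2 hn, by simp only [e]; simp⟩
  rw [guess, List.length_map, List.length_range, this]
  rfl

/-- For each `m` the guess is eventually accurate to `2^(-m)`, but not uniformly in `m`, so a fixed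
choice of `m` depending on `t` may fail. The choice of the last consistent level is safe: it may be
too optimistic, but its value is then still close to the earlier, accurate guesses. -/
theorem tendsto_of_consistent {g : ℕ → ℕ → ℕ} {l : ℕ → List Bool} {y : ℝ}
    (hl : ∀ t, (l t).length = t)
    (h : ∀ m, ∀ᶠ t in atTop, |realPt (g t m) - y| < (1 / 2 : ℝ) ^ m) :
    Tendsto (fun t => realPt (g t (consistentUpTo (l t) (g t)))) atTop (𝓝 y) := by
  -- Accurate guesses are consistent: the two errors sum to less than `2 * 2^(-m)`, the tolerance of
  -- `closeAt`.
  have hlev : ∀ M, ∀ᶠ t in atTop, M ≤ consistentUpTo (l t) (g t) := by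
    intro M
    have := (Filter.eventually_all_finset (Finset.range (M + 1))).2 fun m _ => h m
    filter_upwards [this, eventually_ge_atTop M] with t ht htM
    rw [consistentUpTo, hl]
    cases hf : (List.range t).find? (fun M => (List.range (M + 1)).any fun m =>
        !closeAt m (g t m) (g t (M + 1))) with
    | none => exact htM
    | some M1 =>
      rw [Option.getD_some]
      by_contra! hlt
      rw [List.find?_range_eq_some] at hf
      obtain ⟨hany, -, -⟩ := hf
      obtain ⟨m, hm, hc⟩ := List.any_eq_true.1 hany
      rw [List.mem_range] at hm
      rw [Bool.not_eq_true', ← Bool.not_eq_true, closeAt_iff] at hc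
      refine hc ?_
      have b1 := ht m (Finset.mem_range.2 (by omega))
      have b2 := ht (M1 + 1) (Finset.mem_range.2 (by omega))
      have b3 : (1 / 2 : ℝ) ^ (M1 + 1) ≤ (1 / 2 : ℝ) ^ m :=
        pow_le_pow_of_le_one (by norm_num) (by norm_num) (by omega)
      rw [abs_lt] at b1 b2 ⊢
      constructor <;> linarith
  refine Metric.tendsto_atTop'.2 fun ε hε => ?_
  -- One third for the error of guess `M`, two thirds for its distance to the chosen guess.
  obtain ⟨M, hM⟩ := exists_pow_lt_of_lt_one (show 0 < ε / 3 by linarith)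
    (show (1 / 2 : ℝ) < 1 by norm_num)
  obtain ⟨N, hN⟩ := eventually_atTop.1 ((h M).and (hlev M))
  refine ⟨N, fun t ht => ?_⟩
  obtain ⟨hd, hle⟩ := hN t ht.le
  have hc : |realPt (g t M) - realPt (g t (consistentUpTo (l t) (g t)))| <
      2 * (1 / 2 : ℝ) ^ M := by
    rcases hle.eq_or_lt with heq | hlt
    · rw [← heq, sub_self, abs_zero]
      positivity
    · rw [← closeAt_iff]
      obtain ⟨L, hL⟩ : ∃ L, consistentUpTo (l t) (g t) = L + 1 := ⟨_, (Nat.succ_pred (by omega)).symm⟩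
      rw [hL] at hlt ⊢
      rw [consistentUpTo, hl] at hL
      have hno : ((List.range (L + 1)).any fun m => !closeAt m (g t m) (g t (L + 1))) = false := by
        cases hf : (List.range t).find? (fun M => (List.range (M + 1)).any fun m =>
            !closeAt m (g t m) (g t (M + 1))) with
        | none =>
          rw [hf, Option.getD_none] at hL
          rw [List.find?_eq_none] at hf
          simpa only [Bool.not_eq_true] using hf L (List.mem_range.2 (by omega))
        | some M1 =>
          rw [hf, Option.getD_some] at hL
          rw [List.find?_range_eq_some] at hf
          have := hf.2.2 L (by omega)
          simpa only [Bool.not_eq_true'] using this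
      rw [List.any_eq_false] at hno
      simpa using hno M (List.mem_range.2 (by omega))
  rw [Real.dist_eq]
  rw [abs_lt] at *
  constructor <;> linarith

theorem tendsto_estimate {V : ℕ → Bool} {y : ℝ}
    (hex : ∀ m, ∃ j, ∀ n, V (Nat.pair m (Nat.pair j n)) = false)
    (hV : ∀ m j, (∀ n, V (Nat.pair m (Nat.pair j n)) = false) →
      |realPt j.unpair.1 - y| < (1 / 2 : ℝ) ^ m) :
    Tendsto (fun t => realPt (estimate ((List.range t).map V))) atTop (𝓝 y) := by
  refine tendsto_of_consistent (g := fun t m => (guess ((List.range t).map V) m).unpair.1)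
    (l := fun t => (List.range t).map V) (fun t => by simp) fun m => ?_
  obtain ⟨j, hj, ht⟩ := eventually_guess (hex m)
  filter_upwards [ht] with t ht
  rw [ht]
  exact hV m j hj

end Guess

/-! Points from measurability -/

section Converse

variable {D : ℕ} {X : Set (EuclideanSpace ℝ (Fin D))} {f : X → ℝ}

/-- A rational `q` with `|q - f x| < 2^(-m)` has to be found for all `m`. For `d = 0` this is a
search. For larger `d` a pair of `q` and an outermost witness is correct iff it has no violation;
guessing such pairs takes one limit, and deciding violations takes the other `d - 1`. -/
theorem isComputableFun_rhoJump_of_names {d : ℕ} {h : ℕ → ℕ → ℕ}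
    (hh : Computable fun p : ℕ × ℕ => h p.1 p.2)
    (hf : ∀ b, IsSigmaSeq X (d + 1) (h b) (f ⁻¹' ratBall realPt b)) :
    IsComputableFun (rhoOn X) (rhoJump d) f := by
  have hmem : ∀ {s : ℕ → ℕ} {x : X}, IsNameOn X s x → ∀ q m,
      (|realPt q - f x| < (1 / 2 : ℝ) ^ m ↔
        AltEx d fun n => memBit D d h s (Nat.pair q (rpowInv 2 m), n) = true) := by
    intro s x hs q m
    rw [← mem_iff_memBit (hf _) hs, Set.mem_preimage, ratBall, Metric.mem_ball, Nat.unpair_pair,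
      dist_comm, Real.dist_eq]
    have := realPt_rpowInv (b := 2) (by norm_num) m
    rw [realPt] at this
    rw [this]
    norm_num
  have hq : ∀ (x : X) (m : ℕ), ∃ q, |realPt q - f x| < (1 / 2 : ℝ) ^ m := by
    intro x m
    obtain ⟨q, h1, h2⟩ := exists_realPt_between
      (show f x < f x + (1 / 2 : ℝ) ^ m from lt_add_of_pos_right _ (by positivity))
    exact ⟨q, by rw [abs_lt]; constructor <;> linarith⟩
  let P : (ℕ → ℕ) → Prop := fun s => ∃ x, IsNameOn X s x
  obtain _ | _ | e := d
  · classical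
    refine isComputableFun_ofSeq_iff.2 ?_
    have hb : OComp P fun s (p : ℕ × ℕ) =>
        memBit D 0 h s (Nat.pair p.2.unpair.1 (rpowInv 2 p.1), p.2.unpair.2) :=
      (ocomp_memBit D 0 hh).comp_computable (g := fun p : ℕ × ℕ =>
        (Nat.pair p.2.unpair.1 (rpowInv 2 p.1), p.2.unpair.2)) (by fun_prop)
    have hex : ∀ s, P s → ∀ m, ∃ n : ℕ,
        memBit D 0 h s (Nat.pair n.unpair.1 (rpowInv 2 m), n.unpair.2) = true := by
      rintro s ⟨x, hs⟩ m
      obtain ⟨q, hq⟩ := hq x m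
      obtain ⟨n, hn⟩ := (hmem hs q m).1 hq
      exact ⟨Nat.pair q n, by simpa using hn⟩
    let G : (ℕ → ℕ) → ℕ → ℕ := fun s m =>
      if hs : ∃ n : ℕ, memBit D 0 h s (Nat.pair n.unpair.1 (rpowInv 2 m), n.unpair.2) = true
      then Nat.find hs else 0
    have hG : ∀ s, P s → ∀ m,
        memBit D 0 h s (Nat.pair (G s m).unpair.1 (rpowInv 2 m), (G s m).unpair.2) = true ∧
        ∀ n < G s m, memBit D 0 h s (Nat.pair n.unpair.1 (rpowInv 2 m), n.unpair.2) = false := by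
      intro s hs m
      simp only [G, dif_pos (hex s hs m)]
      exact ⟨Nat.find_spec (hex s hs m), fun n hn => by simpa using Nat.find_min (hex s hs m) hn⟩
    have hGc : OComp P G := OComp.find hb fun s hs m => hG s hs m
    refine ⟨fun s m => (G s m).unpair.1,
      OComp.computable_comp (g := fun n : ℕ => n.unpair.1) (by fun_prop) hGc, fun s x hs m => ?_⟩
    rw [dist_comm, Real.dist_eq]
    exact ((hmem hs _ m).2 ⟨_, (hG s ⟨x, hs⟩ m).1⟩).le
  · refine isComputableFun_ofSeq_iff.2 ?_
    -- The index is `⟨m, ⟨⟨q, n⟩, k⟩⟩`: precision, rational with outermost witness, possible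
    -- violation.
    let V : (ℕ → ℕ) → ℕ → Bool := fun s i => memBit D 1 h s
      (Nat.pair i.unpair.2.unpair.1.unpair.1 (rpowInv 2 i.unpair.1),
        Nat.pair i.unpair.2.unpair.1.unpair.2 i.unpair.2.unpair.2)
    have hVc : OComp P fun s (p : ℕ × ℕ) => V s p.2 :=
      (ocomp_memBit D 1 hh).comp_computable (g := fun p : ℕ × ℕ =>
        (Nat.pair p.2.unpair.2.unpair.1.unpair.1 (rpowInv 2 p.2.unpair.1),
          Nat.pair p.2.unpair.2.unpair.1.unpair.2 p.2.unpair.2.unpair.2)) (by fun_prop)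
    refine ⟨fun s t => estimate ((List.range t).map (V s)),
      OComp.computable_comp computable_estimate (hVc.map_range (f := fun t : ℕ => t) (by fun_prop)),
      fun s x hs => ?_⟩
    refine tendsto_estimate (fun m => ?_) fun m j hj => ?_
    · obtain ⟨q, hq⟩ := hq x m
      obtain ⟨n, hn⟩ := (hmem hs q m).1 hq
      refine ⟨Nat.pair q n, fun k => ?_⟩
      simp only [V, Nat.unpair_pair]
      simpa [AltEx] using not_exists.1 hn k
    · refine (hmem hs _ m).2 ⟨j.unpair.2, ?_⟩
      rintro ⟨n, hn⟩
      have := hj n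
      simp only [V, Nat.unpair_pair] at this
      simp [this] at hn
  · classical
    refine isComputableFun_ofSeq_iff.2 ?_
    -- The violation indexed by `i` is now the failure of an `AltEx e` statement over `r`, whose
    -- truth value is an `(e + 1)`-fold limit.
    let b : (ℕ → ℕ) → ℕ → ℕ → Bool := fun s i r => memBit D (e + 2) h s
      (Nat.pair i.unpair.2.unpair.1.unpair.1 (rpowInv 2 i.unpair.1),
        Nat.pair i.unpair.2.unpair.1.unpair.2 (Nat.pair i.unpair.2.unpair.2 r))
    have hbc : OComp P fun s (p : ℕ × ℕ) => b s p.1 p.2 :=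
      (ocomp_memBit D (e + 2) hh).comp_computable (g := fun p : ℕ × ℕ =>
        (Nat.pair p.1.unpair.2.unpair.1.unpair.1 (rpowInv 2 p.1.unpair.1),
          Nat.pair p.1.unpair.2.unpair.1.unpair.2 (Nat.pair p.1.unpair.2.unpair.2 p.2)))
        (by fun_prop)
    have hac : OComp P fun s (p : ℕ × ℕ) => !altApprox e (b s p.2) p.1.unpair.2 := by
      have := OComp.computable_comp (g := fun c : Bool => !c) (by fun_prop) (ocomp_altApprox e hbc)
      exact this.comp_computable (g := fun p : ℕ × ℕ => (p.2, p.1.unpair.2)) (by fun_prop)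
    refine ⟨fun s t => estimate ((List.range t.unpair.1).map fun i => !altApprox e (b s i) t.unpair.2),
      OComp.computable_comp computable_estimate
        (hac.map_range (f := fun t : ℕ => t.unpair.1) (by fun_prop)), fun s x hs => ?_⟩
    let V : ℕ → Bool := fun i => !decide (AltEx e fun r => b s i r = true)
    refine ⟨fun t => realPt (estimate ((List.range t).map V)), fun t => ?_, ?_⟩
    · simp only [Nat.unpair_pair]
      exact ((EvIter.map_range (fun i => (evIter_altApprox e (b s i)).map (!·)) t).map
        fun l => realPt (estimate l)).isIterLim
    · refine tendsto_estimate (fun m => ?_) fun m j hj => ?_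
      · obtain ⟨q, hq⟩ := hq x m
        obtain ⟨n, hn⟩ := (hmem hs q m).1 hq
        refine ⟨Nat.pair q n, fun k => ?_⟩
        simp only [V, b, Nat.unpair_pair]
        simpa [AltEx] using not_exists.1 hn k
      · refine (hmem hs _ m).2 ⟨j.unpair.2, ?_⟩
        rintro ⟨n, hn⟩
        have := hj n
        simp only [V, b, Nat.unpair_pair, Bool.not_eq_false', decide_eq_true_eq] at this
        exact hn this

theorem isComputableFun_rhoJump {d : ℕ}
    (hf : IsComputableFun (theta realPt) (deltaSigma X (d + 1)) fun V => f ⁻¹' V) :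
    IsComputableFun (rhoOn X) (rhoJump d) f := by
  obtain ⟨F, hFc, hF⟩ := isComputableFun_ofSeq_iff.1 hf
  have hname : ∀ b : ℕ, ratBall realPt b = ⋃ _ : ℕ, ratBall realPt b := fun b =>
    (Set.iUnion_const _).symm
  exact isComputableFun_rhoJump_of_names (h := fun b => F fun _ => b)
    (hFc.computable_of_oracle (s := fun b _ => b) (by fun_prop) fun b => ⟨_, hname b⟩)
    fun b => hF _ _ (hname b)

end Converse

end TTE

namespace TTE

attribute [local irreducible] Nat.unpair Nat.pair

/-! Verifying guessed truth values -/

section Truth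

theorem OComp.natRec {β : Type*} [Primcodable β] {P : (ℕ → ℕ) → Prop}
    {G : (ℕ → ℕ) → ℕ × β → β} (hG : OComp P G) (z : β) :
    OComp P fun s n => Nat.rec (motive := fun _ => β) z (fun i b => G s (i, b)) n := by
  obtain ⟨Φ, h1, h2, h3⟩ := hG
  let Ψ : List ℕ → ℕ → Option β := fun L n =>
    Nat.rec (motive := fun _ => Option β) (some z) (fun i o => o.bind fun b => Φ L (i, b)) n
  have hs : ∀ L n, Ψ L (n + 1) = (Ψ L n).bind fun b => Φ L (n, b) := fun _ _ => rfl
  refine ⟨Ψ, ?_, ?_, ?_⟩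
  · refine computable_iter (f := fun p : List ℕ × ℕ => p.2) (g := fun _ => some z)
      (h := fun p i o => o.bind fun b => Φ p.1 (i, b)) (by fun_prop) (by fun_prop) ?_
    exact computable_optionBind (by fun_prop)
      (h1.comp (g := fun q : ((List ℕ × ℕ) × ℕ × Option β) × β => (q.1.1.1, (q.1.2.1, q.2)))
        (by fun_prop))
  · intro L L' n b hL
    induction n generalizing b with
    | zero => exact fun h => h
    | succ n ih =>
      intro h
      rw [hs, Option.bind_eq_some_iff] at h ⊢
      obtain ⟨x, hx, hy⟩ := h
      exact ⟨x, ih _ hx, h2 _ _ _ _ hL hy⟩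
  · intro s hP n
    have key : ∃ k, ∀ k' ≥ k, Ψ (pfx s k') n =
        some (Nat.rec (motive := fun _ => β) z (fun i b => G s (i, b)) n) := by
      induction n with
      | zero => exact ⟨0, fun _ _ => rfl⟩
      | succ n ih =>
        obtain ⟨k, hk⟩ := ih
        obtain ⟨k', hk'⟩ := h3 s hP (n, Nat.rec (motive := fun _ => β) z (fun i b => G s (i, b)) n)
        refine ⟨max k k', fun j hj => ?_⟩
        rw [hs, hk j (le_trans (le_max_left _ _) hj), Option.bind_some,
          h2 _ _ _ _ (pfx_prefix s (le_trans (le_max_right _ _) hj)) hk']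
    obtain ⟨k, hk⟩ := key
    exact ⟨k, hk k le_rfl⟩

variable {U : ℕ → ℕ → Option ℕ} {bs : ℕ → ℕ → Bool}

/-- A local test of the entry `⟨d, a⟩` of a list that claims to contain 0 if `Sat d a` fails, and
one more than a witness if it holds. -/
def cellTest (U : ℕ → ℕ → Option ℕ) (bs : ℕ → ℕ → Bool) (L : List ℕ) (k n : ℕ) : Bool :=
  (L[k]?).elim true fun w => bif decide (k.unpair.1 = 0) then
      bif decide (w = 0) then !bs k.unpair.2 n else bs k.unpair.2 (w - 1)
    else
      bif decide (w = 0) then (U k.unpair.2 n).elim true fun a' =>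
        !decide (L[Nat.pair (k.unpair.1 - 1) a']? = some 0)
      else (U k.unpair.2 (w - 1)).elim false fun a' =>
        (L[Nat.pair (k.unpair.1 - 1) a']?).elim true fun w' => decide (w' = 0)

def truthTest (U : ℕ → ℕ → Option ℕ) (bs : ℕ → ℕ → Bool) (L : List ℕ) : Bool :=
  (List.range L.length).all fun k => (List.range L.length).all fun n => cellTest U bs L k n

theorem computable_truthTest (hU : Computable fun p : ℕ × ℕ => U p.1 p.2)
    (hbs : Computable fun p : ℕ × ℕ => bs p.1 p.2) : Computable (truthTest U bs) := by
  have e1 : Computable fun q : ((List ℕ × ℕ) × ℕ) × ℕ => bs q.1.1.2.unpair.2 q.1.2 :=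
    hbs.comp (g := fun q : ((List ℕ × ℕ) × ℕ) × ℕ => (q.1.1.2.unpair.2, q.1.2)) (by fun_prop)
  have e2 : Computable fun q : ((List ℕ × ℕ) × ℕ) × ℕ => bs q.1.1.2.unpair.2 (q.2 - 1) :=
    hbs.comp (g := fun q : ((List ℕ × ℕ) × ℕ) × ℕ => (q.1.1.2.unpair.2, q.2 - 1)) (by fun_prop)
  have e3 : Computable fun q : ((List ℕ × ℕ) × ℕ) × ℕ => U q.1.1.2.unpair.2 q.1.2 :=
    hU.comp (g := fun q : ((List ℕ × ℕ) × ℕ) × ℕ => (q.1.1.2.unpair.2, q.1.2)) (by fun_prop)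
  have e4 : Computable fun q : ((List ℕ × ℕ) × ℕ) × ℕ => U q.1.1.2.unpair.2 (q.2 - 1) :=
    hU.comp (g := fun q : ((List ℕ × ℕ) × ℕ) × ℕ => (q.1.1.2.unpair.2, q.2 - 1)) (by fun_prop)
  unfold truthTest cellTest
  refine computable_all (by fun_prop) (computable_all (by fun_prop) ?_)
  refine computable_optionElim (by fun_prop) (by fun_prop) ?_
  refine computable_cond (by fun_prop) (computable_cond (by fun_prop) (by fun_prop) e2) ?_
  exact computable_cond (by fun_prop)
    (computable_optionElim e3 (by fun_prop) (by fun_prop))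
    (computable_optionElim e4 (by fun_prop) (by fun_prop))

/-- All local tests succeed. It is enough to say that those of arbitrarily long prefixes do. -/
def IsTruth (U : ℕ → ℕ → Option ℕ) (bs : ℕ → ℕ → Bool) (W : ℕ → ℕ) : Prop :=
  ∀ N, ∃ K, N ≤ K ∧ truthTest U bs (pfx W K) = true

theorem IsTruth.cellTest {W : ℕ → ℕ} (h : IsTruth U bs W) (k n N : ℕ) :
    ∃ K, k < K ∧ N ≤ K ∧ cellTest U bs (pfx W K) k n = true := by
  obtain ⟨K, hK, this⟩ := h (k + n + N + 1)
  simp only [truthTest, List.all_eq_true, List.mem_range, length_pfx] at this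
  exact ⟨K, by omega, by omega, this k (by omega) n (by omega)⟩

/-- Induction on the level: a nonzero entry exhibits its witness, and a zero entry is tested against
every possible witness. Both tests refer only to the level below. The witnesses themselves are not
determined, but the set of zeros is. -/
theorem IsTruth.ne_zero_iff {W : ℕ → ℕ} (h : IsTruth U bs W) (d a : ℕ) :
    W (Nat.pair d a) ≠ 0 ↔ Sat (fun a n => U a n) (fun a n => bs a n = true) d a := by
  induction d generalizing a with
  | zero =>
    have key : ∀ n, (bif decide (W (Nat.pair 0 a) = 0) then !bs a n
        else bs a (W (Nat.pair 0 a) - 1)) = true := by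
      intro n
      obtain ⟨K, hk, -, this⟩ := h.cellTest (Nat.pair 0 a) n 0
      rw [TTE.cellTest, getElem?_pfx W hk] at this
      simpa using this
    constructor
    · intro hw
      have := key 0
      rw [decide_eq_false hw] at this
      exact ⟨_, this⟩
    · rintro ⟨n, hn⟩ hw
      have := key n
      rw [decide_eq_true hw] at this
      simp [hn] at this
  | succ d ih =>
    have key : ∀ n N, ∃ K, N ≤ K ∧
        (bif decide (W (Nat.pair (d + 1) a) = 0) then (U a n).elim true fun a' =>
          !decide ((pfx W K)[Nat.pair d a']? = some 0)
        else (U a (W (Nat.pair (d + 1) a) - 1)).elim false fun a' =>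
          ((pfx W K)[Nat.pair d a']?).elim true fun w' => decide (w' = 0)) = true := by
      intro n N
      obtain ⟨K, hk, hN, this⟩ := h.cellTest (Nat.pair (d + 1) a) n N
      rw [TTE.cellTest, getElem?_pfx W hk] at this
      refine ⟨K, hN, ?_⟩
      simpa only [Option.elim_some, Nat.unpair_pair, Nat.add_one_ne_zero, decide_false, cond_false,
        Nat.add_sub_cancel] using this
    constructor
    · intro hw
      obtain ⟨K, -, h1⟩ := key 0 0
      rw [decide_eq_false hw, cond_false] at h1
      cases hu : U a (W (Nat.pair (d + 1) a) - 1) with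
      | none => simp [hu] at h1
      | some a' =>
        refine ⟨_, a', hu, ?_⟩
        obtain ⟨K, hK, h2⟩ := key 0 (Nat.pair d a' + 1)
        rw [decide_eq_false hw, cond_false, hu, Option.elim_some, getElem?_pfx W hK,
          Option.elim_some, decide_eq_true_eq] at h2
        rw [← ih]
        exact not_not.2 h2
    · rintro ⟨n, a', hu, hs⟩ hw
      rw [← ih, not_not] at hs
      change U a n = some a' at hu
      obtain ⟨K, hK, h2⟩ := key n (Nat.pair d a' + 1)
      rw [decide_eq_true hw, cond_true, hu, Option.elim_some, getElem?_pfx W hK, hs] at h2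
      simp at h2

/-- Choose actual truth values and witnesses. A test that needs an entry not yet in the prefix
cannot fail, so all prefixes pass. -/
theorem exists_truthTest (U : ℕ → ℕ → Option ℕ) (bs : ℕ → ℕ → Bool) :
    ∃ W, ∀ K, truthTest U bs (pfx W K) = true := by
  classical
  let S : ℕ → ℕ → Prop := Sat (fun a n => U a n) (fun a n => bs a n = true)
  have h0 : ∀ a, ∃ w : ℕ, (w = 0 ↔ ¬ S 0 a) ∧ (w ≠ 0 → bs a (w - 1) = true) := by
    intro a
    by_cases h : S 0 a
    · obtain ⟨n, hn⟩ := id h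
      exact ⟨n + 1, by simp [h], fun _ => hn⟩
    · exact ⟨0, by simp [h], fun h => absurd rfl h⟩
  have h1 : ∀ d a, ∃ w : ℕ, (w = 0 ↔ ¬ S (d + 1) a) ∧
      (w ≠ 0 → ∃ a', U a (w - 1) = some a' ∧ ¬ S d a') := by
    intro d a
    by_cases h : S (d + 1) a
    · obtain ⟨n, a', hn⟩ := id h
      exact ⟨n + 1, by simp [h], fun _ => ⟨a', hn⟩⟩
    · exact ⟨0, by simp [h], fun h => absurd rfl h⟩
  choose w0 hw0 hw0' using h0
  choose w1 hw1 hw1' using h1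
  let V : ℕ → ℕ → ℕ := fun d a => Nat.rec (motive := fun _ => ℕ) (w0 a) (fun d _ => w1 d a) d
  have hV : ∀ d a, V d a = 0 ↔ ¬ S d a := by
    intro d a
    cases d with
    | zero => exact hw0 a
    | succ d => exact hw1 d a
  refine ⟨fun k => V k.unpair.1 k.unpair.2, fun K => ?_⟩
  have hget : ∀ (k w : ℕ), (pfx (fun k => V k.unpair.1 k.unpair.2) K)[k]? = some w →
      w = V k.unpair.1 k.unpair.2 := fun k w h => (getElem?_pfx_eq_some h).2
  simp only [truthTest, List.all_eq_true]
  intro k _ n _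
  rw [cellTest]
  cases hk : (pfx (fun k => V k.unpair.1 k.unpair.2) K)[k]? with
  | none => rfl
  | some w =>
    have hw := hget k w hk
    rw [Option.elim_some]
    generalize k.unpair.1 = d at *
    generalize k.unpair.2 = a at *
    cases d with
    | zero =>
      rw [decide_eq_true rfl, cond_true]
      by_cases hz : w = 0
      · rw [decide_eq_true hz, cond_true, Bool.not_eq_true', ← Bool.not_eq_true]
        exact fun hn => (hV 0 a).1 (hw ▸ hz) ⟨n, hn⟩
      · rw [decide_eq_false hz, cond_false, hw]
        exact hw0' a (by rw [hw] at hz; exact hz)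
    | succ d =>
      rw [decide_eq_false (Nat.succ_ne_zero d), cond_false, Nat.add_sub_cancel]
      by_cases hz : w = 0
      · rw [decide_eq_true hz, cond_true]
        cases hu : U a n with
        | none => rfl
        | some a' =>
          rw [Option.elim_some, Bool.not_eq_true', decide_eq_false_iff_not]
          intro h'
          have h0 := hget _ _ h'
          rw [Nat.unpair_pair] at h0
          exact (hV (d + 1) a).1 (hw ▸ hz) ⟨n, a', hu, (hV d a').1 h0.symm⟩
      · rw [decide_eq_false hz, cond_false]
        obtain ⟨a', hu, hs⟩ := hw1' d a (by rw [hw] at hz; exact hz)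
        rw [hw]
        change ((U a (w1 d a - 1)).elim false _) = true
        rw [hu, Option.elim_some]
        cases hk' : (pfx (fun k => V k.unpair.1 k.unpair.2) K)[Nat.pair d a']? with
        | none => rfl
        | some w' =>
          have h0 := hget _ _ hk'
          rw [Nat.unpair_pair] at h0
          rw [Option.elim_some, decide_eq_true_eq, h0]
          exact (hV d a').2 hs

/-- Whatever is computable from verifiable truth values is nondeterministically computable. -/
theorem isNondetComputableFun_const {A B : Type*} {α : Rep A} {R : (ℕ → ℕ) → B → Prop} {c : B}
    (hU : Computable fun p : ℕ × ℕ => U p.1 p.2) (hbs : Computable fun p : ℕ × ℕ => bs p.1 p.2)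
    {F : (ℕ → ℕ) → ℕ → ℕ} (hF : OComp (IsTruth U bs) F) (hR : ∀ W, IsTruth U bs W → R (F W) c) :
    IsNondetComputableFun α (ofSeq R) fun _ => c := by
  obtain ⟨Φ, h1, h2, h3⟩ := hF
  -- The guard on the length makes an infinite output possible only if the guessed string decodes to
  -- an infinite list. Otherwise a malformed guess could escape the tests and still produce output.
  let Θ : List Bool → ℕ → Option Bool := fun B n => bif decide (n < (decList B).length) then
    (Φ (decList B) n.unpair.1).map fun w => decide (w = n.unpair.2) else none
  have hΘc : Computable fun p : List Bool × ℕ => Θ p.1 p.2 :=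
    computable_cond (by fun_prop) (computable_optionMap
      (h1.comp (g := fun p : List Bool × ℕ => (decList p.1, p.2.unpair.1)) (by fun_prop))
      (by fun_prop)) (by fun_prop)
  have hΘs : ∀ B n b, Θ B n = some b ↔ n < (decList B).length ∧
      ∃ w, Φ (decList B) n.unpair.1 = some w ∧ decide (w = n.unpair.2) = b := by
    intro B n b
    by_cases h : n < (decList B).length <;> simp [Θ, h]
  have hΘ : ∀ B B' n b, B <+: B' → Θ B n = some b → Θ B' n = some b := by
    intro B B' n b hB h
    rw [hΘs] at h ⊢
    obtain ⟨hl, w, hw, hb⟩ := h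
    exact ⟨hl.trans_le (decList_mono hB).length_le, w, h2 _ _ _ _ (decList_mono hB) hw, hb⟩
  have hchk : Computable fun B => truthTest U bs (decList B) :=
    (computable_truthTest hU hbs).comp (by fun_prop)
  have hout : ∀ W, IsTruth U bs W → ∀ γ : ℕ → Bool,
      (∀ N, ∃ k, N ≤ (decList (pfx γ k)).length) →
      (∀ k, decList (pfx γ k) = pfx W (decList (pfx γ k)).length) →
      ∀ n, ∃ k, Θ (pfx γ k) n = some (seqCode (F W) n) := by
    intro W hW γ hlen hγ n
    obtain ⟨j, hj⟩ := h3 W hW n.unpair.1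
    obtain ⟨k, hk⟩ := hlen (max j (n + 1))
    refine ⟨k, (hΘs _ _ _).2 ⟨lt_of_lt_of_le (Nat.lt_succ_self n) ((le_max_right _ _).trans hk),
      F W n.unpair.1, ?_, rfl⟩⟩
    rw [hγ k]
    exact h2 _ _ _ _ (pfx_prefix W ((le_max_left _ _).trans hk)) hj
  refine ⟨streamMachine (fun g _ => g) (fun B => truthTest U bs (decList B)) hchk Θ hΘc,
    fun σ _ _ => ⟨?_, ?_⟩⟩
  · obtain ⟨W, hW'⟩ := exists_truthTest U bs
    have hW : IsTruth U bs W := fun N => ⟨N, le_rfl, hW' N⟩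
    refine ⟨streamCfg Θ (seqCode W), seqCode (F W),
      isComputation_streamCfg (g := seqCode W) (fun _ => rfl) (fun k => ?_),
      (outputs_streamCfg_iff hΘ _ _).2 (hout W hW _ exists_length_decList (decList_seqCode W)),
      F W, rfl, hR W hW⟩
    rw [decList_seqCode]
    exact hW' _
  · rintro c' τ hc hτ
    obtain ⟨γ, rfl, hγ⟩ := exists_of_isComputation hc
    rw [outputs_streamCfg_iff hΘ] at hτ
    have hlen : ∀ N, ∃ k, N ≤ (decList (pfx γ k)).length := by
      intro N
      obtain ⟨k, hk⟩ := hτ N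
      exact ⟨k, ((hΘs _ _ _).1 hk).1.le⟩
    choose κ hκ using hlen
    -- The infinite list decoded from the guesses; the default 0 is never used, since by `hκ` the
    -- prefix is long enough.
    let W : ℕ → ℕ := fun i => ((decList (pfx γ (κ (i + 1))))[i]?).getD 0
    have hW : ∀ k, decList (pfx γ k) = pfx W (decList (pfx γ k)).length := by
      intro k
      refine List.ext_getElem? fun i => ?_
      rcases lt_or_ge i (decList (pfx γ k)).length with hi | hi
      · rw [getElem?_pfx _ hi]
        have hi' : i < (decList (pfx γ (κ (i + 1)))).length := hκ (i + 1)
        have e1 := getElem?_of_prefix (decList_mono (pfx_prefix γ (le_max_left k (κ (i + 1)))))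
          (List.getElem?_eq_getElem hi)
        have e2 := getElem?_of_prefix (decList_mono (pfx_prefix γ (le_max_right k (κ (i + 1)))))
          (List.getElem?_eq_getElem hi')
        simp only [W]
        rw [List.getElem?_eq_getElem hi, List.getElem?_eq_getElem hi', Option.getD_some, ← e2, e1]
      · rw [List.getElem?_eq_none hi, List.getElem?_eq_none (by simpa using hi)]
    have hT : IsTruth U bs W := by
      intro N
      refine ⟨_, (hκ N).trans (decList_mono (pfx_prefix γ (Nat.le_succ _))).length_le, ?_⟩
      rw [← hW]
      exact hγ _
    have hτ' : τ = seqCode (F W) := by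
      funext n
      obtain ⟨k, hk⟩ := hout W hT γ (fun N => ⟨κ N, hκ N⟩) hW n
      obtain ⟨k', hk'⟩ := hτ n
      exact Option.some.inj ((hΘ _ _ _ _ (pfx_prefix γ (le_max_left k' k)) hk').symm.trans
        (hΘ _ _ _ _ (pfx_prefix γ (le_max_right k' k)) hk))
    exact ⟨F W, hτ', hR W hT⟩

end Truth

end TTE

namespace TTE

attribute [local irreducible] Nat.unpair Nat.pair

/-! A number that is no iterated limit of a computable sequence -/

section Diagonal

/-- The states `(e, a)`, in coded form, where `a` speaks about the sequence with program `e`. -/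
noncomputable def progNext (i n : ℕ) : Option ℕ :=
  (Encodable.decode (α := ℕ × LimState) i).bind fun x =>
    (limNext x.2 n).map fun a => Encodable.encode (x.1, a)

/-- The test that the entry with index `n.unpair.1` of the sequence with program `e` is computed
within `n.unpair.2` steps and lies outside a ball. -/
noncomputable def progTest (e : ℕ) (a : LimState) (n : ℕ) : Bool :=
  decide (a.2.2.2 ≤ n.unpair.1) &&
    (Nat.Partrec.Code.evaln n.unpair.2 (Denumerable.ofNat Nat.Partrec.Code e)
      (pathIdx a.2.1 n.unpair.1)).elim false fun q => outTest q a.2.2.1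

noncomputable def progBase (i n : ℕ) : Bool :=
  (Encodable.decode (α := ℕ × LimState) i).elim false fun x => progTest x.1 x.2 n

theorem computable_progNext : Computable fun p : ℕ × ℕ => progNext p.1 p.2 := by
  unfold progNext
  refine computable_optionBind (by fun_prop) (computable_optionMap
    (computable_limNext.comp (g := fun q : (ℕ × ℕ) × ℕ × LimState => (q.2.2, q.1.2)) (by fun_prop))
    (by fun_prop))

theorem computable_progBase : Computable fun p : ℕ × ℕ => progBase p.1 p.2 := by
  unfold progBase progTest
  refine computable_optionElim (by fun_prop) (by fun_prop) (computable_and (by fun_prop)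
    (computable_optionElim ?_ (by fun_prop) (by fun_prop)))
  exact Nat.Partrec.Code.primrec_evaln.to_comp.comp
    (g := fun q : (ℕ × ℕ) × ℕ × LimState => ((q.1.2.unpair.2,
      Denumerable.ofNat Nat.Partrec.Code q.2.1), pathIdx q.2.2.2.1 q.1.2.unpair.1)) (by fun_prop)

theorem sat_progNext (e d : ℕ) (a : LimState) :
    Sat (fun i n => progNext i n) (fun i n => progBase i n = true) d (Encodable.encode (e, a)) ↔
      Sat limNext (fun a n => progTest e a n = true) d a := by
  induction d generalizing a with
  | zero => simp [Sat, progBase]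
  | succ d ih =>
    simp only [Sat, progNext, Encodable.encodek, Option.bind_some, Option.map_eq_some_iff]
    constructor
    · rintro ⟨n, _, ⟨a', ha, rfl⟩, h⟩
      exact ⟨n, a', ha, fun h' => h ((ih a').2 h')⟩
    · rintro ⟨n, a', ha, h⟩
      exact ⟨n, _, ⟨a', ha, rfl⟩, fun h' => h ((ih a').1 h')⟩

/-- Bounding the running time in `progTest` makes the base statements decidable for all programs,
including partial ones. The program serves for every depth `d`. -/
theorem exists_sat_progNext_iff {p : ℕ → ℕ} (hp : Computable p) :
    ∃ e : ℕ, ∀ {d : ℕ} {y : ℝ}, IsIterLim d (fun k => realPt (p k)) y → ∀ b,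
      (Sat (fun i n => progNext i n) (fun i n => progBase i n = true) (d + 1)
        (Encodable.encode (e, ((true, [], b, 0) : LimState))) ↔ y ∈ ratBall realPt b) := by
  obtain ⟨c, hc⟩ := Nat.Partrec.Code.exists_code.1 (Partrec.nat_iff.1 hp)
  refine ⟨Encodable.encode c, fun {d y} hy b => ?_⟩
  rw [sat_progNext]
  refine sat_limNext_true (p := p) (fun path β N => ?_) hy b 0
  have hev : ∀ k m q, Nat.Partrec.Code.evaln k c m = some q → q = p m := by
    intro k m q h
    have := Nat.Partrec.Code.evaln_sound h
    rw [hc] at this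
    exact Part.mem_some_iff.1 this
  constructor
  · rintro ⟨n, hn⟩
    simp only [progTest, Bool.and_eq_true, decide_eq_true_eq, Denumerable.ofNat_encode] at hn
    obtain ⟨h1, h2⟩ := hn
    refine ⟨n.unpair.1, h1, ?_⟩
    cases h : Nat.Partrec.Code.evaln n.unpair.2 c (pathIdx path n.unpair.1) with
    | none => simp [h] at h2
    | some q =>
      rw [h, Option.elim_some, outTest_iff, hev _ _ _ h] at h2
      exact h2
  · rintro ⟨n, hN, hn⟩
    have : p (pathIdx path n) ∈ Nat.Partrec.Code.eval c (pathIdx path n) := by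
      rw [hc]
      exact Part.mem_some _
    obtain ⟨k, hk⟩ := Nat.Partrec.Code.evaln_complete.1 this
    rw [Option.mem_def] at hk
    refine ⟨Nat.pair n k, ?_⟩
    simp only [progTest, Bool.and_eq_true, decide_eq_true_eq, Denumerable.ofNat_encode,
      Nat.unpair_pair, hk, Option.elim_some, outTest_iff]
    exact ⟨hN, hn⟩

/-- The ball around the `n`-th approximation `u`, in which the `n`-th limit may be. -/
def diagBall (n u : ℕ) : ℕ :=
  Nat.pair u (rmul (Nat.pair (Nat.pair 1 0) 1) (rpowInv 3 n))

theorem mem_ratBall_diagBall {n u : ℕ} {y : ℝ} :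
    y ∈ ratBall realPt (diagBall n u) ↔ |y - realPt u| < 1 / 2 * (1 / 3 : ℝ) ^ n := by
  have h : realPt (rmul (Nat.pair (Nat.pair 1 0) 1) (rpowInv 3 n)) = 1 / 2 * (1 / 3 : ℝ) ^ n := by
    have := realPt_rpowInv (b := 3) (by norm_num) n
    rw [realPt] at this
    rw [realPt, ratNum_rmul, Rat.cast_mul, this, ratNum]
    norm_num
  rw [PointCode.mem_ratBall, diagBall, Nat.unpair_pair, h, Real.dist_eq]

/-- The code of the state that says that the `n`-th limit is in the `n`-th ball. -/
def diagState (n u : ℕ) : ℕ :=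
  Nat.pair (n.unpair.2 + 1)
    (Encodable.encode (n.unpair.1, ((true, [], diagBall n u, 0) : LimState)))

/-- The next approximation, that avoids the `n`-th limit. -/
def diagNext (w n u : ℕ) : ℕ :=
  bif decide (w = 0) then u else radd u (rmul (Nat.pair (Nat.pair 2 0) 0) (rpowInv 3 (n + 1)))

theorem realPt_diagNext (w n u : ℕ) : realPt (diagNext w n u) =
    realPt u + if w = 0 then 0 else 2 * (1 / 3 : ℝ) ^ (n + 1) := by
  unfold diagNext
  by_cases h : w = 0
  · simp [h]
  · have := realPt_rpowInv (b := 3) (by norm_num) (n + 1)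
    rw [realPt] at this
    rw [decide_eq_false h, cond_false, if_neg h, realPt, ratNum_radd, ratNum_rmul, ratNum_natCast,
      Rat.cast_add, Rat.cast_mul, this]
    norm_num [realPt]

/-- The approximations that are computed from truth values. -/
def diagSeq (W : ℕ → ℕ) (n : ℕ) : ℕ :=
  Nat.rec (motive := fun _ => ℕ) 0 (fun n u => diagNext (W (diagState n u)) n u) n

theorem ocomp_diagSeq {P : (ℕ → ℕ) → Prop} : OComp P diagSeq := by
  have h1 : OComp P fun W (p : ℕ × ℕ) => W (diagState p.1 p.2) := by
    refine OComp.query (f := fun p : ℕ × ℕ => diagState p.1 p.2) ?_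
    unfold diagState diagBall
    fun_prop
  have h2 : OComp P fun _ (p : ℕ × ℕ) => p := OComp.of_computable (by fun_prop)
  exact OComp.natRec (G := fun W (p : ℕ × ℕ) => diagNext (W (diagState p.1 p.2)) p.1 p.2)
    (OComp.computable_comp (g := fun q : ℕ × ℕ × ℕ => diagNext q.1 q.2.1 q.2.2)
      (by unfold diagNext; fun_prop) (h1.pair h2)) 0

/-- The approximations depend only on which entries vanish. Hence all successful guesses, whatever
their witnesses, give the same number. -/
theorem diagSeq_congr {W W' : ℕ → ℕ} (h : ∀ d a, W (Nat.pair d a) = 0 ↔ W' (Nat.pair d a) = 0) :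
    diagSeq W = diagSeq W' := by
  funext n
  induction n with
  | zero => rfl
  | succ n ih =>
    change diagNext (W (diagState n (diagSeq W n))) n (diagSeq W n) =
      diagNext (W' (diagState n (diagSeq W' n))) n (diagSeq W' n)
    rw [ih, diagNext, diagNext, diagState]
    simp only [h]

/-- The intervals from `u n` to `u n + 3^(-n)` are nested: a step to the right by at most two thirds
of the length leaves room for the next interval. -/
theorem exists_ternary_limit {u : ℕ → ℝ} (h1 : ∀ n, u n ≤ u (n + 1))
    (h2 : ∀ n, u (n + 1) ≤ u n + 2 * (1 / 3 : ℝ) ^ (n + 1)) :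
    ∃ c, ∀ n, u n ≤ c ∧ c ≤ u n + (1 / 3 : ℝ) ^ n := by
  have hmono : Monotone u := monotone_nat_of_le_succ h1
  have hanti : Antitone fun n => u n + (1 / 3 : ℝ) ^ n := antitone_nat_of_succ_le fun n => by
    have := h2 n
    rw [pow_succ] at *
    linarith
  have hle : ∀ m n, u m ≤ u n + (1 / 3 : ℝ) ^ n := fun m n =>
    (hmono (le_max_left m n)).trans (le_trans (le_add_of_nonneg_right (by positivity))
      (hanti (le_max_right m n)))
  exact ⟨⨆ n, u n, fun n => ⟨le_ciSup ⟨_, Set.forall_mem_range.2 fun m => hle m 0⟩ n,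
    ciSup_le fun m => hle m n⟩⟩

/-- A computable name of 0 is fed to the machine. A fast convergent output also counts as a single
limit, which covers `d = 0`. -/
theorem exists_iterLim_of_isComputableFun_const {c : ℝ} {d : ℕ}
    (h : IsComputableFun (rho realPt) (rhoJump d) fun _ : ℝ => c) :
    ∃ d' p, Computable p ∧ IsIterLim d' (fun k => realPt (p k)) c := by
  obtain ⟨q, hq⟩ := realPt_surjOn 0
  have hname : ∀ m : ℕ, dist (realPt q) (realPt q) ≤ (1 / 2 : ℝ) ^ m := fun m => by
    rw [dist_self]
    positivity
  have key : ∀ {R : (ℕ → ℕ) → ℝ → Prop},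
      IsComputableFun (rho realPt) (ofSeq R) (fun _ : ℝ => c) → ∃ p, Computable p ∧ R p c := by
    intro R h
    obtain ⟨F, hF, hR⟩ := isComputableFun_ofSeq_iff.1 h
    refine ⟨F fun _ => q, ?_, hR _ (realPt q) hname⟩
    exact (hF.computable_of_oracle (α := Unit) (s := fun _ _ => q) (by fun_prop)
      fun _ => ⟨realPt q, hname⟩).comp (g := fun n : ℕ => ((), n)) (by fun_prop)
  cases d with
  | zero =>
    obtain ⟨p, hp, hR⟩ := key h
    refine ⟨0, p, hp, tendsto_iff_dist_tendsto_zero.2 ?_⟩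
    refine squeeze_zero (fun _ => dist_nonneg) (fun m => ?_)
      (tendsto_pow_atTop_nhds_zero_of_lt_one (r := (1 / 2 : ℝ)) (by norm_num) (by norm_num))
    rw [dist_comm]
    exact hR m
  | succ d =>
    obtain ⟨p, hp, hR⟩ := key h
    exact ⟨d, p, hp, hR⟩

theorem exists_nondet_not_rhoJump : ∃ g : ℝ → ℝ,
    IsNondetComputableFun (rho realPt) (rho realPt) g ∧
      ∀ d : ℕ, ¬ IsComputableFun (rho realPt) (rhoJump d) g := by
  obtain ⟨W, hW'⟩ := exists_truthTest (fun i n => progNext i n) (fun i n => progBase i n)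
  have hW : IsTruth (fun i n => progNext i n) (fun i n => progBase i n) W :=
    fun N => ⟨N, le_rfl, hW' N⟩
  have hstep : ∀ n, realPt (diagSeq W (n + 1)) = realPt (diagSeq W n) +
      if W (diagState n (diagSeq W n)) = 0 then 0 else 2 * (1 / 3 : ℝ) ^ (n + 1) :=
    fun n => realPt_diagNext _ _ _
  obtain ⟨c, hc⟩ := exists_ternary_limit (u := fun n => realPt (diagSeq W n))
    (fun n => by
      rw [hstep]
      split_ifs
      · simp
      · exact le_add_of_nonneg_right (by positivity))
    (fun n => by
      rw [hstep]
      split_ifs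
      · exact add_le_add_right (by positivity) _
      · exact le_rfl)
  refine ⟨fun _ => c, isNondetComputableFun_const (U := fun i n => progNext i n)
    (bs := fun i n => progBase i n) computable_progNext computable_progBase
    (F := diagSeq) ocomp_diagSeq fun W' hW' m => ?_, fun d hd => ?_⟩
  · have : diagSeq W' = diagSeq W := diagSeq_congr fun d a =>
      not_iff_not.1 ((hW'.ne_zero_iff d a).trans (hW.ne_zero_iff d a).symm)
    rw [this, Real.dist_eq, abs_of_nonneg (sub_nonneg.2 (hc m).1)]
    -- Ternary precision is at least the binary precision that a `ρ`-name requires.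
    have h3 : (1 / 3 : ℝ) ^ m ≤ (1 / 2 : ℝ) ^ m := by gcongr; norm_num
    have := (hc m).2
    linarith
  · obtain ⟨d', p, hp, hlim⟩ := exists_iterLim_of_isComputableFun_const hd
    obtain ⟨e, he⟩ := exists_sat_progNext_iff hp
    -- The stage devoted to program `e` and depth `d'` tests whether `c` is within `3^(-n) / 2` of
    -- the approximation `u`. A positive answer moves the construction so that `c` is at least `u +
    -- (2/3) 3^(-n)`, a negative one keeps `c` at most `u + (1/3) 3^(-n)`; either contradicts the
    -- answer.
    obtain ⟨n, hn⟩ : ∃ n, n = Nat.pair e d' := ⟨_, rfl⟩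
    have hiff : W (diagState n (diagSeq W n)) ≠ 0 ↔
        |c - realPt (diagSeq W n)| < 1 / 2 * (1 / 3 : ℝ) ^ n := by
      rw [diagState, hW.ne_zero_iff, ← mem_ratBall_diagBall, ← he hlim]
      simp only [hn, Nat.unpair_pair]
    have h1 := hc n
    have h2 := hc (n + 1)
    have h3 : (0 : ℝ) < (1 / 3 : ℝ) ^ n := by positivity
    beta_reduce at h1 h2
    rw [hstep, pow_succ] at h2
    by_cases h0 : W (diagState n (diagSeq W n)) = 0
    · rw [if_pos h0] at h2
      refine absurd h0 (hiff.2 ?_)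
      rw [abs_lt]
      constructor <;> linarith
    · rw [if_neg h0] at h2
      have := abs_lt.1 (hiff.1 h0)
      linarith

end Diagonal

end TTE

-- The theorem assembled.

theorem theorem1 :
    (∀ (D : ℕ) (X : Set (EuclideanSpace ℝ (Fin D))), TTE.IsRecursivelyOpen X →
      ∀ (f : X → ℝ) (d : ℕ), 1 ≤ d →
        (TTE.IsComputableFun (TTE.rhoOn X) (TTE.rhoJump (d - 1)) f ↔
          TTE.IsEffectivelySigmaMeasurable d f) ∧
        (TTE.IsComputableFun (TTE.rhoOn X) (TTE.rhoLowerJump (d - 1)) f ↔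
          (∀ y : ℝ, TTE.IsBorelSigma d (f ⁻¹' Set.Ioi y)) ∧
            TTE.IsComputableFun TTE.rhoUpper (TTE.deltaSigma X d)
              fun y : ℝ => f ⁻¹' Set.Ioi y)) ∧
    ∃ g : ℝ → ℝ,
      TTE.IsNondetComputableFun (TTE.rho TTE.realPt) (TTE.rho TTE.realPt) g ∧
        ∀ d : ℕ, ¬ TTE.IsComputableFun (TTE.rho TTE.realPt) (TTE.rhoJump d) g := by
  refine ⟨fun D X hX f d hd => ?_, TTE.exists_nondet_not_rhoJump⟩
  obtain ⟨d, rfl⟩ := Nat.exists_eq_add_of_le' hd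
  rw [Nat.add_sub_cancel]
  refine ⟨⟨fun h => ?_, fun h => TTE.isComputableFun_rhoJump h.2⟩,
    ⟨fun h => ?_, fun h => TTE.isComputableFun_rhoLowerJump h.2⟩⟩
  · have h' := TTE.isComputableFun_preimage_of_rhoJump hX d h
    exact ⟨fun V hV => TTE.isBorelSigma_of_isComputableFun h'
      (TTE.exists_theta_name TTE.realCode hV), h'⟩
  · have h' := TTE.isComputableFun_preimage_of_rhoLowerJump hX d h
    exact ⟨fun y => TTE.isBorelSigma_of_isComputableFun h' (TTE.exists_rhoUpper_name y), h'⟩
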